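/- Let $p,q\ge 0$ be integers and $\mu>0$ a real number. Let $Z$ be the open set of complex $(p+q)\times p$ matrices $z=(z^A_i)$ of rank $p$, let $G_{p,q}(\mathbb C)=Z/GL(p,\mathbb C)$ be the complex Grassmann manifold and $\pi:Z\to G_{p,q}(\mathbb C)$ the projection. All functions are smooth and complex valued, and $\lambda$ is a real formal parameter. On $C^\infty(Z)[[\lambda]]$ let $$F\,\tilde *\,G=\sum_{r\ge0}\frac{\lambda^r}{r!}\sum_{A_1,\dots,A_r}\sum_{i_1,\dots,i_r}\frac{\partial^rF}{\partial z^{A_1}_{i_1}\cdots\partial z^{A_r}_{i_r}}\,\frac{\partial^rG}{\partial\bar z^{A_1}_{i_1}\cdots\partial\bar z^{A_r}_{i_r}}$$ be the Wick product. Let $C_0^\infty(Z)$ and $C_{hom}^\infty(Z)$ be the functions on $Z$ invariant under right multiplication by $U(p)$ and by $GL(p,\mathbb C)$, respectively, and put $x=z^\dagger z$. Let $$\mathcal J=\Big\{\sum_{i,j}G_{ij}\,\tilde *\,(x-\mu)_{ji}\Big\},$$ where $G$ runs over the formal power series in $\lambda$ whose coefficients are smooth functions $Z\to\mathfrak u(p)\otimes\mathbb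 C=\mathfrak{gl}(p,\mathbb C)$ with $G(zU)=U^{-1}G(z)U$ for all $U\in U(p)$. A star product on a manifold $M$ with Poisson bracket $\{\cdot,\cdot\}$ is a $\mathbb C[[\lambda]]$-bilinear associative product $f*g=\sum_r\lambda^rC_r(f,g)$ on $C^\infty(M)[[\lambda]]$ with bidifferential operators $C_r$, such that $C_0(f,g)=fg$, $C_1(f,g)-C_1(g,f)=\frac i2\{f,g\}$, the constant $1$ is the unit, and $\overline{f*g}=\bar g*\bar f$. The Poisson bracket on $G_{p,q}(\mathbb C)$ is that of the reduced phase space $\{\zeta\in Z:\zeta^\dagger\zeta=\mu 1\}/U(p)$, that is, $\{f,g\}(\pi(\zeta))=\{\pi^*f,\pi^*g\}_Z(\zeta)$ whenever $\zeta^\dagger\zeta=\mu 1$, where $$\{F,G\}_Z=\frac2i\sum_{A,i}\Big(\frac{\partial F}{\partial z^A_i}\frac{\partial G}{\partial\bar z^A_i}-\frac{\partial G}{\partial z^A_i}\frac{\partial F}{\partial\bar z^A_i}\Big)$$ is the bracket of the Kähler form $\omega=\frac i2\,\mathrm{tr}\,dz\wedge dz^\dagger$. Then $(C_0^\infty(Z)[[\lambda]],\tilde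 *)$ is an associative unital algebra, it decomposes as $C_0^\infty(Z)[[\lambda]]=C_{hom}^\infty(Z)[[\lambda]]\oplus\mathcal J$, and, if $P$ denotes the projection of $C_0^\infty(Z)[[\lambda]]$ onto $C_{hom}^\infty(Z)[[\lambda]]$ along $\mathcal J$, there exists a star product $*$ on $G_{p,q}(\mathbb C)$, with the reduced Poisson bracket, for which $$(\pi^*)^{-1}\circ P:\big(C_0^\infty(Z)[[\lambda]],\tilde *\big)\longrightarrow\big(C^\infty(G_{p,q}(\mathbb C))[[\lambda]],*\big)$$ is an epimorphism of unital $\mathbb C[[\lambda]]$-algebras. -/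

import Mathlib

open scoped ContDiff Manifold PowerSeries Matrix

namespace GrassmannStar

noncomputable section

/-! ## Matrices of full rank and the Grassmann manifold -/

/-- Complex matrices with `p + q` rows and `p` columns. -/
abbrev Mat (p q : ℕ) : Type := Matrix (Fin p ⊕ Fin q) (Fin p) ℂ

/-- The set of complex `(p+q) × p` matrices of rank `p`. -/
def fullRank (p q : ℕ) : Set (Mat p q) := {z | z.rank = p}

theorem mem_fullRank_of_mul_eq_one {p q : ℕ} {z : Mat p q}
    (y : Matrix (Fin p) (Fin p ⊕ Fin q) ℂ) (h : y * z = 1) : z ∈ fullRank p q := by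
  have h1 := Matrix.rank_mul_le_right y z
  have h2 := Matrix.rank_le_card_width z
  rw [h, Matrix.rank_one] at h1
  simp only [Fintype.card_fin] at h1 h2
  exact le_antisymm h2 h1

theorem mulVec_injective_of_mem {p q : ℕ} {z : Mat p q} (hz : z ∈ fullRank p q) :
    Function.Injective z.mulVec := by
  have h := z.mulVecLin.finrank_range_add_finrank_ker
  have hz' : Module.finrank ℂ (LinearMap.range z.mulVecLin) = p := hz
  rw [hz', Module.finrank_fin_fun] at h
  have h0 : Module.finrank ℂ (LinearMap.ker z.mulVecLin) = 0 := by omega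
  have := LinearMap.ker_eq_bot.mp (Submodule.finrank_eq_zero.mp h0)
  exact this

open scoped ComplexOrder in
theorem det_gram_ne_zero_of_injective {p q : ℕ} {z : Mat p q}
    (hz : Function.Injective z.mulVec) : (zᴴ * z).det ≠ 0 := by
  intro h
  obtain ⟨v, hv, h0⟩ := Matrix.exists_mulVec_eq_zero_iff.mpr h
  rw [Matrix.conjTranspose_mul_self_mulVec_eq_zero] at h0
  exact hv (hz (by simpa using h0))

theorem mem_fullRank_iff_det {p q : ℕ} {z : Mat p q} :
    z ∈ fullRank p q ↔ (zᴴ * z).det ≠ 0 := by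
  refine ⟨fun h => det_gram_ne_zero_of_injective (mulVec_injective_of_mem h), fun h => ?_⟩
  refine mem_fullRank_of_mul_eq_one ((zᴴ * z)⁻¹ * zᴴ) ?_
  rw [Matrix.mul_assoc, Matrix.nonsing_inv_mul _ (isUnit_iff_ne_zero.mpr h)]

theorem exists_leftInverse {p q : ℕ} {z : Mat p q} (h : z ∈ fullRank p q) :
    ∃ y : Matrix (Fin p) (Fin p ⊕ Fin q) ℂ, y * z = 1 := by
  refine ⟨(zᴴ * z)⁻¹ * zᴴ, ?_⟩
  rw [Matrix.mul_assoc, Matrix.nonsing_inv_mul _ (isUnit_iff_ne_zero.mpr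
    (mem_fullRank_iff_det.mp h))]

theorem isOpen_fullRank (p q : ℕ) : IsOpen (fullRank p q) := by
  have : fullRank p q = (fun z : Mat p q => (zᴴ * z).det) ⁻¹' {0}ᶜ := by
    ext z
    simpa using mem_fullRank_iff_det
  rw [this]
  refine isOpen_compl_singleton.preimage ?_
  exact Continuous.matrix_det (by fun_prop)

theorem mul_right_mem {p q : ℕ} {z : Mat p q} (hz : z ∈ fullRank p q)
    (g : GL (Fin p) ℂ) : z * (g : Matrix (Fin p) (Fin p) ℂ) ∈ fullRank p q := by
  obtain ⟨y, hy⟩ := exists_leftInverse hz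
  refine mem_fullRank_of_mul_eq_one ((↑g⁻¹ : Matrix (Fin p) (Fin p) ℂ) * y) ?_
  rw [Matrix.mul_assoc, ← Matrix.mul_assoc y, hy, Matrix.one_mul, Units.inv_mul]

theorem mul_left_mem {p q : ℕ} {z : Mat p q} (hz : z ∈ fullRank p q)
    (a : GL (Fin p ⊕ Fin q) ℂ) :
    (a : Matrix (Fin p ⊕ Fin q) (Fin p ⊕ Fin q) ℂ) * z ∈ fullRank p q := by
  obtain ⟨y, hy⟩ := exists_leftInverse hz
  refine mem_fullRank_of_mul_eq_one
    (y * (↑a⁻¹ : Matrix (Fin p ⊕ Fin q) (Fin p ⊕ Fin q) ℂ)) ?_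
  rw [Matrix.mul_assoc, ← Matrix.mul_assoc _ _ z, Units.inv_mul, Matrix.one_mul, hy]

/-- The space of `(p+q) × p` matrices of rank `p`, an open subset of `ℂ^{(p+q)p}`. -/
abbrev Frame (p q : ℕ) : Type := ↥(fullRank p q)

/-- The right action of `GL(p, ℂ)` on matrices of rank `p`. -/
def Frame.mul {p q : ℕ} (z : Frame p q) (g : GL (Fin p) ℂ) : Frame p q :=
  ⟨z.1 * (g : Matrix (Fin p) (Fin p) ℂ), mul_right_mem z.2 g⟩

/-- The right action of the unitary group `U(p)` on matrices of rank `p`. -/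
def Frame.mulU {p q : ℕ} (z : Frame p q) (U : Matrix.unitaryGroup (Fin p) ℂ) : Frame p q :=
  z.mul (Unitary.toUnits U)

/-- `z₁ ∼ z₂` iff `z₂ = z₁ g` for some `g ∈ GL(p, ℂ)`. -/
def frameSetoid (p q : ℕ) : Setoid (Frame p q) where
  r z₁ z₂ := ∃ g : GL (Fin p) ℂ, z₂ = z₁.mul g
  iseqv :=
    { refl := fun z => ⟨1, Subtype.ext (by simp [Frame.mul])⟩
      symm := by
        rintro z w ⟨g, rfl⟩
        exact ⟨g⁻¹, Subtype.ext (by simp [Frame.mul, Matrix.mul_assoc])⟩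
      trans := by
        rintro z w v ⟨g, rfl⟩ ⟨h, rfl⟩
        exact ⟨g * h, Subtype.ext (by simp [Frame.mul, Matrix.mul_assoc])⟩ }

/-- The complex Grassmann manifold `G_{p,q}(ℂ)`, the set of `(p+q) × p` matrices of rank `p`
modulo the right action of `GL(p, ℂ)`. -/
def Grassmann (p q : ℕ) : Type := Quotient (frameSetoid p q)

instance (p q : ℕ) : TopologicalSpace (Grassmann p q) :=
  inferInstanceAs (TopologicalSpace (Quotient (frameSetoid p q)))

/-- The projection `π` from matrices of rank `p` onto the Grassmann manifold. -/
def proj {p q : ℕ} (z : Frame p q) : Grassmann p q := Quotient.mk (frameSetoid p q) z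

theorem isQuotientMap_proj (p q : ℕ) : Topology.IsQuotientMap (proj (p := p) (q := q)) :=
  isQuotientMap_quot_mk

theorem proj_mul {p q : ℕ} (z : Frame p q) (g : GL (Fin p) ℂ) : proj (z.mul g) = proj z :=
  (Quotient.sound (s := frameSetoid p q) ⟨g, rfl⟩ : _ = _).symm

/-! ### The standard affine charts, moved around by `GL(p+q, ℂ)`

For `a ∈ GL(p+q, ℂ)` write `a z` as a `p × p` block `c` on top of a `q × p` block `b`; where `c` is
invertible, the coordinate of the class of `z` is `b c⁻¹`. -/

/-- The model space of `q × p` complex matrices, as a real normed space. -/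
abbrev Model (p q : ℕ) : Type := Fin q → Fin p → ℂ

/-- The coordinate `b c⁻¹` of `z`. -/
def chartFun {p q : ℕ} (a : GL (Fin p ⊕ Fin q) ℂ) (z : Mat p q) : Model p q :=
  Matrix.of.symm ((a.1 * z).toRows₂ * (a.1 * z).toRows₁⁻¹)

/-- The determinant of the block `c`. -/
def chartDet {p q : ℕ} (a : GL (Fin p ⊕ Fin q) ℂ) (z : Mat p q) : ℂ :=
  (a.1 * z).toRows₁.det

theorem toRows₁_mul_right {p q : ℕ} (z : Mat p q) (g : Matrix (Fin p) (Fin p) ℂ) :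
    (z * g).toRows₁ = z.toRows₁ * g := rfl

theorem toRows₂_mul_right {p q : ℕ} (z : Mat p q) (g : Matrix (Fin p) (Fin p) ℂ) :
    (z * g).toRows₂ = z.toRows₂ * g := rfl

theorem chartFun_mul {p q : ℕ} (a : GL (Fin p ⊕ Fin q) ℂ) (z : Mat p q) (g : GL (Fin p) ℂ) :
    chartFun a (z * g.1) = chartFun a z := by
  have hg : g.1 * g.1⁻¹ = 1 := Matrix.mul_nonsing_inv _
    ((Matrix.isUnit_iff_isUnit_det _).mp g.isUnit)
  rw [chartFun, chartFun, ← Matrix.mul_assoc, toRows₁_mul_right, toRows₂_mul_right,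
    Matrix.mul_inv_rev, Matrix.mul_assoc, ← Matrix.mul_assoc g.1, hg, Matrix.one_mul]

theorem chartDet_mul {p q : ℕ} (a : GL (Fin p ⊕ Fin q) ℂ) (z : Mat p q) (g : GL (Fin p) ℂ) :
    chartDet a (z * g.1) = chartDet a z * g.1.det := by
  rw [chartDet, chartDet, ← Matrix.mul_assoc, toRows₁_mul_right, Matrix.det_mul]

/-- The inverse of the chart, before projecting: `w ↦ a⁻¹ (1; w)`. -/
def chartInv {p q : ℕ} (a : GL (Fin p ⊕ Fin q) ℂ) (w : Model p q) : Frame p q :=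
  ⟨(a⁻¹).1 * Matrix.fromRows 1 (Matrix.of w), mul_left_mem
    (mem_fullRank_of_mul_eq_one (Matrix.fromCols 1 0) (by simp [Matrix.fromCols_mul_fromRows])) _⟩

theorem chartInv_spec {p q : ℕ} (a : GL (Fin p ⊕ Fin q) ℂ) (w : Model p q) :
    a.1 * (chartInv a w).1 = Matrix.fromRows 1 (Matrix.of w) := by
  simp [chartInv, ← Matrix.mul_assoc]

theorem chartFun_chartInv {p q : ℕ} (a : GL (Fin p ⊕ Fin q) ℂ)
    (w : Model p q) : chartFun a (chartInv a w).1 = w := by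
  rw [chartFun, chartInv_spec]
  simp

theorem chartDet_chartInv {p q : ℕ} (a : GL (Fin p ⊕ Fin q) ℂ)
    (w : Model p q) : chartDet a (chartInv a w).1 = 1 := by
  rw [chartDet, chartInv_spec]
  simp

theorem proj_chartInv {p q : ℕ} (a : GL (Fin p ⊕ Fin q) ℂ) (z : Frame p q)
    (h : chartDet a z.1 ≠ 0) : proj (chartInv a (chartFun a z.1)) = proj z := by
  have hu : IsUnit (a.1 * z.1).toRows₁ :=
    (Matrix.isUnit_iff_isUnit_det _).mpr (isUnit_iff_ne_zero.mpr h)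
  obtain ⟨c, hc⟩ := hu
  have hcc : c.1 * (c⁻¹).1 = 1 := by simp
  have : chartInv a (chartFun a z.1) = z.mul c⁻¹ := by
    apply Subtype.ext
    have h1 : Matrix.fromRows 1 (Matrix.of (chartFun a z.1)) = a.1 * z.1 * (c⁻¹).1 := by
      conv_rhs => rw [← Matrix.fromRows_toRows (a.1 * z.1)]
      rw [Matrix.fromRows_mul, chartFun, Equiv.apply_symm_apply, ← hc, Matrix.coe_units_inv, ← Matrix.coe_units_inv, hcc]
    rw [chartInv]
    simp only [h1, Frame.mul]
    rw [← Matrix.mul_assoc, ← Matrix.mul_assoc, ← Units.val_mul]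
    simp
  rw [this, proj_mul]

/-- The coordinate space of the matrices, as a real normed space. -/
abbrev Coord (p q : ℕ) : Type := Fin p ⊕ Fin q → Fin p → ℂ

section Smooth

variable {V : Type*} [NormedAddCommGroup V] [NormedSpace ℝ V]
  {m n : Type*}

/-- A matrix valued function is smooth at a point if all its entries are. -/
def SmoothEntries (f : V → Matrix m n ℂ) (x : V) : Prop :=
  ∀ i j, ContDiffAt ℝ ∞ (fun v => f v i j) x

theorem SmoothEntries.mul {l : Type*} [Fintype n] {x : V} {f : V → Matrix m n ℂ}
    {g : V → Matrix n l ℂ} (hf : SmoothEntries f x) (hg : SmoothEntries g x) :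
    SmoothEntries (fun v => f v * g v) x := by
  intro i j
  simp only [Matrix.mul_apply]
  exact ContDiffAt.sum fun k _ => (hf i k).mul (hg k j)

theorem SmoothEntries.const (B : Matrix m n ℂ) (x : V) : SmoothEntries (fun _ => B) x :=
  fun _ _ => contDiffAt_const

theorem SmoothEntries.det [Fintype m] [DecidableEq m] {x : V} {f : V → Matrix m m ℂ}
    (hf : SmoothEntries f x) : ContDiffAt ℝ ∞ (fun v => (f v).det) x := by
  simp only [Matrix.det_apply]
  refine ContDiffAt.sum fun σ _ => ?_
  have h : ContDiffAt ℝ ∞ (fun v => ∏ i, f v (σ i) i) x :=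
    contDiffAt_prod fun i _ => hf _ _
  simp only [Units.smul_def, zsmul_eq_mul]
  exact contDiffAt_const.mul h

theorem SmoothEntries.inv [Fintype m] [DecidableEq m] {x : V} {f : V → Matrix m m ℂ}
    (hf : SmoothEntries f x) (h0 : (f x).det ≠ 0) : SmoothEntries (fun v => (f v)⁻¹) x := by
  intro i j
  simp only [Matrix.inv_def, Matrix.smul_apply, Ring.inverse_eq_inv', smul_eq_mul,
    Matrix.adjugate_apply]
  refine (hf.det.inv h0).mul (SmoothEntries.det fun k l => ?_)
  simp only [Matrix.updateRow_apply]
  split_ifs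
  · exact contDiffAt_const
  · exact hf k l

end Smooth

theorem smoothEntries_of {p q : ℕ} (v : Coord p q) :
    SmoothEntries (fun v : Coord p q => Matrix.of v) v :=
  fun i j => contDiffAt_pi.mp (contDiffAt_pi.mp contDiffAt_id i) j

theorem contDiffAt_chartDet {p q : ℕ} (a : GL (Fin p ⊕ Fin q) ℂ) (v : Coord p q) :
    ContDiffAt ℝ ∞ (fun v : Coord p q => chartDet a (Matrix.of v)) v :=
  SmoothEntries.det fun i j =>
    ((SmoothEntries.const a.1 v).mul (smoothEntries_of v)) (Sum.inl i) j

theorem contDiffAt_chartFun {p q : ℕ} (a : GL (Fin p ⊕ Fin q) ℂ) (v : Coord p q)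
    (h0 : chartDet a (Matrix.of v) ≠ 0) :
    ContDiffAt ℝ ∞ (fun v : Coord p q => chartFun a (Matrix.of v)) v := by
  have h := (SmoothEntries.const a.1 v).mul (smoothEntries_of v)
  have h1 : SmoothEntries (fun v : Coord p q => (a.1 * Matrix.of v).toRows₁) v :=
    fun i j => h (Sum.inl i) j
  have h2 : SmoothEntries (fun v : Coord p q => (a.1 * Matrix.of v).toRows₂) v :=
    fun i j => h (Sum.inr i) j
  exact contDiffAt_pi.mpr fun i => contDiffAt_pi.mpr fun j => (h2.mul (h1.inv h0)) i j

theorem contDiff_chartInv {p q : ℕ} (a : GL (Fin p ⊕ Fin q) ℂ) :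
    ContDiff ℝ ∞ (fun w : Model p q => (Matrix.of.symm (chartInv a w).1 : Coord p q)) := by
  refine contDiff_iff_contDiffAt.mpr fun w => ?_
  have h : SmoothEntries (fun w : Model p q =>
      (Matrix.fromRows 1 (Matrix.of w) : Mat p q)) w := by
    rintro (i | i) j
    · simp only [Matrix.fromRows_apply_inl]
      exact contDiffAt_const
    · simp only [Matrix.fromRows_apply_inr]
      exact contDiffAt_pi.mp (contDiffAt_pi.mp contDiffAt_id i) j
  exact contDiffAt_pi.mpr fun i => contDiffAt_pi.mpr fun j =>
    ((SmoothEntries.const (a⁻¹).1 w).mul h) i j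

theorem continuous_val_of (p q : ℕ) :
    Continuous (fun z : Frame p q => (Matrix.of.symm z.1 : Coord p q)) :=
  continuous_subtype_val

theorem continuous_chartDet {p q : ℕ} (a : GL (Fin p ⊕ Fin q) ℂ) :
    Continuous (fun z : Frame p q => chartDet a z.1) :=
  (continuous_iff_continuousAt.mpr fun v : Coord p q =>
    (contDiffAt_chartDet a v).continuousAt).comp (continuous_val_of p q)

/-- The chart domain: classes of those `z` for which the block `c` is invertible. -/
def chartSource {p q : ℕ} (a : GL (Fin p ⊕ Fin q) ℂ) : Set (Grassmann p q) :=
  {x | ∃ z : Frame p q, proj z = x ∧ chartDet a z.1 ≠ 0}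

theorem proj_mem_chartSource {p q : ℕ} (a : GL (Fin p ⊕ Fin q) ℂ) (z : Frame p q) :
    proj z ∈ chartSource a ↔ chartDet a z.1 ≠ 0 := by
  refine ⟨?_, fun h => ⟨z, rfl, h⟩⟩
  rintro ⟨w, hw, h⟩
  obtain ⟨g, rfl⟩ := Quotient.exact (s := frameSetoid p q) hw
  rw [Frame.mul, chartDet_mul]
  exact mul_ne_zero h ((Matrix.isUnit_iff_isUnit_det _).mp g.isUnit).ne_zero

theorem isOpen_chartSource {p q : ℕ} (a : GL (Fin p ⊕ Fin q) ℂ) : IsOpen (chartSource a) := by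
  rw [← (isQuotientMap_proj p q).isOpen_preimage]
  have : proj ⁻¹' chartSource a = (fun z : Frame p q => chartDet a z.1) ⁻¹' {0}ᶜ := by
    ext z
    simpa using proj_mem_chartSource a z
  rw [this]
  exact isOpen_compl_singleton.preimage (continuous_chartDet a)

/-- The affine chart of the Grassmann manifold given by `a ∈ GL(p+q, ℂ)`. -/
def grassmannChart {p q : ℕ} (a : GL (Fin p ⊕ Fin q) ℂ) :
    OpenPartialHomeomorph (Grassmann p q) (Model p q) where
  toFun := Quotient.lift (fun z : Frame p q => chartFun a z.1) (by
    rintro z _ ⟨g, rfl⟩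
    exact (chartFun_mul a z.1 g).symm)
  invFun w := proj (chartInv a w)
  source := chartSource a
  target := Set.univ
  map_source' _ _ := Set.mem_univ _
  map_target' w _ := (proj_mem_chartSource a _).mpr (by rw [chartDet_chartInv]; exact one_ne_zero)
  left_inv' := by
    rintro _ ⟨z, rfl, h⟩
    exact proj_chartInv a z h
  right_inv' w _ := chartFun_chartInv a w
  open_source := isOpen_chartSource a
  open_target := isOpen_univ
  continuousOn_toFun := by
    refine ((isQuotientMap_proj p q).continuousOn_isOpen_iff (isOpen_chartSource a)).mpr ?_
    intro z hz
    have h1 := (contDiffAt_chartFun a (Matrix.of.symm z.1)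
      ((proj_mem_chartSource a z).mp hz)).continuousAt
    exact (ContinuousAt.comp (f := fun z : Frame p q => (Matrix.of.symm z.1 : Coord p q)) h1
      (continuous_val_of p q).continuousAt).continuousWithinAt
  continuousOn_invFun :=
    ((isQuotientMap_proj p q).continuous.comp
      ((contDiff_chartInv a).continuous.subtype_mk _)).continuousOn

theorem grassmannChart_proj {p q : ℕ} (a : GL (Fin p ⊕ Fin q) ℂ) (z : Frame p q) :
    grassmannChart a (proj z) = chartFun a z.1 := rfl

theorem grassmannChart_symm {p q : ℕ} (a : GL (Fin p ⊕ Fin q) ℂ)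
    (w : Model p q) : (grassmannChart a).symm w = proj (chartInv a w) := rfl

/-- Every matrix of rank `p` lies over some chart domain. -/
theorem exists_chartDet_ne_zero {p q : ℕ} (z : Frame p q) :
    ∃ a : GL (Fin p ⊕ Fin q) ℂ, chartDet a z.1 ≠ 0 := by
  have hli : LinearIndependent ℂ z.1.col :=
    Matrix.mulVec_injective_iff.mp (mulVec_injective_of_mem z.2)
  let b := Module.Basis.sumExtend hli
  have : Fintype (Fin p ⊕ Module.Basis.sumExtendIndex hli) := FiniteDimensional.fintypeBasisIndex b
  have hfin : Finite (Module.Basis.sumExtendIndex hli) :=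
    Finite.of_injective (Sum.inr : _ → Fin p ⊕ Module.Basis.sumExtendIndex hli)
      Sum.inr_injective
  have : Fintype (Module.Basis.sumExtendIndex hli) := Fintype.ofFinite _
  have hc := Module.finrank_eq_nat_card_basis b
  rw [Nat.card_sum, Module.finrank_pi] at hc
  simp only [Fintype.card_sum, Fintype.card_fin, Nat.card_eq_fintype_card] at hc
  let e : Module.Basis.sumExtendIndex hli ≃ Fin q :=
    Fintype.equivFinOfCardEq (by omega)
  let b' : Module.Basis (Fin p ⊕ Fin q) ℂ (Fin p ⊕ Fin q → ℂ) :=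
    b.reindex (Equiv.sumCongr (Equiv.refl _) e)
  have hb : ∀ j, b' (Sum.inl j) = z.1.col j := by
    intro j
    simp only [b', b, Module.Basis.sumExtend, Module.Basis.reindex_apply]
    simp
    rfl
  let B : Matrix (Fin p ⊕ Fin q) (Fin p ⊕ Fin q) ℂ := Matrix.of fun i j => b' j i
  have hB : IsUnit B := Matrix.linearIndependent_cols_iff_isUnit.mp b'.linearIndependent
  obtain ⟨u, hu⟩ := hB
  have hz : z.1 = u.1 * (Matrix.fromRows (1 : Matrix (Fin p) (Fin p) ℂ)
      (0 : Matrix (Fin q) (Fin p) ℂ) : Mat p q) := by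
    rw [hu]
    ext i j
    rw [Matrix.mul_apply, Fintype.sum_sum_type]
    simp [B, hb, Matrix.one_apply]
  refine ⟨u⁻¹, ?_⟩
  rw [chartDet, hz, ← Matrix.mul_assoc, ← Units.val_mul]
  simp

theorem exists_mem_chartSource {p q : ℕ} (x : Grassmann p q) :
    ∃ a : GL (Fin p ⊕ Fin q) ℂ, x ∈ chartSource a := by
  obtain ⟨z, rfl⟩ := (isQuotientMap_proj p q).surjective x
  obtain ⟨a, ha⟩ := exists_chartDet_ne_zero z
  exact ⟨a, z, rfl, ha⟩

instance (p q : ℕ) : ChartedSpace (Model p q) (Grassmann p q) where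
  atlas := Set.range grassmannChart
  chartAt x := grassmannChart (exists_mem_chartSource x).choose
  mem_chart_source x := (exists_mem_chartSource x).choose_spec
  chart_mem_atlas _ := Set.mem_range_self _

instance (p q : ℕ) : IsManifold 𝓘(ℝ, Model p q) ∞ (Grassmann p q) := by
  refine isManifold_of_contDiffOn _ _ _ ?_
  rintro _ _ ⟨a, rfl⟩ ⟨b, rfl⟩
  rintro w ⟨hw, -⟩
  have hw' : proj (chartInv a w) ∈ chartSource b := by
    simp only [Set.mem_preimage, OpenPartialHomeomorph.trans_source] at hw
    exact hw.2
  have h := contDiffAt_chartFun b _ ((proj_mem_chartSource b _).mp hw')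
  exact (h.comp w (contDiff_chartInv a).contDiffAt).contDiffWithinAt

/-! ## Smooth functions -/

/-- The algebra `C^∞(M)` of smooth complex valued functions on a real manifold `M` modelled on
the normed space `E`. -/
def smoothFn (E : Type*) [NormedAddCommGroup E] [NormedSpace ℝ E] (M : Type*) [TopologicalSpace M]
    [ChartedSpace E M] : Subalgebra ℂ (M → ℂ) where
  carrier := {f | ContMDiff 𝓘(ℝ, E) 𝓘(ℝ, ℂ) ∞ f}
  mul_mem' {_ _} hf hg := (contDiff_mul.contMDiff).comp (hf.prodMk_space hg)
  add_mem' {_ _} hf hg := (contDiff_add.contMDiff).comp (hf.prodMk_space hg)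
  algebraMap_mem' _ := contMDiff_const

/-- Pointwise complex conjugation on `C^∞(M)`. -/
def smoothFn.conj {E : Type*} [NormedAddCommGroup E] [NormedSpace ℝ E] {M : Type*}
    [TopologicalSpace M] [ChartedSpace E M] (f : smoothFn E M) : smoothFn E M :=
  ⟨fun x => starRingEnd ℂ (f.1 x), Complex.conjCLE.contDiff.contMDiff.comp f.2⟩

/-- The set of matrices of rank `p`, as an open set of the coordinate space. -/
def fullRankCoord (p q : ℕ) : Set (Coord p q) := {v | Matrix.of v ∈ fullRank p q}

theorem isOpen_fullRankCoord (p q : ℕ) : IsOpen (fullRankCoord p q) := isOpen_fullRank p q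

/-- Extension by zero of a function on matrices of rank `p` to all matrices. -/
def extend {p q : ℕ} (F : Frame p q → ℂ) (v : Coord p q) : ℂ :=
  Function.extend Subtype.val F 0 (Matrix.of v)

theorem extend_of_mem {p q : ℕ} (F : Frame p q → ℂ) (v : Coord p q)
    (hv : v ∈ fullRankCoord p q) : extend F v = F ⟨Matrix.of v, hv⟩ :=
  Subtype.val_injective.extend_apply F 0 ⟨Matrix.of v, hv⟩

/-- The coordinates of a matrix of rank `p`. -/
def Frame.coord {p q : ℕ} (z : Frame p q) : Coord p q := Matrix.of.symm z.1

/-- The algebra of smooth complex valued functions on the open set of matrices of rank `p`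
(smooth in the real sense). -/
def smoothFrame (p q : ℕ) : Subalgebra ℂ (Frame p q → ℂ) where
  carrier := {F | ContDiffOn ℝ ∞ (extend F) (fullRankCoord p q)}
  mul_mem' {F G} hF hG := (ContDiffOn.mul hF hG).congr fun v hv => by
    simp only [extend_of_mem _ v hv, Pi.mul_apply]
  add_mem' {F G} hF hG := (ContDiffOn.add hF hG).congr fun v hv => by
    simp only [extend_of_mem _ v hv, Pi.add_apply]
  algebraMap_mem' c := (contDiffOn_const (c := c)).congr fun v hv => by
    rw [extend_of_mem _ v hv]
    rfl

theorem differentiableAt_extend {p q : ℕ} (F : smoothFrame p q) (z : Frame p q) :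
    DifferentiableAt ℝ (extend F.1) z.coord :=
  (ContDiffOn.contDiffAt F.2 ((isOpen_fullRankCoord p q).mem_nhds z.2)).differentiableAt (by simp)

/-- The pullback `π^*` of smooth functions. -/
def pullback (p q : ℕ) : smoothFn (Model p q) (Grassmann p q) →ₐ[ℂ] smoothFrame p q where
  toFun f := ⟨fun z => f.1 (proj z), by
    intro v hv
    obtain ⟨a, ha⟩ := exists_chartDet_ne_zero ⟨Matrix.of v, hv⟩
    have h1 : ContDiff ℝ ∞ (fun w : Model p q => f.1 (proj (chartInv a w))) := by
      have h2 : ContMDiffOn 𝓘(ℝ, Model p q) 𝓘(ℝ, Model p q) ∞ (grassmannChart a).symm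
          (grassmannChart a).target :=
        contMDiffOn_symm_of_mem_maximalAtlas
          (IsManifold.subset_maximalAtlas (Set.mem_range_self a))
      have h3 : ContMDiff 𝓘(ℝ, Model p q) 𝓘(ℝ, Model p q) ∞ (grassmannChart a).symm :=
        contMDiffOn_univ.mp h2
      exact contMDiff_iff_contDiff.mp (f.2.comp h3)
    have h4 : ContDiffAt ℝ ∞
        (fun v : Coord p q => f.1 (proj (chartInv a (chartFun a (Matrix.of v))))) v :=
      h1.contDiffAt.comp v (contDiffAt_chartFun a v ha)
    refine (h4.congr_of_eventuallyEq ?_).contDiffWithinAt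
    have h5 : ∀ᶠ y in nhds v, chartDet a (Matrix.of y) ≠ 0 :=
      (contDiffAt_chartDet a v).continuousAt.eventually_ne ha
    filter_upwards [h5, (isOpen_fullRankCoord p q).mem_nhds hv] with y hy hy'
    rw [extend_of_mem _ y hy', ← proj_chartInv a ⟨Matrix.of y, hy'⟩ hy]⟩
  map_one' := rfl
  map_mul' _ _ := rfl
  map_zero' := rfl
  map_add' _ _ := rfl
  commutes' _ := rfl

/-- The derivative of a smooth function in the real direction `v`. -/
def dirDeriv {p q : ℕ} (v : Coord p q) : smoothFrame p q →ₗ[ℂ] smoothFrame p q where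
  toFun F := ⟨fun z => fderiv ℝ (extend F.1) z.coord v, by
    have h : ContDiffOn ℝ ∞ (fun z => fderiv ℝ (extend F.1) z v) (fullRankCoord p q) :=
      (ContDiffOn.fderiv_of_isOpen F.2 (isOpen_fullRankCoord p q) (m := ∞) (by simp)).clm_apply
        contDiffOn_const
    exact h.congr fun v hv => extend_of_mem _ v hv⟩
  map_add' F G := by
    ext z
    have h : extend (F + G).1 =ᶠ[nhds z.coord] extend F.1 + extend G.1 := by
      filter_upwards [(isOpen_fullRankCoord p q).mem_nhds z.2] with y hy
      simp only [extend_of_mem _ y hy, Pi.add_apply]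
      rfl
    change fderiv ℝ (extend (F + G).1) z.coord v = _
    rw [h.fderiv_eq, fderiv_add (differentiableAt_extend F z) (differentiableAt_extend G z)]
    rfl
  map_smul' c F := by
    ext z
    have h : extend (c • F).1 =ᶠ[nhds z.coord] c • extend F.1 := by
      filter_upwards [(isOpen_fullRankCoord p q).mem_nhds z.2] with y hy
      simp only [extend_of_mem _ y hy, Pi.smul_apply]
      rfl
    change fderiv ℝ (extend (c • F).1) z.coord v = _
    rw [h.fderiv_eq, fderiv_const_smul (differentiableAt_extend F z)]
    rfl

/-- The coordinate direction of the entry `(A, i)`, multiplied by `c`. -/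
def entryDir {p q : ℕ} (A : Fin p ⊕ Fin q) (i : Fin p) (c : ℂ) : Coord p q :=
  Pi.single A (Pi.single i c)

/-- The Wirtinger derivative `∂/∂z^A_i = (∂/∂x^A_i - i ∂/∂y^A_i) / 2`, where `z = x + i y`. -/
def dz {p q : ℕ} (A : Fin p ⊕ Fin q) (i : Fin p) : smoothFrame p q →ₗ[ℂ] smoothFrame p q :=
  (1 / 2 : ℂ) • (dirDeriv (entryDir A i 1) -
    Complex.I • dirDeriv (entryDir A i Complex.I))

/-- The Wirtinger derivative `∂/∂z̄^A_i = (∂/∂x^A_i + i ∂/∂y^A_i) / 2`, where `z = x + i y`. -/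
def dzbar {p q : ℕ} (A : Fin p ⊕ Fin q) (i : Fin p) : smoothFrame p q →ₗ[ℂ] smoothFrame p q :=
  (1 / 2 : ℂ) • (dirDeriv (entryDir A i 1) +
    Complex.I • dirDeriv (entryDir A i Complex.I))

/-- The Poisson bracket of the Kähler form `ω = (i/2) tr dz ∧ dz†`. In the real coordinates
`z = x + i y` this form is `∑ dx ∧ dy`, and the bracket is normalized by `{x, y} = 1`. -/
def poisson {p q : ℕ} (F G : smoothFrame p q) : smoothFrame p q :=
  (2 / Complex.I) • ∑ A, ∑ i, (dz A i F * dzbar A i G - dz A i G * dzbar A i F)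

/-- The map `μ_r(F ⊗ G) = m ∘ (∑_{A,i} ∂/∂z^A_i ⊗ ∂/∂z̄^A_i)^r (F ⊗ G)`, that is, the sum
`∑ ∂^r F / ∂z^{A_1}_{i_1} ⋯ ∂z^{A_r}_{i_r} · ∂^r G / ∂z̄^{A_1}_{i_1} ⋯ ∂z̄^{A_r}_{i_r}`. -/
def wickPower {p q : ℕ} :
    ℕ → smoothFrame p q →ₗ[ℂ] smoothFrame p q →ₗ[ℂ] smoothFrame p q
  | 0 => LinearMap.mul ℂ (smoothFrame p q)
  | r + 1 => ∑ A, ∑ i, (wickPower r).compl₁₂ (dz A i) (dzbar A i)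

/-! ## Formal power series and star products -/

section Formal

variable {A : Type*} [CommRing A] [Algebra ℂ A]

theorem coeff_smul_formal (c : ℂ⟦X⟧) (F : A⟦X⟧) (n : ℕ) :
    PowerSeries.coeff n (c • F) = ∑ k ∈ Finset.HasAntidiagonal.antidiagonal n,
      PowerSeries.coeff k.1 c • PowerSeries.coeff k.2 F := by
  rw [Algebra.smul_def, PowerSeries.algebraMap_apply'', PowerSeries.coeff_mul]
  simp [Algebra.smul_def]

/-- Formal power series with coefficients in a given space of functions. -/
def formalSub (S : Submodule ℂ A) : Submodule ℂ⟦X⟧ A⟦X⟧ where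
  carrier := {F | ∀ n, PowerSeries.coeff n F ∈ S}
  add_mem' {F G} hF hG n := by
    rw [map_add]
    exact S.add_mem (hF n) (hG n)
  zero_mem' n := by
    rw [map_zero]
    exact S.zero_mem
  smul_mem' c F hF n := by
    rw [coeff_smul_formal]
    exact S.sum_mem fun k _ => S.smul_mem _ (hF k.2)

/-- The `ℂ[[λ]]`-bilinear product `f * g = ∑_r λ^r C_r(f, g)`; on power series it is
`(∑ λ^i F_i) * (∑ λ^j G_j) = ∑_n λ^n ∑_{r+i+j=n} C_r(F_i, G_j)`. -/
def formalBilin (C : ℕ → A →ₗ[ℂ] A →ₗ[ℂ] A) : A⟦X⟧ →ₗ[ℂ⟦X⟧] A⟦X⟧ →ₗ[ℂ⟦X⟧] A⟦X⟧ :=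
  LinearMap.mk₂ ℂ⟦X⟧
    (fun F G => PowerSeries.mk fun n => ∑ k ∈ Finset.HasAntidiagonal.antidiagonal n,
      ∑ l ∈ Finset.HasAntidiagonal.antidiagonal k.2,
        C k.1 (PowerSeries.coeff l.1 F) (PowerSeries.coeff l.2 G))
    (fun F F' G => by
      ext n
      simp [Finset.sum_add_distrib])
    (fun c F G => by
      ext n
      simp only [PowerSeries.coeff_mk, coeff_smul_formal, map_sum, map_smul,
        LinearMap.sum_apply, LinearMap.smul_apply, Finset.smul_sum]
      simp only [Finset.sum_sigma']
      refine Finset.sum_nbij'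
        (fun x => ⟨⟨x.2.2.1, x.1.1 + (x.2.2.2 + x.2.1.2)⟩, ⟨x.1.1, x.2.2.2 + x.2.1.2⟩,
          ⟨x.2.2.2, x.2.1.2⟩⟩)
        (fun x => ⟨⟨x.2.1.1, x.1.1 + (x.2.2.1 + x.2.2.2)⟩, ⟨x.1.1 + x.2.2.1, x.2.2.2⟩,
          ⟨x.1.1, x.2.2.1⟩⟩) ?_ ?_ ?_ ?_ ?_
      all_goals
        rintro ⟨⟨a, b⟩, ⟨d, e⟩, ⟨f, g⟩⟩ h
        simp only [Finset.mem_sigma, Finset.HasAntidiagonal.mem_antidiagonal] at h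
        obtain ⟨rfl, rfl, rfl⟩ := h
        simp only [Finset.mem_sigma, Finset.HasAntidiagonal.mem_antidiagonal] <;> simp <;> omega)
    (fun F G G' => by
      ext n
      simp [Finset.sum_add_distrib])
    (fun c F G => by
      ext n
      simp only [PowerSeries.coeff_mk, coeff_smul_formal, map_sum, map_smul, Finset.smul_sum]
      simp only [Finset.sum_sigma']
      refine Finset.sum_nbij'
        (fun x => ⟨⟨x.2.2.1, x.1.1 + (x.2.1.1 + x.2.2.2)⟩, ⟨x.1.1, x.2.1.1 + x.2.2.2⟩,
          ⟨x.2.1.1, x.2.2.2⟩⟩)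
        (fun x => ⟨⟨x.2.1.1, x.1.1 + (x.2.2.1 + x.2.2.2)⟩, ⟨x.2.2.1, x.1.1 + x.2.2.2⟩,
          ⟨x.1.1, x.2.2.2⟩⟩) ?_ ?_ ?_ ?_ ?_
      all_goals
        rintro ⟨⟨a, b⟩, ⟨d, e⟩, ⟨f, g⟩⟩ h
        simp only [Finset.mem_sigma, Finset.HasAntidiagonal.mem_antidiagonal] at h
        obtain ⟨rfl, rfl, rfl⟩ := h
        simp only [Finset.mem_sigma, Finset.HasAntidiagonal.mem_antidiagonal] <;> simp <;> omega)


/-- A bilinear product `m` with unit `e` that makes `V` an associative unital algebra. -/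
structure IsUnitalAlgebra {R V : Type*} [CommRing R] [AddCommGroup V] [Module R V]
    (m : V →ₗ[R] V →ₗ[R] V) (e : V) : Prop where
  assoc : ∀ f g h, m (m f g) h = m f (m g h)
  one_mul : ∀ f, m e f = f
  mul_one : ∀ f, m f e = f

/-- `D` is a differential operator of order at most `k` on the commutative algebra `A`: it is
linear and its `k + 1`-fold commutators with multiplications vanish. -/
def IsDiffOp : ℕ → (A →ₗ[ℂ] A) → Prop
  | 0, D => ∀ a : A, ⁅D, LinearMap.mulLeft ℂ a⁆ = 0
  | k + 1, D => ∀ a : A, IsDiffOp k ⁅D, LinearMap.mulLeft ℂ a⁆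

/-- The coefficient of `λ^r` in `f * g`, for `f` and `g` independent of `λ`. -/
def cochain (m : A⟦X⟧ →ₗ[ℂ⟦X⟧] A⟦X⟧ →ₗ[ℂ⟦X⟧] A⟦X⟧) (r : ℕ) (f g : A) : A :=
  PowerSeries.coeff r (m (PowerSeries.C f) (PowerSeries.C g))

/-- All coefficients of the product are bidifferential operators. -/
def IsBidifferential (m : A⟦X⟧ →ₗ[ℂ⟦X⟧] A⟦X⟧ →ₗ[ℂ⟦X⟧] A⟦X⟧) : Prop :=
  ∀ r, ∃ k, ∀ g,
    (∃ D : A →ₗ[ℂ] A, IsDiffOp k D ∧ ∀ f, D f = cochain m r f g) ∧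
    (∃ D : A →ₗ[ℂ] A, IsDiffOp k D ∧ ∀ f, D f = cochain m r g f)

end Formal

/-- Complex conjugation of formal power series of functions; the parameter `λ` is real. -/
def formalConj {E : Type*} [NormedAddCommGroup E] [NormedSpace ℝ E] {M : Type*}
    [TopologicalSpace M] [ChartedSpace E M] (f : (smoothFn E M)⟦X⟧) : (smoothFn E M)⟦X⟧ :=
  PowerSeries.mk fun n => smoothFn.conj (PowerSeries.coeff n f)

/-- A star product on the manifold `M` with Poisson bracket `B`: an associative
`ℂ[[λ]]`-bilinear product on `C^∞(M)[[λ]]`, given by bidifferential operators, which deforms the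
pointwise product in the direction of the Poisson bracket, has the constant function `1` as its
unit and complex conjugation as an antilinear involution. The first order of the commutator is
`(i/2) B`. -/
structure IsStarProduct {E : Type*} [NormedAddCommGroup E] [NormedSpace ℝ E] {M : Type*}
    [TopologicalSpace M] [ChartedSpace E M]
    (B : smoothFn E M → smoothFn E M → smoothFn E M)
    (m : (smoothFn E M)⟦X⟧ →ₗ[ℂ⟦X⟧] (smoothFn E M)⟦X⟧ →ₗ[ℂ⟦X⟧] (smoothFn E M)⟦X⟧) :
    Prop where
  algebra : IsUnitalAlgebra m 1
  bidifferential : IsBidifferential m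
  order_zero : ∀ f g, cochain m 0 f g = f * g
  order_one : ∀ f g, cochain m 1 f g - cochain m 1 g f = (Complex.I / 2) • B f g
  conj : ∀ f g, formalConj (m f g) = m (formalConj g) (formalConj f)

/-! ## The Wick product, invariant and homogeneous functions, and the ideal -/

/-- The Wick product on `C^∞[[λ]]` of the matrices of rank `p`:
`F ∗̃ G = ∑_r λ^r / r! ∑ ∂^r F / ∂z^{A_1}_{i_1} ⋯ · ∂^r G / ∂z̄^{A_1}_{i_1} ⋯`. -/
def wick (p q : ℕ) : (smoothFrame p q)⟦X⟧ →ₗ[ℂ⟦X⟧] (smoothFrame p q)⟦X⟧ →ₗ[ℂ⟦X⟧]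
    (smoothFrame p q)⟦X⟧ :=
  formalBilin fun r => (1 / (r.factorial : ℂ)) • (wickPower r :
    smoothFrame p q →ₗ[ℂ] smoothFrame p q →ₗ[ℂ] smoothFrame p q)

/-- The invariant functions: those invariant under the right action of `U(p)`. -/
def invariantFn (p q : ℕ) : Submodule ℂ (smoothFrame p q) where
  carrier := {F | ∀ (z : Frame p q) (U : Matrix.unitaryGroup (Fin p) ℂ), F.1 (z.mulU U) = F.1 z}
  add_mem' {F G} hF hG z U := by
    change F.1 (z.mulU U) + G.1 (z.mulU U) = F.1 z + G.1 z
    rw [hF, hG]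
  zero_mem' _ _ := rfl
  smul_mem' c F hF z U := by
    change c * F.1 (z.mulU U) = c * F.1 z
    rw [hF]

/-- The homogeneous functions: those invariant under the right action of `GL(p, ℂ)`. -/
def homogeneousFn (p q : ℕ) : Submodule ℂ (smoothFrame p q) where
  carrier := {F | ∀ (z : Frame p q) (g : GL (Fin p) ℂ), F.1 (z.mul g) = F.1 z}
  add_mem' {F G} hF hG z g := by
    change F.1 (z.mul g) + G.1 (z.mul g) = F.1 z + G.1 z
    rw [hF, hG]
  zero_mem' _ _ := rfl
  smul_mem' c F hF z g := by
    change c * F.1 (z.mul g) = c * F.1 z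
    rw [hF]

/-- Formal power series of invariant functions. -/
abbrev formalInv (p q : ℕ) : Submodule ℂ⟦X⟧ (smoothFrame p q)⟦X⟧ := formalSub (invariantFn p q)

/-- Formal power series of homogeneous functions. -/
abbrev formalHom (p q : ℕ) : Submodule ℂ⟦X⟧ (smoothFrame p q)⟦X⟧ := formalSub (homogeneousFn p q)

theorem one_mem_formalInv (p q : ℕ) : (1 : (smoothFrame p q)⟦X⟧) ∈ formalInv p q := by
  intro n z U
  rw [PowerSeries.coeff_one]
  split_ifs <;> rfl

/-- The constant function `1`, as an invariant function. -/
def oneInv (p q : ℕ) : formalInv p q := ⟨1, one_mem_formalInv p q⟩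

/-- The entries of `x - μ`, where `x = z† z`. -/
def momentum {p q : ℕ} (μ : ℝ) (i j : Fin p) : smoothFrame p q :=
  ⟨fun z => (z.1ᴴ * z.1 - (μ : ℂ) • (1 : Matrix (Fin p) (Fin p) ℂ)) i j, by
    have h : ContDiff ℝ ∞ (fun v : Coord p q =>
        ((Matrix.of v)ᴴ * Matrix.of v - (μ : ℂ) • (1 : Matrix (Fin p) (Fin p) ℂ)) i j) := by
      simp only [Matrix.sub_apply, Matrix.mul_apply, Matrix.conjTranspose_apply, Matrix.of_apply]
      refine ContDiff.sub (ContDiff.sum fun A _ => ContDiff.mul ?_ ?_) contDiff_const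
      · exact Complex.conjCLE.contDiff.comp (contDiff_apply_apply ℝ ℂ A i)
      · exact contDiff_apply_apply ℝ ℂ A j
    exact h.contDiffOn.congr fun v hv => extend_of_mem _ v hv⟩

/-- The coefficient of `λ^n` of a matrix of formal power series, as a matrix valued function. -/
def coeffMatrix {p q : ℕ} (G : Matrix (Fin p) (Fin p) (smoothFrame p q)⟦X⟧) (n : ℕ)
    (z : Frame p q) : Matrix (Fin p) (Fin p) ℂ :=
  Matrix.of fun i j => (PowerSeries.coeff n (G i j)).1 z

/-- Formal power series of `Ad`-equivariant functions with values in `u(p) ⊗ ℂ = gl(p, ℂ)`: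
each coefficient satisfies `G(z U) = U⁻¹ G(z) U` for all `U ∈ U(p)`. -/
def IsEquivariant {p q : ℕ} (G : Matrix (Fin p) (Fin p) (smoothFrame p q)⟦X⟧) : Prop :=
  ∀ (n : ℕ) (z : Frame p q) (U : Matrix.unitaryGroup (Fin p) ℂ),
    coeffMatrix G n (z.mulU U) = star U.1 * coeffMatrix G n z * U.1

theorem coeffMatrix_add {p q : ℕ} (G H : Matrix (Fin p) (Fin p) (smoothFrame p q)⟦X⟧) (n : ℕ)
    (z : Frame p q) : coeffMatrix (G + H) n z = coeffMatrix G n z + coeffMatrix H n z := by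
  ext i j
  simp [coeffMatrix]

theorem coeffMatrix_smul {p q : ℕ} (c : ℂ⟦X⟧)
    (G : Matrix (Fin p) (Fin p) (smoothFrame p q)⟦X⟧) (n : ℕ) (z : Frame p q) :
    coeffMatrix (c • G) n z = ∑ k ∈ Finset.HasAntidiagonal.antidiagonal n,
      PowerSeries.coeff k.1 c • coeffMatrix G k.2 z := by
  ext i j
  simp only [coeffMatrix, Matrix.of_apply, Matrix.smul_apply, coeff_smul_formal,
    Matrix.sum_apply, AddSubmonoidClass.coe_finsetSum, Finset.sum_apply]
  rfl

/-- The ideal generated by `x - μ` in the algebra of invariant functions with the Wick product: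
all `∑_{i,j} G_{ij} ∗̃ (x - μ)_{ji}` with `G` equivariant. -/
def momentumIdeal (p q : ℕ) (μ : ℝ) : Submodule ℂ⟦X⟧ (smoothFrame p q)⟦X⟧ where
  carrier := {F | ∃ G : Matrix (Fin p) (Fin p) (smoothFrame p q)⟦X⟧, IsEquivariant G ∧
    F = ∑ i, ∑ j, wick p q (G i j) (PowerSeries.C (momentum μ j i))}
  add_mem' := by
    rintro _ _ ⟨G, hG, rfl⟩ ⟨H, hH, rfl⟩
    refine ⟨G + H, fun n z U => ?_, ?_⟩
    · rw [coeffMatrix_add, coeffMatrix_add, hG, hH, Matrix.mul_add, Matrix.add_mul]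
    · simp only [Matrix.add_apply, map_add, LinearMap.add_apply, Finset.sum_add_distrib]
  zero_mem' := by
    refine ⟨0, fun n z U => ?_, by simp⟩
    have h : ∀ w : Frame p q, coeffMatrix (0 : Matrix (Fin p) (Fin p) (smoothFrame p q)⟦X⟧) n w
        = 0 := fun w => by ext i j; simp [coeffMatrix]
    rw [h, h, Matrix.mul_zero, Matrix.zero_mul]
  smul_mem' := by
    rintro c _ ⟨G, hG, rfl⟩
    refine ⟨c • G, fun n z U => ?_, ?_⟩
    · rw [coeffMatrix_smul, coeffMatrix_smul, Matrix.mul_sum, Matrix.sum_mul]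
      refine Finset.sum_congr rfl fun k _ => ?_
      rw [hG, Matrix.mul_smul, Matrix.smul_mul]
    · simp only [Matrix.smul_apply, map_smul, LinearMap.smul_apply, Finset.smul_sum]

/-- The Poisson bracket of the reduced phase space `J⁻¹(iμ/2) / U(p) = G_{p,q}(ℂ)`, where
`J = (i/2) z† z`: its pullback to `J⁻¹(iμ/2)` is the restriction of the Poisson bracket of the
invariant extensions `π^* f` and `π^* g`. -/
def IsReducedBracket {p q : ℕ} (μ : ℝ)
    (B : smoothFn (Model p q) (Grassmann p q) → smoothFn (Model p q) (Grassmann p q) →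
      smoothFn (Model p q) (Grassmann p q)) : Prop :=
  ∀ f g, ∀ ζ : Frame p q, ζ.1ᴴ * ζ.1 = (μ : ℂ) • (1 : Matrix (Fin p) (Fin p) ℂ) →
    (B f g).1 (proj ζ) = (poisson (pullback p q f) (pullback p q g)).1 ζ

/-- `P` is the projection of the invariant functions onto the homogeneous functions along the
ideal generated by `x - μ`. -/
structure IsProjection {p q : ℕ} (μ : ℝ)
    (P : formalInv p q →ₗ[ℂ⟦X⟧] (smoothFrame p q)⟦X⟧) : Prop where
  mem_hom : ∀ F, P F ∈ formalHom p q
  sub_mem : ∀ F : formalInv p q, (F : (smoothFrame p q)⟦X⟧) - P F ∈ momentumIdeal p q μ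

/-- A linear map `Φ` is an epimorphism between the unital algebras given by the products
`m₁`, `m₂` with units `e₁`, `e₂`. -/
structure IsAlgebraEpimorphism {R V W : Type*} [CommRing R] [AddCommGroup V] [Module R V]
    [AddCommGroup W] [Module R W] (m₁ : V →ₗ[R] V →ₗ[R] V) (e₁ : V)
    (m₂ : W →ₗ[R] W →ₗ[R] W) (e₂ : W) (Φ : V →ₗ[R] W) : Prop where
  map_one : Φ e₁ = e₂
  map_mul : ∀ f g, Φ (m₁ f g) = m₂ (Φ f) (Φ g)
  surjective : Function.Surjective Φ

/-- The pullback `π^*` of formal power series of functions. -/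
def formalPullback (p q : ℕ) :
    (smoothFn (Model p q) (Grassmann p q))⟦X⟧ →+* (smoothFrame p q)⟦X⟧ :=
  PowerSeries.map (pullback p q).toRingHom

end

end GrassmannStar

open GrassmannStar

/-!
Write `x = z† z` and let `E_ij = ∑_A z^A_i ∂/∂z^A_j` be the holomorphic fundamental vector fields of
the right action. Since the entries of `x - μ` are affine in `z̄`, the product `∑ G_ij * (x - μ)_ji`
stops after first order and equals `D G + λ L G` with `D K = ∑ K_ij (x - μ)_ji` (`traceMomentum`)
and `L K = ∑ E_ij K_ij` (`traceEuler`). So a series `F` lies in the ideal iff `F_0 = D K_0` and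
`F_{n+1} = D K_{n+1} + L K_n` for some equivariant `K_n` (`mem_momentumIdeal_iff`), and everything
rests on two facts about `D` and `L`.

*The sum is everything.* Every invariant function is `H + D K` with `H` homogeneous and `K`
equivariant (`exists_homogeneousFn_add_traceMomentum`). On the fibre through `z`, an invariant `F`
is a function `Ψ(z, y) = F(z c)` of the positive definite matrix `y = c c†`, smooth by the inverse
function theorem (`fibreExt`, `contDiffAt_fibreExt`). The fibre meets `x = μ` at `y = μ x⁻¹`, which
gives `H(z) = Ψ(z, μ x⁻¹)`. The segment from `μ x⁻¹` to `1` stays positive definite, and integrating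
the derivative of `Ψ` along it expresses `F - H` as a linear functional of
`1 - μ x⁻¹ = x⁻¹ (x - μ)`. The decomposition of series is then found order by order, subtracting
`L K_n` from the next coefficient (`formalHom_sup_momentumIdeal`).

*The sum is direct.* Homogeneous functions are annihilated by all `E_ij`. The function
`ρ = det x e^{-tr x / μ}` has compact superlevel sets at positive levels and attains its maximum on
every fibre exactly where `x = μ`. Against a homogeneous test function and a weight
`φ(ρ) (det x)^{-(p+q)}`, whose determinant factor cancels the divergence of `E_ii`, integration by
parts turns `L K` into `1/μ` times `D K` with the weight of `s φ'(s)` in place of `φ(s)`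
(`frameIntegral_traceEuler`). If a homogeneous `H` is in the ideal, then by induction on `n` its
coefficient `H_n` has the same integrals as `D K_n`, which vanishes on `x = μ`. Concentrating the
weights near the maximum of `ρ` gives `H_n = 0` (`homogeneous_eq_zero_of_integral_eq`), hence the
integrals of `D K_n` vanish, hence, by the integration by parts, those of `L K_n`, and the induction
continues.

The Wick product is associative because both bracketings of three factors are the exponential of the
same sum of commuting operators (`biPower_assoc`). The ideal is two-sided because it is a left ideal
stable under complex conjugation, which reverses products: infinitesimal equivariance gives
`∑ G_ij * (x - μ)_ji = ∑ (x - μ)_ji * G_ij` (`IsEquivariant.sum_wick_comm`). So the product of the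
quotient is carried to the Grassmann manifold by `reduce`. Its cochains are bidifferential because
the ideal is stable under pointwise multiplication by homogeneous functions, so that commutators
with multiplications may be taken before the reduction (`diffOpLT_of_eq_coeff_reduce`). Its bracket
is the reduced one because the lowest order of an element of the ideal vanishes where `x = μ`
(`coeff_zero_reduce_apply`).
-/

namespace GrassmannStar

noncomputable section

/-! ### Formal power series and bilinear products -/

section FormalAlgebra

variable {A : Type*} [CommRing A] [Algebra ℂ A]

theorem coeff_X_smul_zero (F : A⟦X⟧) :
    PowerSeries.coeff 0 ((PowerSeries.X : ℂ⟦X⟧) • F) = 0 := by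
  simp [coeff_smul_formal]

theorem coeff_X_smul_succ (F : A⟦X⟧) (n : ℕ) :
    PowerSeries.coeff (n + 1) ((PowerSeries.X : ℂ⟦X⟧) • F) = PowerSeries.coeff n F := by
  rw [coeff_smul_formal, Finset.Nat.antidiagonal_succ]
  simp only [Finset.sum_cons, PowerSeries.coeff_zero_X, zero_smul, zero_add, Finset.sum_map]
  rw [Finset.sum_eq_single (0, n)]
  · simp
  · rintro ⟨a, b⟩ h hne
    have : a ≠ 0 := by
      rintro rfl
      simp at h
      exact hne (by simp [h])
    simp [PowerSeries.coeff_X, this]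
  · intro h
    simp at h

theorem eq_C_add_X_smul (F : A⟦X⟧) :
    F = PowerSeries.C (PowerSeries.coeff 0 F) +
      (PowerSeries.X : ℂ⟦X⟧) • PowerSeries.mk fun n => PowerSeries.coeff (n + 1) F := by
  ext n
  cases n with
  | zero => rw [map_add, coeff_X_smul_zero]; simp
  | succ n => rw [map_add, coeff_X_smul_succ]; simp

/-- Linear maps over `ℂ⟦X⟧` are continuous for the `X`-adic topology, hence determined by their
values on constant series. -/
theorem formal_linear_ext {B : Type*} [CommRing B] [Algebra ℂ B] {S T : A⟦X⟧ →ₗ[ℂ⟦X⟧] B⟦X⟧}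
    (h : ∀ f, S (PowerSeries.C f) = T (PowerSeries.C f)) : S = T := by
  refine LinearMap.ext fun F => PowerSeries.ext fun n => ?_
  induction n generalizing F with
  | zero =>
    rw [eq_C_add_X_smul F, S.map_add, T.map_add, S.map_smul, T.map_smul, h, map_add, map_add,
      coeff_X_smul_zero, coeff_X_smul_zero]
  | succ n ih =>
    rw [eq_C_add_X_smul F, S.map_add, T.map_add, S.map_smul, T.map_smul, h, map_add, map_add,
      coeff_X_smul_succ, coeff_X_smul_succ, ih]

theorem coeff_formalBilin (C : ℕ → A →ₗ[ℂ] A →ₗ[ℂ] A) (F G : A⟦X⟧) (n : ℕ) :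
    PowerSeries.coeff n (formalBilin C F G) = ∑ k ∈ Finset.HasAntidiagonal.antidiagonal n,
      ∑ l ∈ Finset.HasAntidiagonal.antidiagonal k.2,
        C k.1 (PowerSeries.coeff l.1 F) (PowerSeries.coeff l.2 G) := by
  simp [formalBilin]

theorem coeff_formalBilin_C_right (C : ℕ → A →ₗ[ℂ] A →ₗ[ℂ] A) (F : A⟦X⟧) (g : A) (n : ℕ) :
    PowerSeries.coeff n (formalBilin C F (PowerSeries.C g)) =
      ∑ k ∈ Finset.HasAntidiagonal.antidiagonal n, C k.1 (PowerSeries.coeff k.2 F) g := by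
  rw [coeff_formalBilin]
  refine Finset.sum_congr rfl fun k _ => ?_
  rw [Finset.sum_eq_single (k.2, 0)]
  · simp
  · rintro ⟨a, b⟩ h hne
    have : b ≠ 0 := by
      rintro rfl
      simp at h
      exact hne (by simp [h])
    simp [PowerSeries.coeff_C, this]
  · intro h
    simp at h

theorem coeff_formalBilin_C_left (C : ℕ → A →ₗ[ℂ] A →ₗ[ℂ] A) (f : A) (G : A⟦X⟧) (n : ℕ) :
    PowerSeries.coeff n (formalBilin C (PowerSeries.C f) G) =
      ∑ k ∈ Finset.HasAntidiagonal.antidiagonal n, C k.1 f (PowerSeries.coeff k.2 G) := by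
  rw [coeff_formalBilin]
  refine Finset.sum_congr rfl fun k _ => ?_
  rw [Finset.sum_eq_single (0, k.2)]
  · simp
  · rintro ⟨a, b⟩ h hne
    have : a ≠ 0 := by
      rintro rfl
      simp at h
      exact hne (by simp [h])
    simp [PowerSeries.coeff_C, this]
  · intro h
    simp at h

theorem coeff_formalBilin_C_C (C : ℕ → A →ₗ[ℂ] A →ₗ[ℂ] A) (f g : A) (n : ℕ) :
    PowerSeries.coeff n (formalBilin C (PowerSeries.C f) (PowerSeries.C g)) = C n f g := by
  rw [coeff_formalBilin_C_right, Finset.sum_eq_single (n, 0)]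
  · simp
  · rintro ⟨a, b⟩ h hne
    have : b ≠ 0 := by
      rintro rfl
      simp at h
      exact hne (by simp [h])
    simp [PowerSeries.coeff_C, this]
  · intro h
    simp at h

theorem formalBilin_assoc {C : ℕ → A →ₗ[ℂ] A →ₗ[ℂ] A}
    (hC : ∀ n f g h, ∑ k ∈ Finset.HasAntidiagonal.antidiagonal n, C k.1 (C k.2 f g) h =
      ∑ k ∈ Finset.HasAntidiagonal.antidiagonal n, C k.1 f (C k.2 g h)) (F G H : A⟦X⟧) :
    formalBilin C (formalBilin C F G) H = formalBilin C F (formalBilin C G H) := by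
  have key : ∀ f g h : A, formalBilin C (formalBilin C (PowerSeries.C f) (PowerSeries.C g))
      (PowerSeries.C h) = formalBilin C (PowerSeries.C f)
        (formalBilin C (PowerSeries.C g) (PowerSeries.C h)) := by
    intro f g h
    ext n
    rw [coeff_formalBilin_C_right, coeff_formalBilin_C_left]
    simp only [coeff_formalBilin_C_C]
    exact hC n f g h
  -- each of the three arguments is reduced to constants in turn
  have h1 : ∀ (F : A⟦X⟧) (g h : A), formalBilin C (formalBilin C F (PowerSeries.C g))
      (PowerSeries.C h) = formalBilin C F
        (formalBilin C (PowerSeries.C g) (PowerSeries.C h)) := by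
    intro F g h
    exact LinearMap.congr_fun (formal_linear_ext
      (S := ((formalBilin C).flip (PowerSeries.C h)).comp ((formalBilin C).flip (PowerSeries.C g)))
      (T := (formalBilin C).flip (formalBilin C (PowerSeries.C g) (PowerSeries.C h)))
      (fun f => key f g h)) F
  have h2 : ∀ (F G : A⟦X⟧) (h : A), formalBilin C (formalBilin C F G)
      (PowerSeries.C h) = formalBilin C F (formalBilin C G (PowerSeries.C h)) := by
    intro F G h
    exact LinearMap.congr_fun (formal_linear_ext
      (S := ((formalBilin C).flip (PowerSeries.C h)).comp (formalBilin C F))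
      (T := (formalBilin C F).comp ((formalBilin C).flip (PowerSeries.C h)))
      (fun g => h1 F g h)) G
  exact LinearMap.congr_fun (formal_linear_ext
      (S := formalBilin C (formalBilin C F G))
      (T := (formalBilin C F).comp (formalBilin C G))
      (fun h => h2 F G h)) H

end FormalAlgebra

/-! ### Products built from commuting derivations -/

section CommutingDerivations

variable {A : Type*} [CommRing A] [Algebra ℂ A] {ι : Type*} [Fintype ι]

/-- The bilinear map `m ∘ (∑_i d_i ⊗ d'_i)^r`. -/
def biPower (d d' : ι → A →ₗ[ℂ] A) : ℕ → A →ₗ[ℂ] A →ₗ[ℂ] A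
  | 0 => LinearMap.mul ℂ A
  | r + 1 => ∑ i, (biPower d d' r).compl₁₂ (d i) (d' i)

theorem biPower_zero (d d' : ι → A →ₗ[ℂ] A) (f g : A) : biPower d d' 0 f g = f * g := rfl

theorem biPower_succ (d d' : ι → A →ₗ[ℂ] A) (r : ℕ) (f g : A) :
    biPower d d' (r + 1) f g = ∑ i, biPower d d' r (d i f) (d' i g) := by
  simp [biPower, LinearMap.sum_apply]

/-- A derivation that commutes with all `d_i` and `d'_i` is a derivation of each term of the
product. -/
theorem leibniz_biPower {d d' : ι → A →ₗ[ℂ] A} (δ : A →ₗ[ℂ] A)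
    (hδ : ∀ f g, δ (f * g) = δ f * g + f * δ g) (h1 : ∀ i f, δ (d i f) = d i (δ f))
    (h2 : ∀ i f, δ (d' i f) = d' i (δ f)) (r : ℕ) (f g : A) :
    δ (biPower d d' r f g) = biPower d d' r (δ f) g + biPower d d' r f (δ g) := by
  induction r generalizing f g with
  | zero => exact hδ f g
  | succ r ih => simp only [biPower_succ, map_sum, ih, h1, h2, Finset.sum_add_distrib]

/-- The operator that feeds `∑_i d_i ⊗ d'_i` into the first and second of three arguments. -/
def theta₁₂ (d d' : ι → A →ₗ[ℂ] A) : Module.End ℂ (A → A → A → A) where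
  toFun T f g h := ∑ i, T (d i f) (d' i g) h
  map_add' S T := by ext; simp [Finset.sum_add_distrib]
  map_smul' c T := by ext; simp [Finset.smul_sum]

/-- The operator that feeds `∑_i d_i ⊗ d'_i` into the first and third of three arguments. -/
def theta₁₃ (d d' : ι → A →ₗ[ℂ] A) : Module.End ℂ (A → A → A → A) where
  toFun T f g h := ∑ i, T (d i f) g (d' i h)
  map_add' S T := by ext; simp [Finset.sum_add_distrib]
  map_smul' c T := by ext; simp [Finset.smul_sum]

/-- The operator that feeds `∑_i d_i ⊗ d'_i` into the second and third of three arguments. -/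
def theta₂₃ (d d' : ι → A →ₗ[ℂ] A) : Module.End ℂ (A → A → A → A) where
  toFun T f g h := ∑ i, T f (d i g) (d' i h)
  map_add' S T := by ext; simp [Finset.sum_add_distrib]
  map_smul' c T := by ext; simp [Finset.smul_sum]

theorem theta₁₂_apply (d d' : ι → A →ₗ[ℂ] A) (T : A → A → A → A) (f g h : A) :
    theta₁₂ d d' T f g h = ∑ i, T (d i f) (d' i g) h := rfl

theorem theta₁₃_apply (d d' : ι → A →ₗ[ℂ] A) (T : A → A → A → A) (f g h : A) :
    theta₁₃ d d' T f g h = ∑ i, T (d i f) g (d' i h) := rfl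

theorem theta₂₃_apply (d d' : ι → A →ₗ[ℂ] A) (T : A → A → A → A) (f g h : A) :
    theta₂₃ d d' T f g h = ∑ i, T f (d i g) (d' i h) := rfl

/-- By the Leibniz rule, a derivation of the inner product is distributed over its two factors,
which turns the outer contraction into `Θ₁₃ + Θ₂₃`. -/
theorem biPower_biPower_left {d d' : ι → A →ₗ[ℂ] A}
    (hd : ∀ i f g, d i (f * g) = d i f * g + f * d i g)
    (hdd : ∀ i j f, d i (d j f) = d j (d i f)) (hdd' : ∀ i j f, d i (d' j f) = d' j (d i f))
    (r s : ℕ) (f g h : A) : biPower d d' r (biPower d d' s f g) h =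
      ((theta₁₃ d d' + theta₂₃ d d') ^ r * theta₁₂ d d' ^ s) (fun f g h => f * g * h) f g h := by
  induction r generalizing f g h with
  | zero =>
    rw [pow_zero, one_mul, biPower_zero]
    induction s generalizing f g with
    | zero => rfl
    | succ s ih =>
      rw [pow_succ', Module.End.mul_apply, theta₁₂_apply, biPower_succ, Finset.sum_mul]
      exact Finset.sum_congr rfl fun i _ => ih _ _
  | succ r ih =>
    rw [pow_succ', mul_assoc, Module.End.mul_apply, LinearMap.add_apply, Pi.add_apply,
      Pi.add_apply, Pi.add_apply, theta₁₃_apply, theta₂₃_apply, biPower_succ,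
      ← Finset.sum_add_distrib]
    refine Finset.sum_congr rfl fun i _ => ?_
    rw [leibniz_biPower (d i) (hd i) (hdd i) (hdd' i), map_add, LinearMap.add_apply, ih, ih]

theorem biPower_biPower_right {d d' : ι → A →ₗ[ℂ] A}
    (hd : ∀ i f g, d' i (f * g) = d' i f * g + f * d' i g)
    (hdd : ∀ i j f, d' i (d j f) = d j (d' i f)) (hdd' : ∀ i j f, d' i (d' j f) = d' j (d' i f))
    (r s : ℕ) (f g h : A) : biPower d d' r f (biPower d d' s g h) =
      ((theta₁₂ d d' + theta₁₃ d d') ^ r * theta₂₃ d d' ^ s) (fun f g h => f * g * h) f g h := by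
  induction r generalizing f g h with
  | zero =>
    rw [pow_zero, one_mul, biPower_zero]
    induction s generalizing g h with
    | zero => exact (mul_assoc _ _ _).symm
    | succ s ih =>
      rw [pow_succ', Module.End.mul_apply, theta₂₃_apply, biPower_succ, Finset.mul_sum]
      exact Finset.sum_congr rfl fun i _ => ih _ _
  | succ r ih =>
    rw [pow_succ', mul_assoc, Module.End.mul_apply, LinearMap.add_apply, Pi.add_apply,
      Pi.add_apply, Pi.add_apply, theta₁₂_apply, theta₁₃_apply, biPower_succ,
      ← Finset.sum_add_distrib]
    refine Finset.sum_congr rfl fun i _ => ?_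
    rw [leibniz_biPower (d' i) (hd i) (hdd i) (hdd' i), map_add, ih, ih]

theorem sum_antidiagonal_pow_mul_pow {R : Type*} [Ring R] [Algebra ℂ R] {x y : R}
    (h : Commute x y) (n : ℕ) :
    ∑ k ∈ Finset.HasAntidiagonal.antidiagonal n,
      ((1 / (k.2.factorial : ℂ)) * (1 / (k.1.factorial : ℂ))) • (x ^ k.1 * y ^ k.2) =
      (1 / (n.factorial : ℂ)) • (x + y) ^ n := by
  rw [h.add_pow', Finset.smul_sum]
  refine Finset.sum_congr rfl fun k hk => ?_
  obtain rfl := Finset.HasAntidiagonal.mem_antidiagonal.mp hk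
  rw [← Nat.cast_smul_eq_nsmul ℂ, smul_smul, Nat.cast_add_choose]
  congr 1
  have h1 : ((k.1 + k.2).factorial : ℂ) ≠ 0 := by exact_mod_cast Nat.factorial_ne_zero _
  field_simp

/-- Exponentials of commuting derivations give an associative product: both ways of bracketing
three factors give the exponential of `Θ₁₂ + Θ₁₃ + Θ₂₃`, applied to the triple product. -/
theorem biPower_assoc {d d' : ι → A →ₗ[ℂ] A}
    (hd : ∀ i f g, d i (f * g) = d i f * g + f * d i g)
    (hd' : ∀ i f g, d' i (f * g) = d' i f * g + f * d' i g)
    (hdd : ∀ i j f, d i (d j f) = d j (d i f)) (hdd' : ∀ i j f, d i (d' j f) = d' j (d i f))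
    (hd'd' : ∀ i j f, d' i (d' j f) = d' j (d' i f)) (n : ℕ) (f g h : A) :
    ∑ k ∈ Finset.HasAntidiagonal.antidiagonal n, ((1 / (k.1.factorial : ℂ)) • biPower d d' k.1)
      (((1 / (k.2.factorial : ℂ)) • biPower d d' k.2) f g) h =
    ∑ k ∈ Finset.HasAntidiagonal.antidiagonal n, ((1 / (k.1.factorial : ℂ)) • biPower d d' k.1)
      f (((1 / (k.2.factorial : ℂ)) • biPower d d' k.2) g h) := by
  have c1 : Commute (theta₁₂ d d') (theta₁₃ d d') := by
    refine LinearMap.ext fun T => funext₃ fun f g h => ?_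
    simp only [Module.End.mul_apply, theta₁₂_apply, theta₁₃_apply]
    rw [Finset.sum_comm]
    simp only [hdd]
  have c2 : Commute (theta₁₂ d d') (theta₂₃ d d') := by
    refine LinearMap.ext fun T => funext₃ fun f g h => ?_
    simp only [Module.End.mul_apply, theta₁₂_apply, theta₂₃_apply]
    rw [Finset.sum_comm]
    simp only [hdd']
  have c3 : Commute (theta₁₃ d d') (theta₂₃ d d') := by
    refine LinearMap.ext fun T => funext₃ fun f g h => ?_
    simp only [Module.End.mul_apply, theta₁₃_apply, theta₂₃_apply]
    rw [Finset.sum_comm]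
    simp only [hd'd']
  have e1 := sum_antidiagonal_pow_mul_pow (c1.symm.add_left c2.symm) n
  have e2 := sum_antidiagonal_pow_mul_pow (c2.add_left c3) n
  have e3 := e1.trans ((congrArg (fun z => (1 / (n.factorial : ℂ)) • z ^ n)
    (by abel : theta₁₃ d d' + theta₂₃ d d' + theta₁₂ d d' =
      theta₁₂ d d' + theta₁₃ d d' + theta₂₃ d d')).trans e2.symm)
  have e4 := congrFun₃ (LinearMap.congr_fun e3 (fun f g h => f * g * h)) f g h
  simp only [LinearMap.sum_apply, LinearMap.smul_apply, Finset.sum_apply, Pi.smul_apply,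
    ← biPower_biPower_left hd hdd hdd',
    ← biPower_biPower_right hd' (fun i j f => (hdd' j i f).symm) hd'd'] at e4
  simp only [LinearMap.smul_apply, map_smul, smul_smul]
  exact e4

end CommutingDerivations

/-! ### Calculus on matrices of full rank -/

section Calculus

variable {p q : ℕ}

theorem contDiffAt_extend (F : smoothFrame p q) (z : Frame p q) :
    ContDiffAt ℝ ∞ (extend F.1) z.coord :=
  F.2.contDiffAt ((isOpen_fullRankCoord p q).mem_nhds z.2)

theorem extend_coord (F : Frame p q → ℂ) (z : Frame p q) : extend F z.coord = F z :=
  extend_of_mem F z.coord z.2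

theorem extend_eventuallyEq {F : Frame p q → ℂ} {f : Coord p q → ℂ} (z : Frame p q)
    (h : ∀ w : Frame p q, F w = f w.coord) : extend F =ᶠ[nhds z.coord] f := by
  filter_upwards [(isOpen_fullRankCoord p q).mem_nhds z.2] with y hy
  rw [extend_of_mem F y hy, h]
  rfl

/-- A function on the coordinate space that is smooth on the matrices of full rank. -/
def smoothOf (f : Coord p q → ℂ) (hf : ContDiffOn ℝ ∞ f (fullRankCoord p q)) : smoothFrame p q :=
  ⟨fun z => f z.coord, hf.congr fun v hv => extend_of_mem _ v hv⟩

theorem dirDeriv_apply (v : Coord p q) (F : smoothFrame p q) (z : Frame p q) :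
    (dirDeriv v F).1 z = fderiv ℝ (extend F.1) z.coord v := rfl

theorem dirDeriv_eq_of_hasFDerivAt {v : Coord p q} {F : smoothFrame p q} {z : Frame p q}
    {f : Coord p q → ℂ} {f' : Coord p q →L[ℝ] ℂ} (h : ∀ w : Frame p q, F.1 w = f w.coord)
    (hf : HasFDerivAt f f' z.coord) : (dirDeriv v F).1 z = f' v := by
  rw [dirDeriv_apply, (extend_eventuallyEq z h).fderiv_eq, hf.fderiv]

theorem smoothFrame_ext {F G : smoothFrame p q} (h : ∀ z, F.1 z = G.1 z) : F = G :=
  Subtype.ext (funext h)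

theorem coe_sum_apply {ι : Type*} (s : Finset ι) (F : ι → smoothFrame p q) (z : Frame p q) :
    (∑ i ∈ s, F i).1 z = ∑ i ∈ s, (F i).1 z := by
  rw [AddSubmonoidClass.coe_finsetSum, Finset.sum_apply]

theorem coe_add_apply (F G : smoothFrame p q) (z : Frame p q) :
    (F + G).1 z = F.1 z + G.1 z := rfl

theorem coe_sub_apply (F G : smoothFrame p q) (z : Frame p q) :
    (F - G).1 z = F.1 z - G.1 z := rfl

theorem coe_mul_apply (F G : smoothFrame p q) (z : Frame p q) :
    (F * G).1 z = F.1 z * G.1 z := rfl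

theorem coe_smul_apply (c : ℂ) (F : smoothFrame p q) (z : Frame p q) :
    (c • F).1 z = c * F.1 z := rfl

theorem dirDeriv_mul (v : Coord p q) (F G : smoothFrame p q) :
    dirDeriv v (F * G) = dirDeriv v F * G + F * dirDeriv v G := by
  refine smoothFrame_ext fun z => ?_
  have h := (differentiableAt_extend F z).hasFDerivAt.mul (differentiableAt_extend G z).hasFDerivAt
  rw [dirDeriv_eq_of_hasFDerivAt (f := extend F.1 * extend G.1) (fun w => ?_) h]
  · simp [extend_coord, coe_add_apply, coe_mul_apply, dirDeriv_apply]
    ring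
  · rw [Pi.mul_apply, extend_coord, extend_coord]
    rfl

theorem dirDeriv_comm (v w : Coord p q) (F : smoothFrame p q) :
    dirDeriv v (dirDeriv w F) = dirDeriv w (dirDeriv v F) := by
  refine smoothFrame_ext fun z => ?_
  have hd : DifferentiableAt ℝ (fderiv ℝ (extend F.1)) z.coord :=
    ((contDiffAt_extend F z).fderiv_right (m := 1) (by norm_cast)).differentiableAt
      (by norm_num)
  have key : ∀ u u' : Coord p q, (dirDeriv u (dirDeriv u' F)).1 z =
      fderiv ℝ (fderiv ℝ (extend F.1)) z.coord u u' := by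
    intro u u'
    have h2 : HasFDerivAt (fun y => fderiv ℝ (extend F.1) y u')
        ((fderiv ℝ (fderiv ℝ (extend F.1)) z.coord).flip u') z.coord := by
      have := hd.hasFDerivAt.clm_apply (hasFDerivAt_const u' z.coord)
      simpa using this
    rw [dirDeriv_eq_of_hasFDerivAt (f := fun y => fderiv ℝ (extend F.1) y u') (fun w => rfl) h2]
    rfl
  rw [key, key]
  exact (contDiffAt_extend F z).isSymmSndFDerivAt (by simp; norm_cast) v w

theorem dirDeriv_add_dir (v w : Coord p q) (F : smoothFrame p q) :
    dirDeriv (v + w) F = dirDeriv v F + dirDeriv w F :=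
  smoothFrame_ext fun z => map_add (fderiv ℝ (extend F.1) z.coord) v w

theorem dirDeriv_sum_dir {ι : Type*} (s : Finset ι) (v : ι → Coord p q) (F : smoothFrame p q) :
    dirDeriv (∑ i ∈ s, v i) F = ∑ i ∈ s, dirDeriv (v i) F :=
  smoothFrame_ext fun z => by
    rw [coe_sum_apply]
    exact map_sum (fderiv ℝ (extend F.1) z.coord) v s

theorem dirDeriv_smul_dir (c : ℝ) (v : Coord p q) (F : smoothFrame p q) :
    dirDeriv (c • v) F = (c : ℂ) • dirDeriv v F :=
  smoothFrame_ext fun z => by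
    rw [coe_smul_apply]
    exact (map_smul (fderiv ℝ (extend F.1) z.coord) c v).trans (by simp [dirDeriv_apply])

theorem dz_apply (A : Fin p ⊕ Fin q) (i : Fin p) (F : smoothFrame p q) :
    dz A i F = (1 / 2 : ℂ) • (dirDeriv (entryDir A i 1) F -
      Complex.I • dirDeriv (entryDir A i Complex.I) F) := rfl

theorem dzbar_apply (A : Fin p ⊕ Fin q) (i : Fin p) (F : smoothFrame p q) :
    dzbar A i F = (1 / 2 : ℂ) • (dirDeriv (entryDir A i 1) F +
      Complex.I • dirDeriv (entryDir A i Complex.I) F) := rfl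

theorem dirDeriv_entryDir (A : Fin p ⊕ Fin q) (i : Fin p) (c : ℂ) (F : smoothFrame p q) :
    dirDeriv (entryDir A i c) F = c • dz A i F + (starRingEnd ℂ c) • dzbar A i F := by
  have h : entryDir (p := p) (q := q) A i c =
      c.re • entryDir A i 1 + c.im • entryDir A i Complex.I := by
    unfold entryDir
    rw [← Pi.single_smul', ← Pi.single_smul', ← Pi.single_smul', ← Pi.single_smul',
      ← Pi.single_add, ← Pi.single_add]
    congr 2
    apply Complex.ext <;> simp
  rw [h, dirDeriv_add_dir, dirDeriv_smul_dir, dirDeriv_smul_dir, dz_apply, dzbar_apply]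
  refine smoothFrame_ext fun z => ?_
  simp only [coe_add_apply, coe_sub_apply, coe_smul_apply]
  have hc : starRingEnd ℂ c = c.re - c.im * Complex.I := by
    apply Complex.ext <;> simp
  rw [hc]
  conv_rhs => rw [← Complex.re_add_im c]
  simp only [Complex.add_re, Complex.add_im, Complex.ofReal_re, Complex.ofReal_im, Complex.mul_re,
    Complex.mul_im, Complex.I_re, Complex.I_im]
  ring_nf
  simp only [Complex.I_sq]
  ring

theorem sum_entryDir (v : Coord p q) : v = ∑ A, ∑ i, entryDir A i (v A i) := by
  ext B j
  simp only [entryDir, Finset.sum_apply]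
  rw [Finset.sum_eq_single B, Finset.sum_eq_single j]
  · simp
  · intro i _ hi
    simp [hi.symm]
  · simp
  · intro A _ hA
    simp [Pi.single_eq_of_ne hA.symm]
  · simp

/-- The real derivative in terms of the Wirtinger derivatives. -/
theorem dirDeriv_eq_sum (v : Coord p q) (F : smoothFrame p q) :
    dirDeriv v F = ∑ A, ∑ i, (v A i • dz A i F + (starRingEnd ℂ (v A i)) • dzbar A i F) := by
  conv_lhs => rw [sum_entryDir v]
  simp only [dirDeriv_sum_dir, dirDeriv_entryDir]

theorem dz_mul (A : Fin p ⊕ Fin q) (i : Fin p) (F G : smoothFrame p q) :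
    dz A i (F * G) = dz A i F * G + F * dz A i G := by
  refine smoothFrame_ext fun z => ?_
  simp only [dz_apply, dirDeriv_mul, coe_add_apply, coe_sub_apply, coe_smul_apply, coe_mul_apply]
  ring

theorem dzbar_mul (A : Fin p ⊕ Fin q) (i : Fin p) (F G : smoothFrame p q) :
    dzbar A i (F * G) = dzbar A i F * G + F * dzbar A i G := by
  refine smoothFrame_ext fun z => ?_
  simp only [dzbar_apply, dirDeriv_mul, coe_add_apply, coe_smul_apply, coe_mul_apply]
  ring

theorem dz_dz_comm (A B : Fin p ⊕ Fin q) (i j : Fin p) (F : smoothFrame p q) :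
    dz A i (dz B j F) = dz B j (dz A i F) := by
  refine smoothFrame_ext fun z => ?_
  simp only [dz_apply, map_smul, map_sub, dirDeriv_comm (entryDir A i _) (entryDir B j _),
    coe_sub_apply, coe_smul_apply]
  ring

theorem dz_dzbar_comm (A B : Fin p ⊕ Fin q) (i j : Fin p) (F : smoothFrame p q) :
    dz A i (dzbar B j F) = dzbar B j (dz A i F) := by
  refine smoothFrame_ext fun z => ?_
  simp only [dz_apply, dzbar_apply, map_smul, map_sub, map_add,
    dirDeriv_comm (entryDir A i _) (entryDir B j _), coe_sub_apply, coe_add_apply, coe_smul_apply]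
  ring

theorem dzbar_dzbar_comm (A B : Fin p ⊕ Fin q) (i j : Fin p) (F : smoothFrame p q) :
    dzbar A i (dzbar B j F) = dzbar B j (dzbar A i F) := by
  refine smoothFrame_ext fun z => ?_
  simp only [dzbar_apply, map_smul, map_add,
    dirDeriv_comm (entryDir A i _) (entryDir B j _), coe_add_apply, coe_smul_apply]
  ring

/-! ### Complex conjugation and coordinate functions -/

/-- Pointwise complex conjugation of smooth functions. -/
def conjFn (F : smoothFrame p q) : smoothFrame p q :=
  ⟨fun z => starRingEnd ℂ (F.1 z), by
    have h := Complex.conjCLE.contDiff.comp_contDiffOn F.2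
    exact h.congr fun v hv => by
      rw [extend_of_mem _ v hv, Function.comp_apply, extend_of_mem _ v hv]; rfl⟩

theorem conjFn_apply (F : smoothFrame p q) (z : Frame p q) :
    (conjFn F).1 z = starRingEnd ℂ (F.1 z) := rfl

theorem conjFn_conjFn (F : smoothFrame p q) : conjFn (conjFn F) = F :=
  smoothFrame_ext fun _ => Complex.conj_conj _

theorem conjFn_add (F G : smoothFrame p q) : conjFn (F + G) = conjFn F + conjFn G :=
  smoothFrame_ext fun _ => map_add (starRingEnd ℂ) _ _

theorem conjFn_sub (F G : smoothFrame p q) : conjFn (F - G) = conjFn F - conjFn G :=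
  smoothFrame_ext fun _ => map_sub (starRingEnd ℂ) _ _

theorem conjFn_mul (F G : smoothFrame p q) : conjFn (F * G) = conjFn F * conjFn G :=
  smoothFrame_ext fun _ => map_mul (starRingEnd ℂ) _ _

theorem conjFn_smul (c : ℂ) (F : smoothFrame p q) :
    conjFn (c • F) = (starRingEnd ℂ c) • conjFn F :=
  smoothFrame_ext fun _ => map_mul (starRingEnd ℂ) _ _

theorem conjFn_sum {ι : Type*} (s : Finset ι) (F : ι → smoothFrame p q) :
    conjFn (∑ i ∈ s, F i) = ∑ i ∈ s, conjFn (F i) :=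
  smoothFrame_ext fun z => by
    rw [conjFn_apply, coe_sum_apply, coe_sum_apply, map_sum]
    rfl

theorem dirDeriv_conjFn (v : Coord p q) (F : smoothFrame p q) :
    dirDeriv v (conjFn F) = conjFn (dirDeriv v F) := by
  refine smoothFrame_ext fun z => ?_
  have h := Complex.conjCLE.toContinuousLinearMap.hasFDerivAt.comp z.coord
    (differentiableAt_extend F z).hasFDerivAt
  rw [dirDeriv_eq_of_hasFDerivAt (fun w => ?_) h]
  · rfl
  · rw [Function.comp_apply, extend_coord]
    rfl

theorem dz_conjFn (A : Fin p ⊕ Fin q) (i : Fin p) (F : smoothFrame p q) :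
    dz A i (conjFn F) = conjFn (dzbar A i F) := by
  simp only [dz_apply, dzbar_apply, dirDeriv_conjFn, conjFn_smul, conjFn_add, Complex.conj_I,
    map_div₀, map_one, map_ofNat, neg_smul, sub_eq_add_neg]

theorem dzbar_conjFn (A : Fin p ⊕ Fin q) (i : Fin p) (F : smoothFrame p q) :
    dzbar A i (conjFn F) = conjFn (dz A i F) := by
  rw [← conjFn_conjFn (dzbar A i (conjFn F)), ← dz_conjFn, conjFn_conjFn]

/-- The coordinate function `z^A_i`. -/
def zfun (A : Fin p ⊕ Fin q) (i : Fin p) : smoothFrame p q :=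
  smoothOf (fun v => v A i) (contDiff_apply_apply ℝ ℂ A i).contDiffOn

theorem zfun_apply (A : Fin p ⊕ Fin q) (i : Fin p) (z : Frame p q) : (zfun A i).1 z = z.1 A i :=
  rfl

theorem dirDeriv_zfun (v : Coord p q) (A : Fin p ⊕ Fin q) (i : Fin p) (z : Frame p q) :
    (dirDeriv v (zfun A i)).1 z = v A i :=
  dirDeriv_eq_of_hasFDerivAt (f := fun v => v A i)
    (f' := (ContinuousLinearMap.proj (R := ℝ) (φ := fun _ : Fin p => ℂ) i).comp
      (ContinuousLinearMap.proj (R := ℝ) (φ := fun _ : Fin p ⊕ Fin q => Fin p → ℂ) A))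
    (fun _ => rfl) ((ContinuousLinearMap.proj (R := ℝ) (φ := fun _ : Fin p => ℂ) i).comp
      (ContinuousLinearMap.proj (R := ℝ) (φ := fun _ : Fin p ⊕ Fin q => Fin p → ℂ) A)).hasFDerivAt

theorem entryDir_apply (A B : Fin p ⊕ Fin q) (i j : Fin p) (c : ℂ) :
    entryDir A i c B j = if A = B ∧ i = j then c else 0 := by
  unfold entryDir
  rcases eq_or_ne A B with rfl | h
  · rcases eq_or_ne i j with rfl | h'
    · simp
    · simp [h']
  · simp [h]

theorem dz_zfun (A B : Fin p ⊕ Fin q) (i j : Fin p) :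
    dz A i (zfun (q := q) B j) = if A = B ∧ i = j then 1 else 0 := by
  refine smoothFrame_ext fun z => ?_
  rw [dz_apply, coe_smul_apply, coe_sub_apply, coe_smul_apply, dirDeriv_zfun, dirDeriv_zfun,
    entryDir_apply, entryDir_apply]
  split_ifs
  · norm_num
  · simp

theorem dzbar_zfun (A B : Fin p ⊕ Fin q) (i j : Fin p) :
    dzbar A i (zfun (q := q) B j) = 0 := by
  refine smoothFrame_ext fun z => ?_
  rw [dzbar_apply, coe_smul_apply, coe_add_apply, coe_smul_apply, dirDeriv_zfun, dirDeriv_zfun,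
    entryDir_apply, entryDir_apply]
  split_ifs
  · simp
  · simp

theorem dz_one (A : Fin p ⊕ Fin q) (i : Fin p) : dz A i (1 : smoothFrame p q) = 0 := by
  have h := dz_mul A i (1 : smoothFrame p q) 1
  simpa using h

theorem dzbar_one (A : Fin p ⊕ Fin q) (i : Fin p) : dzbar A i (1 : smoothFrame p q) = 0 := by
  have h := dzbar_mul A i (1 : smoothFrame p q) 1
  simpa using h

theorem momentum_eq (μ : ℝ) (i j : Fin p) : momentum (q := q) μ i j =
    ∑ A, conjFn (zfun A i) * zfun A j - ((μ : ℂ) * (1 : Matrix (Fin p) (Fin p) ℂ) i j) • 1 := by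
  refine smoothFrame_ext fun z => ?_
  rw [coe_sub_apply, coe_sum_apply]
  simp [momentum, Matrix.mul_apply, zfun_apply, conjFn_apply]

theorem conjFn_momentum (μ : ℝ) (i j : Fin p) :
    conjFn (momentum (q := q) μ i j) = momentum μ j i := by
  rw [momentum_eq, momentum_eq, conjFn_sub, conjFn_sum, conjFn_smul]
  congr 1
  · exact Finset.sum_congr rfl fun A _ => by rw [conjFn_mul, conjFn_conjFn, mul_comm]
  · have : conjFn (1 : smoothFrame p q) = 1 := smoothFrame_ext fun _ => map_one (starRingEnd ℂ)
    rw [this, map_mul, Complex.conj_ofReal]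
    congr 2
    rw [Matrix.one_apply, Matrix.one_apply]
    rcases eq_or_ne i j with rfl | h
    · simp
    · simp [h, h.symm]

theorem dzbar_momentum (μ : ℝ) (A : Fin p ⊕ Fin q) (k i j : Fin p) :
    dzbar A k (momentum (q := q) μ i j) = if k = i then zfun A j else 0 := by
  simp only [momentum_eq, map_sub, map_sum, map_smul, dzbar_one, dzbar_mul, dzbar_zfun,
    dzbar_conjFn, dz_zfun]
  rw [Finset.sum_eq_single A]
  · have : conjFn (1 : smoothFrame p q) = 1 := smoothFrame_ext fun _ => map_one (starRingEnd ℂ)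
    have h0 : conjFn (0 : smoothFrame p q) = 0 := smoothFrame_ext fun _ => map_zero (starRingEnd ℂ)
    split_ifs <;> simp_all
  · intro B _ hB
    have h0 : conjFn (0 : smoothFrame p q) = 0 := smoothFrame_ext fun _ => map_zero (starRingEnd ℂ)
    simp [hB.symm, h0]
  · simp

theorem dz_momentum (μ : ℝ) (A : Fin p ⊕ Fin q) (k i j : Fin p) :
    dz A k (momentum (q := q) μ i j) = if k = j then conjFn (zfun A i) else 0 := by
  rw [← conjFn_momentum, dz_conjFn, dzbar_momentum]
  split_ifs
  · rfl
  · exact smoothFrame_ext fun _ => map_zero (starRingEnd ℂ)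

end Calculus

/-! ### Right translations and fundamental vector fields -/

section Translation

variable {p q : ℕ}

/-- Right multiplication by a fixed matrix on the coordinate space. -/
def mulRightCLM (M : Matrix (Fin p) (Fin p) ℂ) : Coord p q →L[ℝ] Coord p q :=
  LinearMap.toContinuousLinearMap
    { toFun := fun v => Matrix.of.symm (Matrix.of v * M)
      map_add' := fun v w => Matrix.add_mul (Matrix.of v) (Matrix.of w) M
      map_smul' := fun c v => Matrix.smul_mul c (Matrix.of v) M }

theorem mulRightCLM_apply (M : Matrix (Fin p) (Fin p) ℂ) (v : Coord p q) (A : Fin p ⊕ Fin q)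
    (j : Fin p) : mulRightCLM M v A j = ∑ i, v A i * M i j := rfl

theorem coord_mul (z : Frame p q) (g : GL (Fin p) ℂ) :
    (z.mul g).coord = mulRightCLM g.1 z.coord := rfl

/-- The right translate `z ↦ F (z g)` of a smooth function. -/
def translate (g : GL (Fin p) ℂ) (F : smoothFrame p q) : smoothFrame p q :=
  ⟨fun z => F.1 (z.mul g), by
    intro v hv
    have h : ContDiffAt ℝ ∞ (fun v : Coord p q => extend F.1 (mulRightCLM g.1 v)) v :=
      ContDiffAt.comp (f := fun v : Coord p q => mulRightCLM g.1 v) v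
        (contDiffAt_extend F (Frame.mul ⟨Matrix.of v, hv⟩ g))
        (mulRightCLM g.1).contDiff.contDiffAt
    refine (h.congr_of_eventuallyEq ?_).contDiffWithinAt
    exact extend_eventuallyEq ⟨Matrix.of v, hv⟩ fun w => (extend_coord F.1 (w.mul g)).symm⟩

theorem translate_apply (g : GL (Fin p) ℂ) (F : smoothFrame p q) (z : Frame p q) :
    (translate g F).1 z = F.1 (z.mul g) := rfl

theorem translate_smul (g : GL (Fin p) ℂ) (c : ℂ) (F : smoothFrame p q) :
    translate g (c • F) = c • translate g F := rfl

theorem translate_sum (g : GL (Fin p) ℂ) {ι : Type*} (s : Finset ι) (F : ι → smoothFrame p q) :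
    translate g (∑ i ∈ s, F i) = ∑ i ∈ s, translate g (F i) :=
  smoothFrame_ext fun z => by
    rw [translate_apply, coe_sum_apply, coe_sum_apply]
    rfl

theorem translate_conjFn (g : GL (Fin p) ℂ) (F : smoothFrame p q) :
    translate g (conjFn F) = conjFn (translate g F) := rfl

theorem dirDeriv_translate (v : Coord p q) (g : GL (Fin p) ℂ) (F : smoothFrame p q) :
    dirDeriv v (translate g F) = translate g (dirDeriv (mulRightCLM g.1 v) F) := by
  refine smoothFrame_ext fun z => ?_
  have h : HasFDerivAt (fun v => extend F.1 (mulRightCLM g.1 v))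
      ((fderiv ℝ (extend F.1) (z.mul g).coord).comp (mulRightCLM g.1)) z.coord :=
    (differentiableAt_extend F (z.mul g)).hasFDerivAt.comp z.coord
      (mulRightCLM g.1).hasFDerivAt
  rw [dirDeriv_eq_of_hasFDerivAt (fun w => ?_) h]
  · rfl
  · exact (extend_coord F.1 (w.mul g)).symm

theorem mulRightCLM_entryDir (M : Matrix (Fin p) (Fin p) ℂ) (A : Fin p ⊕ Fin q) (i : Fin p)
    (c : ℂ) : mulRightCLM M (entryDir (q := q) A i c) = ∑ j, entryDir A j (c * M i j) := by
  ext B k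
  simp only [mulRightCLM_apply, Finset.sum_apply, entryDir_apply]
  by_cases h : A = B <;> simp [h]

theorem dz_translate (A : Fin p ⊕ Fin q) (i : Fin p) (g : GL (Fin p) ℂ) (F : smoothFrame p q) :
    dz A i (translate g F) = ∑ j, g.1 i j • translate g (dz A j F) := by
  simp only [dz_apply A i, dirDeriv_translate, mulRightCLM_entryDir, dirDeriv_sum_dir,
    dirDeriv_entryDir, translate_sum]
  rw [Finset.smul_sum, ← Finset.sum_sub_distrib, Finset.smul_sum]
  refine Finset.sum_congr rfl fun j _ => smoothFrame_ext fun z => ?_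
  simp only [translate_apply, coe_smul_apply, coe_add_apply, coe_sub_apply, map_mul,
    Complex.conj_I, map_one]
  ring_nf
  rw [Complex.I_sq]
  ring

theorem dzbar_translate (A : Fin p ⊕ Fin q) (i : Fin p) (g : GL (Fin p) ℂ)
    (F : smoothFrame p q) :
    dzbar A i (translate g F) = ∑ j, (starRingEnd ℂ (g.1 i j)) • translate g (dzbar A j F) := by
  rw [← conjFn_conjFn F, translate_conjFn, dzbar_conjFn, dz_translate, conjFn_sum]
  simp only [conjFn_smul, dzbar_conjFn, translate_conjFn]

/-- The holomorphic part `E_ij = ∑_A z^A_i ∂/∂z^A_j` of the fundamental vector fields of the right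
action of `GL(p, ℂ)`. -/
def euler (i j : Fin p) : smoothFrame p q →ₗ[ℂ] smoothFrame p q where
  toFun F := ∑ A, zfun A i * dz A j F
  map_add' F G := by simp only [map_add, mul_add, Finset.sum_add_distrib]
  map_smul' c F := by simp only [map_smul, mul_smul_comm, Finset.smul_sum, RingHom.id_apply]

/-- The antiholomorphic part `∑_A z̄^A_i ∂/∂z̄^A_j` of the fundamental vector fields of the right
action of `GL(p, ℂ)`. -/
def eulerBar (i j : Fin p) : smoothFrame p q →ₗ[ℂ] smoothFrame p q where
  toFun F := ∑ A, conjFn (zfun A i) * dzbar A j F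
  map_add' F G := by simp only [map_add, mul_add, Finset.sum_add_distrib]
  map_smul' c F := by simp only [map_smul, mul_smul_comm, Finset.smul_sum, RingHom.id_apply]

theorem euler_apply (i j : Fin p) (F : smoothFrame p q) :
    euler i j F = ∑ A, zfun A i * dz A j F := rfl

theorem eulerBar_apply (i j : Fin p) (F : smoothFrame p q) :
    eulerBar i j F = ∑ A, conjFn (zfun A i) * dzbar A j F := rfl

theorem euler_mul (i j : Fin p) (F G : smoothFrame p q) :
    euler i j (F * G) = euler i j F * G + F * euler i j G := by
  simp only [euler_apply, dz_mul, Finset.sum_mul, Finset.mul_sum, ← Finset.sum_add_distrib]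
  exact Finset.sum_congr rfl fun A _ => by ring

/-- The derivative at `z` in the direction `z M` of the orbit through `z`. -/
theorem fderiv_mulRight (F : smoothFrame p q) (z : Frame p q) (M : Matrix (Fin p) (Fin p) ℂ) :
    fderiv ℝ (extend F.1) z.coord (mulRightCLM M z.coord) =
      ∑ i, ∑ j, (M i j * (euler i j F).1 z + (starRingEnd ℂ (M i j)) * (eulerBar i j F).1 z) := by
  rw [← dirDeriv_apply, dirDeriv_eq_sum]
  simp only [coe_sum_apply, coe_add_apply, coe_smul_apply, euler_apply, eulerBar_apply,
    coe_mul_apply, mulRightCLM_apply, map_sum, map_mul, Finset.sum_mul, Finset.mul_sum,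
    ← Finset.sum_add_distrib, zfun_apply, conjFn_apply]
  rw [Finset.sum_comm]
  conv_lhs =>
    enter [2, j]
    rw [Finset.sum_comm]
  rw [Finset.sum_comm]
  refine Finset.sum_congr rfl fun i _ => Finset.sum_congr rfl fun j _ =>
    Finset.sum_congr rfl fun A _ => ?_
  change z.1 A i * _ * _ + (starRingEnd ℂ (z.1 A i)) * _ * _ = _
  ring

theorem euler_eq_fderiv (F : smoothFrame p q) (z : Frame p q) (i j : Fin p) :
    (euler i j F).1 z = (1 / 2 : ℂ) *
      (fderiv ℝ (extend F.1) z.coord (mulRightCLM (Matrix.single i j 1) z.coord) -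
        Complex.I *
        fderiv ℝ (extend F.1) z.coord (mulRightCLM (Matrix.single i j Complex.I) z.coord)) := by
  have key : ∀ c : ℂ, fderiv ℝ (extend F.1) z.coord (mulRightCLM (Matrix.single i j c) z.coord) =
      c * (euler i j F).1 z + (starRingEnd ℂ c) * (eulerBar i j F).1 z := by
    intro c
    rw [fderiv_mulRight, Finset.sum_eq_single i, Finset.sum_eq_single j]
    · simp
    · intro b _ hb
      simp [hb.symm]
    · simp
    · intro b _ hb
      simp [hb.symm]
    · simp
  rw [key, key, Complex.conj_I, map_one]
  ring_nf
  rw [Complex.I_sq]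
  ring

theorem hasDerivAt_extend_comp (F : smoothFrame p q) (z : Frame p q) {γ : ℝ → Coord p q}
    {v : Coord p q} (h0 : γ 0 = z.coord) (hγ : HasDerivAt γ v 0) :
    HasDerivAt (fun t => extend F.1 (γ t)) (fderiv ℝ (extend F.1) z.coord v) 0 := by
  have h := (differentiableAt_extend F z).hasFDerivAt
  rw [← h0] at h ⊢
  exact h.comp_hasDerivAt (0 : ℝ) hγ

theorem eventually_isUnit_one_add_smul (M : Matrix (Fin p) (Fin p) ℂ) :
    ∀ᶠ t : ℝ in nhds 0, IsUnit (1 + (t : ℂ) • M) := by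
  have hc : Continuous fun t : ℝ => (1 + (t : ℂ) • M).det := by
    refine Continuous.matrix_det ?_
    fun_prop
  have h : ∀ᶠ t : ℝ in nhds 0, (1 + (t : ℂ) • M).det ≠ 0 :=
    hc.continuousAt.eventually_ne (by simp)
  filter_upwards [h] with t ht
  exact (Matrix.isUnit_iff_isUnit_det _).mpr (isUnit_iff_ne_zero.mpr ht)

theorem hasDerivAt_line (z : Frame p q) (M : Matrix (Fin p) (Fin p) ℂ) :
    HasDerivAt (fun t : ℝ => mulRightCLM (1 + (t : ℂ) • M) z.coord)
      (mulRightCLM M z.coord) 0 := by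
  have h : (fun t : ℝ => mulRightCLM (1 + (t : ℂ) • M) z.coord) =
      fun t => z.coord + t • mulRightCLM M z.coord := by
    ext t A j
    simp only [mulRightCLM_apply, Matrix.add_apply, Matrix.smul_apply, Pi.add_apply, Pi.smul_apply,
      mul_add, Finset.sum_add_distrib, smul_eq_mul, Complex.real_smul, Finset.mul_sum]
    congr 1
    · simp [Matrix.one_apply]
    · exact Finset.sum_congr rfl fun i _ => by ring
  rw [h]
  simpa using ((hasDerivAt_id (0 : ℝ)).smul_const (mulRightCLM M z.coord)).const_add z.coord

/-- The derivative along an orbit, computed on the lines `z (1 + t M)`. -/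
theorem fderiv_mulRight_eq (F : smoothFrame p q) (z : Frame p q) (M : Matrix (Fin p) (Fin p) ℂ)
    {φ : ℝ → ℂ} {c : ℂ} (hφ : HasDerivAt φ c 0)
    (h : ∀ (t : ℝ) (g : GL (Fin p) ℂ), g.1 = 1 + (t : ℂ) • M → F.1 (z.mul g) = φ t) :
    fderiv ℝ (extend F.1) z.coord (mulRightCLM M z.coord) = c := by
  have h0 : mulRightCLM (1 + ((0 : ℝ) : ℂ) • M) z.coord = z.coord := by
    ext A j
    simp [mulRightCLM_apply, Matrix.one_apply]
  have h1 := hasDerivAt_extend_comp F z h0 (hasDerivAt_line z M)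
  refine h1.unique (hφ.congr_of_eventuallyEq ?_)
  filter_upwards [eventually_isUnit_one_add_smul M] with t ht
  obtain ⟨g, hg⟩ := ht
  rw [← h t g hg, ← extend_coord F.1, coord_mul, hg]

theorem euler_of_mem_homogeneousFn {F : smoothFrame p q} (hF : F ∈ homogeneousFn p q)
    (i j : Fin p) : euler i j F = 0 := by
  refine smoothFrame_ext fun z => ?_
  have key : ∀ M, fderiv ℝ (extend F.1) z.coord (mulRightCLM M z.coord) = 0 := fun M =>
    fderiv_mulRight_eq F z M (hasDerivAt_const (0 : ℝ) (F.1 z)) fun t g _ => hF z g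
  rw [euler_eq_fderiv, key, key]
  simp

section UnitaryCurve

attribute [local instance] Matrix.linftyOpNormedRing Matrix.linftyOpNormedAlgebra

/-- The one-parameter group generated by a skew-Hermitian matrix. -/
theorem exists_unitary_curve {M : Matrix (Fin p) (Fin p) ℂ} (hM : Mᴴ = -M) :
    ∃ U : ℝ → Matrix.unitaryGroup (Fin p) ℂ, U 0 = 1 ∧
      ∀ i j, HasDerivAt (fun t => (U t).1 i j) (M i j) 0 := by
  have hmem : ∀ t : ℝ, NormedSpace.exp (t • M) ∈ Matrix.unitaryGroup (Fin p) ℂ := by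
    intro t
    rw [Matrix.mem_unitaryGroup_iff, Matrix.star_eq_conjTranspose, ← Matrix.exp_conjTranspose,
      Matrix.conjTranspose_smul, hM, smul_neg, star_trivial, Matrix.exp_neg]
    exact Matrix.mul_nonsing_inv _ ((Matrix.isUnit_iff_isUnit_det _).mp (Matrix.isUnit_exp _))
  refine ⟨fun t => ⟨_, hmem t⟩, Subtype.ext (by simp), fun i j => ?_⟩
  have h := hasDerivAt_exp_smul_const (𝕂 := ℝ) M (0 : ℝ)
  have h2 := (LinearMap.toContinuousLinearMap
    (Matrix.entryLinearMap ℝ ℂ i j)).hasFDerivAt.comp_hasDerivAt (0 : ℝ) h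
  simp only [zero_smul, NormedSpace.exp_zero, one_mul] at h2
  exact h2

end UnitaryCurve

end Translation

/-! ### The Wick product -/

section Wick

variable {p q : ℕ}

theorem wickPower_zero (F G : smoothFrame p q) : wickPower 0 F G = F * G := rfl

theorem wickPower_succ (r : ℕ) (F G : smoothFrame p q) :
    wickPower (r + 1) F G = ∑ A, ∑ i, wickPower r (dz A i F) (dzbar A i G) := by
  simp only [wickPower, LinearMap.sum_apply, LinearMap.compl₁₂_apply]

theorem wickPower_one (F G : smoothFrame p q) :
    wickPower 1 F G = ∑ A, ∑ i, dz A i F * dzbar A i G := wickPower_succ 0 F G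

theorem wickPower_eq_biPower (r : ℕ) (F G : smoothFrame p q) :
    wickPower r F G = biPower (ι := (Fin p ⊕ Fin q) × Fin p) (fun a => dz a.1 a.2)
      (fun a => dzbar a.1 a.2) r F G := by
  induction r generalizing F G with
  | zero => rfl
  | succ r ih => simp only [wickPower_succ, biPower_succ, ih, Fintype.sum_prod_type]

theorem wick_assoc (F G H : (smoothFrame p q)⟦X⟧) :
    wick p q (wick p q F G) H = wick p q F (wick p q G H) := by
  refine formalBilin_assoc (fun n f g h => ?_) F G H
  have e := biPower_assoc (ι := (Fin p ⊕ Fin q) × Fin p) (A := smoothFrame p q)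
    (d := fun a => dz a.1 a.2) (d' := fun a => dzbar a.1 a.2)
    (fun a => dz_mul a.1 a.2) (fun a => dzbar_mul a.1 a.2)
    (fun a b => dz_dz_comm a.1 b.1 a.2 b.2) (fun a b => dz_dzbar_comm a.1 b.1 a.2 b.2)
    (fun a b => dzbar_dzbar_comm a.1 b.1 a.2 b.2) n f g h
  simpa only [LinearMap.smul_apply, wickPower_eq_biPower] using e

theorem coeff_wick (F G : (smoothFrame p q)⟦X⟧) (n : ℕ) :
    PowerSeries.coeff n (wick p q F G) = ∑ k ∈ Finset.HasAntidiagonal.antidiagonal n,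
      ∑ l ∈ Finset.HasAntidiagonal.antidiagonal k.2, (1 / (k.1.factorial : ℂ)) •
        wickPower k.1 (PowerSeries.coeff l.1 F) (PowerSeries.coeff l.2 G) :=
  coeff_formalBilin _ F G n

theorem wickPower_one_right (r : ℕ) (F : smoothFrame p q) : wickPower (r + 1) F 1 = 0 := by
  simp [wickPower_succ, dzbar_one]

theorem wickPower_one_left (r : ℕ) (F : smoothFrame p q) : wickPower (r + 1) 1 F = 0 := by
  simp [wickPower_succ, dz_one]

theorem wick_one (F : (smoothFrame p q)⟦X⟧) : wick p q F 1 = F := by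
  ext1 n
  rw [← map_one PowerSeries.C]
  refine (coeff_formalBilin_C_right _ F 1 n).trans ?_
  rw [Finset.sum_eq_single (0, n)]
  · simp [wickPower_zero]
  · rintro ⟨a, b⟩ h hne
    rcases a with _ | a
    · simp at h
      exact absurd (by simp [h]) hne
    · simp [wickPower_one_right]
  · simp

theorem one_wick (F : (smoothFrame p q)⟦X⟧) : wick p q 1 F = F := by
  ext1 n
  rw [← map_one PowerSeries.C]
  refine (coeff_formalBilin_C_left _ 1 F n).trans ?_
  rw [Finset.sum_eq_single (0, n)]
  · simp [wickPower_zero]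
  · rintro ⟨a, b⟩ h hne
    rcases a with _ | a
    · simp at h
      exact absurd (by simp [h]) hne
    · simp [wickPower_one_left]
  · simp

theorem conjFn_wickPower (r : ℕ) (F G : smoothFrame p q) :
    conjFn (wickPower r F G) = wickPower r (conjFn G) (conjFn F) := by
  induction r generalizing F G with
  | zero => rw [wickPower_zero, wickPower_zero, conjFn_mul, mul_comm]
  | succ r ih => simp only [wickPower_succ, conjFn_sum, ih, dz_conjFn, dzbar_conjFn]

/-- Coefficientwise complex conjugation of formal power series of functions. -/
def conjSeries (F : (smoothFrame p q)⟦X⟧) : (smoothFrame p q)⟦X⟧ :=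
  PowerSeries.mk fun n => conjFn (PowerSeries.coeff n F)

theorem coeff_conjSeries (F : (smoothFrame p q)⟦X⟧) (n : ℕ) :
    PowerSeries.coeff n (conjSeries F) = conjFn (PowerSeries.coeff n F) := by
  simp [conjSeries]

theorem conjSeries_sub (F G : (smoothFrame p q)⟦X⟧) :
    conjSeries (F - G) = conjSeries F - conjSeries G := by
  ext1 n
  simp only [coeff_conjSeries, map_sub, conjFn_sub]

theorem conjSeries_sum {ι : Type*} (s : Finset ι) (F : ι → (smoothFrame p q)⟦X⟧) :
    conjSeries (∑ i ∈ s, F i) = ∑ i ∈ s, conjSeries (F i) := by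
  ext1 n
  simp only [coeff_conjSeries, map_sum, conjFn_sum]

theorem conjSeries_wick (F G : (smoothFrame p q)⟦X⟧) :
    conjSeries (wick p q F G) = wick p q (conjSeries G) (conjSeries F) := by
  ext1 n
  simp only [coeff_conjSeries, coeff_wick, conjFn_sum, conjFn_smul, conjFn_wickPower, map_div₀,
    map_one, map_natCast]
  refine Finset.sum_congr rfl fun k _ => ?_
  rw [← Finset.Nat.sum_antidiagonal_swap]
  rfl

/-- Contraction of dual bases: if `Q P = 1`, a sum of values of a bilinear map is unchanged when
its arguments are transformed by `P` and `Q`. -/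
theorem sum_bilin_contract {V W X : Type*} [AddCommGroup V] [Module ℂ V] [AddCommGroup W]
    [Module ℂ W] [AddCommGroup X] [Module ℂ X] (B : V →ₗ[ℂ] W →ₗ[ℂ] X)
    {P Q : Matrix (Fin p) (Fin p) ℂ} (h : Q * P = 1) (x : Fin p → V) (y : Fin p → W) :
    ∑ i, B (∑ k, P i k • x k) (∑ l, Q l i • y l) = ∑ k, B (x k) (y k) := by
  simp only [map_sum, map_smul, LinearMap.sum_apply, LinearMap.smul_apply, smul_smul,
    Finset.smul_sum]
  rw [Finset.sum_comm]
  refine (Finset.sum_congr rfl fun l _ => Finset.sum_comm).trans ?_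
  refine Finset.sum_congr rfl fun l _ => ?_
  have h1 : ∀ k, ∑ i, (Q l i * P i k) • B (x k) (y l) =
      (1 : Matrix (Fin p) (Fin p) ℂ) l k • B (x k) (y l) := by
    intro k
    rw [← Finset.sum_smul, ← Matrix.mul_apply, h]
  simp only [h1, Matrix.one_apply, ite_smul, one_smul, zero_smul, Finset.sum_ite_eq,
    Finset.mem_univ, if_true]

theorem star_mul_self_unitary (U : Matrix.unitaryGroup (Fin p) ℂ) : star U.1 * U.1 = 1 :=
  Matrix.mem_unitaryGroup_iff'.mp U.2

theorem self_mul_star_unitary (U : Matrix.unitaryGroup (Fin p) ℂ) : U.1 * star U.1 = 1 :=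
  Matrix.mem_unitaryGroup_iff.mp U.2

/-- The Wick product is `U(p)`-invariant: under right translation by `U` the derivatives `∂/∂z` and
`∂/∂z̄` transform by `U` and by its complex conjugate, which cancel in the contraction. -/
theorem wickPower_translate (U : Matrix.unitaryGroup (Fin p) ℂ) (r : ℕ) (F G : smoothFrame p q) :
    wickPower r (translate (Unitary.toUnits U) F) (translate (Unitary.toUnits U) G) =
      translate (Unitary.toUnits U) (wickPower r F G) := by
  induction r generalizing F G with
  | zero => rfl
  | succ r ih =>
    simp only [wickPower_succ, dz_translate, dzbar_translate, translate_sum, ← ih]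
    exact Finset.sum_congr rfl fun A _ =>
      sum_bilin_contract (wickPower r) (star_mul_self_unitary U) _ _

theorem mem_invariantFn_iff {F : smoothFrame p q} :
    F ∈ invariantFn p q ↔ ∀ U, translate (Unitary.toUnits U) F = F :=
  ⟨fun h U => smoothFrame_ext fun z => h z U, fun h z U => congrArg (fun G => G.1 z) (h U)⟩

theorem wickPower_mem_invariantFn (r : ℕ) {F G : smoothFrame p q} (hF : F ∈ invariantFn p q)
    (hG : G ∈ invariantFn p q) : wickPower r F G ∈ invariantFn p q := by
  rw [mem_invariantFn_iff] at hF hG ⊢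
  intro U
  rw [← wickPower_translate, hF, hG]

theorem wick_mem_formalInv {F G : (smoothFrame p q)⟦X⟧} (hF : F ∈ formalInv p q)
    (hG : G ∈ formalInv p q) : wick p q F G ∈ formalInv p q := by
  intro n
  rw [coeff_wick]
  exact Submodule.sum_mem _ fun k _ => Submodule.sum_mem _ fun l _ =>
    Submodule.smul_mem _ _ (wickPower_mem_invariantFn _ (hF _) (hG _))

theorem homogeneousFn_le_invariantFn : homogeneousFn p q ≤ invariantFn p q :=
  fun _ hF z U => hF z (Unitary.toUnits U)

theorem formalHom_le_formalInv : formalHom p q ≤ formalInv p q :=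
  fun _ hF n => homogeneousFn_le_invariantFn (hF n)

/-! ### Equivariant matrix valued functions -/

/-- Smooth maps `K` to `gl(p, ℂ)` with `K (z U) = U⁻¹ K(z) U` for all `U ∈ U(p)`. -/
def EquivariantFn (K : Matrix (Fin p) (Fin p) (smoothFrame p q)) : Prop :=
  ∀ (z : Frame p q) (U : Matrix.unitaryGroup (Fin p) ℂ),
    (Matrix.of fun i j => (K i j).1 (z.mulU U)) =
      star U.1 * (Matrix.of fun i j => (K i j).1 z) * U.1

theorem equivariantFn_iff {K : Matrix (Fin p) (Fin p) (smoothFrame p q)} :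
    EquivariantFn K ↔ ∀ U i j, translate (Unitary.toUnits U) (K i j) =
      ∑ k, star U.1 i k • ∑ l, U.1 l j • K k l := by
  have key : ∀ z (U : Matrix.unitaryGroup (Fin p) ℂ) i j,
      (star U.1 * (Matrix.of fun i j => (K i j).1 z) * U.1) i j =
        (∑ k, star U.1 i k • ∑ l, U.1 l j • K k l).1 z := by
    intro z U i j
    simp only [coe_sum_apply, coe_smul_apply, Matrix.mul_apply, Matrix.of_apply, Finset.sum_mul,
      Finset.mul_sum]
    rw [Finset.sum_comm]
    exact Finset.sum_congr rfl fun k _ => Finset.sum_congr rfl fun l _ => by ring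
  constructor
  · intro h U i j
    exact smoothFrame_ext fun z => (congrFun (congrFun (h z U) i) j).trans (key z U i j)
  · intro h z U
    ext i j
    exact (congrArg (fun G => G.1 z) (h U i j)).trans (key z U i j).symm

theorem equivariantFn_momentum (μ : ℝ) :
    EquivariantFn (p := p) (q := q) (Matrix.of fun i j => momentum μ i j) := by
  intro z U
  have h : ∀ w : Frame p q, (Matrix.of fun i j => (momentum (q := q) μ i j).1 w) =
      w.1ᴴ * w.1 - (μ : ℂ) • (1 : Matrix (Fin p) (Fin p) ℂ) := fun w => rfl
  simp only [Matrix.of_apply]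
  rw [h, h, Matrix.mul_sub, Matrix.sub_mul, Matrix.mul_smul, Matrix.mul_one, Matrix.smul_mul,
    star_mul_self_unitary]
  congr 1
  change (z.1 * U.1)ᴴ * (z.1 * U.1) = _
  rw [Matrix.conjTranspose_mul, Matrix.star_eq_conjTranspose]
  simp only [Matrix.mul_assoc]

/-- The trace pairing of two equivariant maps, with products replaced by a term of the Wick
product, is invariant. -/
theorem sum_wickPower_mem_invariantFn (r : ℕ) {K M : Matrix (Fin p) (Fin p) (smoothFrame p q)}
    (hK : EquivariantFn K) (hM : EquivariantFn M) :
    ∑ i, ∑ j, wickPower r (K i j) (M j i) ∈ invariantFn p q := by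
  rw [mem_invariantFn_iff]
  intro U
  rw [equivariantFn_iff] at hK hM
  simp only [translate_sum, ← wickPower_translate, hK, hM]
  have hM' : ∀ i j, ∑ k, star U.1 j k • ∑ l, U.1 l i • M k l =
      ∑ l, U.1 l i • ∑ k, star U.1 j k • M k l := by
    intro i j
    simp only [Finset.smul_sum, smul_smul]
    rw [Finset.sum_comm]
    simp only [mul_comm]
  simp only [hM']
  rw [Finset.sum_comm]
  refine (Finset.sum_congr rfl fun j _ =>
    sum_bilin_contract (wickPower r) (self_mul_star_unitary U) _ _).trans ?_
  rw [Finset.sum_comm]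
  refine Finset.sum_congr rfl fun k _ => ?_
  refine (Finset.sum_congr rfl fun j _ => ?_).trans
    (sum_bilin_contract (wickPower r) (P := U.1ᵀ) (Q := (star U.1)ᵀ) ?_ (fun l => K k l)
      (fun l => M l k))
  · rfl
  · rw [← Matrix.transpose_mul, self_mul_star_unitary, Matrix.transpose_one]

theorem EquivariantFn.wickPower_left {K : Matrix (Fin p) (Fin p) (smoothFrame p q)}
    (hK : EquivariantFn K) {F : smoothFrame p q} (hF : F ∈ invariantFn p q) (r : ℕ) :
    EquivariantFn <| Matrix.of fun i j => wickPower r F (K i j) := by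
  rw [equivariantFn_iff] at hK ⊢
  intro U i j
  simp only [Matrix.of_apply]
  rw [← wickPower_translate, hK, mem_invariantFn_iff.mp hF]
  simp only [map_sum, map_smul]

theorem EquivariantFn.mul_left {K : Matrix (Fin p) (Fin p) (smoothFrame p q)}
    (hK : EquivariantFn K) {F : smoothFrame p q} (hF : F ∈ invariantFn p q) :
    EquivariantFn <| Matrix.of fun i j => F * K i j := hK.wickPower_left hF 0

theorem equivariantFn_zero : EquivariantFn (0 : Matrix (Fin p) (Fin p) (smoothFrame p q)) := by
  rw [equivariantFn_iff]
  intro U i j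
  simp only [Matrix.zero_apply, smul_zero, Finset.sum_const_zero]
  rfl

theorem EquivariantFn.add {K M : Matrix (Fin p) (Fin p) (smoothFrame p q)}
    (hK : EquivariantFn K) (hM : EquivariantFn M) : EquivariantFn (K + M) := by
  rw [equivariantFn_iff] at hK hM ⊢
  intro U i j
  simp only [Matrix.add_apply, smul_add, Finset.sum_add_distrib, ← hK, ← hM]
  rfl

theorem EquivariantFn.smul {K : Matrix (Fin p) (Fin p) (smoothFrame p q)}
    (hK : EquivariantFn K) (c : ℂ) : EquivariantFn (c • K) := by
  rw [equivariantFn_iff] at hK ⊢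
  intro U i j
  simp only [Matrix.smul_apply, translate_smul, hK, Finset.smul_sum, smul_comm c]

theorem EquivariantFn.sum {ι : Type*} (s : Finset ι)
    {K : ι → Matrix (Fin p) (Fin p) (smoothFrame p q)} (hK : ∀ a ∈ s, EquivariantFn (K a)) :
    EquivariantFn (∑ a ∈ s, K a) := by
  classical
  induction s using Finset.induction_on with
  | empty => exact equivariantFn_zero
  | insert a s ha ih =>
    rw [Finset.sum_insert ha]
    exact (hK a (Finset.mem_insert_self a s)).add
      (ih fun b hb => hK b (Finset.mem_insert_of_mem hb))

theorem EquivariantFn.conj {K : Matrix (Fin p) (Fin p) (smoothFrame p q)}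
    (hK : EquivariantFn K) : EquivariantFn <| Matrix.of fun i j => conjFn (K j i) := by
  intro z U
  have h := congrArg Matrix.conjTranspose (hK z U)
  rw [Matrix.conjTranspose_mul, Matrix.conjTranspose_mul, Matrix.star_eq_conjTranspose,
    Matrix.conjTranspose_conjTranspose, ← Matrix.mul_assoc] at h
  exact h

theorem isEquivariant_iff {G : Matrix (Fin p) (Fin p) (smoothFrame p q)⟦X⟧} :
    IsEquivariant G ↔ ∀ n, EquivariantFn <|
      Matrix.of fun i j => PowerSeries.coeff n (G i j) := Iff.rfl

/-! ### The infinitesimal form of equivariance -/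

/-- The derivative of an equivariant map along a skew-Hermitian direction is a commutator. -/
theorem EquivariantFn.fderiv_mulRight {K : Matrix (Fin p) (Fin p) (smoothFrame p q)}
    (hK : EquivariantFn K) {M : Matrix (Fin p) (Fin p) ℂ} (hM : Mᴴ = -M) (z : Frame p q)
    (a b : Fin p) : fderiv ℝ (extend (K a b).1) z.coord (mulRightCLM M z.coord) =
      ∑ k, ((K a k).1 z * M k b - M a k * (K k b).1 z) := by
  obtain ⟨U, hU0, hU⟩ := exists_unitary_curve hM
  have h0 : mulRightCLM (U 0).1 z.coord = z.coord := by
    rw [hU0]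
    ext A j
    simp [mulRightCLM_apply, Matrix.one_apply]
  have hγ : HasDerivAt (fun t => mulRightCLM (U t).1 z.coord) (mulRightCLM M z.coord) 0 := by
    refine hasDerivAt_pi.mpr fun A => hasDerivAt_pi.mpr fun j => ?_
    simp only [mulRightCLM_apply]
    exact HasDerivAt.fun_sum fun i _ => (hU i j).const_mul (z.coord A i)
  have h1 := hasDerivAt_extend_comp (K a b) z h0 hγ
  have h2 : (fun t => extend (K a b).1 (mulRightCLM (U t).1 z.coord)) =
      fun t => ∑ k, ∑ l, starRingEnd ℂ ((U t).1 k a) * ((K k l).1 z * (U t).1 l b) := by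
    funext t
    have h3 := congrFun (congrFun (hK z (U t)) a) b
    have h4 : extend (K a b).1 (mulRightCLM (U t).1 z.coord) = (K a b).1 (z.mulU (U t)) :=
      extend_coord (K a b).1 (z.mulU (U t))
    rw [h4]
    refine h3.trans ?_
    rw [Matrix.mul_assoc, Matrix.mul_apply]
    simp only [Matrix.mul_apply, Finset.mul_sum, Matrix.of_apply, Matrix.star_apply]
    rfl
  have h5 : HasDerivAt (fun t => ∑ k, ∑ l, starRingEnd ℂ ((U t).1 k a) *
      ((K k l).1 z * (U t).1 l b)) (∑ k, ∑ l, (starRingEnd ℂ (M k a) *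
        ((K k l).1 z * (U 0).1 l b) + starRingEnd ℂ ((U 0).1 k a) * ((K k l).1 z * M l b))) 0 := by
    refine HasDerivAt.fun_sum fun k _ => HasDerivAt.fun_sum fun l _ => ?_
    have hc : HasDerivAt (fun t => starRingEnd ℂ ((U t).1 k a)) (starRingEnd ℂ (M k a)) 0 :=
      Complex.conjCLE.toContinuousLinearMap.hasFDerivAt.comp_hasDerivAt (0 : ℝ) (hU k a)
    exact hc.mul ((hU l b).const_mul ((K k l).1 z))
  rw [h2] at h1
  rw [h1.unique h5, hU0]
  have hM' : ∀ k, starRingEnd ℂ (M k a) = -M a k := fun k => congrFun (congrFun hM a) k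
  simp only [OneMemClass.coe_one, Matrix.one_apply, mul_ite, mul_one, mul_zero, hM',
    Finset.sum_add_distrib, Finset.sum_ite_eq', Finset.mem_univ, if_true, apply_ite (starRingEnd ℂ),
    map_one, map_zero, ite_mul, one_mul, zero_mul, Finset.sum_sub_distrib]
  rw [Finset.sum_comm (γ := Fin p)]
  simp [sub_eq_add_neg, add_comm]

/-- Infinitesimal equivariance under the complexified Lie algebra. -/
theorem EquivariantFn.euler_sub_eulerBar {K : Matrix (Fin p) (Fin p) (smoothFrame p q)}
    (hK : EquivariantFn K) (z : Frame p q) (a b i j : Fin p) :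
    (euler i j (K a b)).1 z - (eulerBar j i (K a b)).1 z =
      (if j = b then (K a i).1 z else 0) - (if a = i then (K j b).1 z else 0) := by
  -- the defect `S` is linear in `gl(p, ℂ) = u(p) ⊕ i u(p)` and vanishes on `u(p)`
  set S : Fin p → Fin p → ℂ := fun i j =>
    (euler i j (K a b)).1 z - (eulerBar j i (K a b)).1 z -
      ((if j = b then (K a i).1 z else 0) - (if a = i then (K j b).1 z else 0)) with hS
  have key : ∀ M : Matrix (Fin p) (Fin p) ℂ, Mᴴ = -M → ∑ i, ∑ j, M i j * S i j = 0 := by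
    intro M hM
    have h1 := hK.fderiv_mulRight hM z a b
    rw [GrassmannStar.fderiv_mulRight] at h1
    have hM' : ∀ i j, starRingEnd ℂ (M i j) = -M j i := fun i j => congrFun (congrFun hM j) i
    simp only [hM', Finset.sum_add_distrib, neg_mul, Finset.sum_neg_distrib] at h1
    rw [Finset.sum_comm (f := fun i j => M j i * (eulerBar i j (K a b)).1 z)] at h1
    simp only [hS, mul_sub, Finset.sum_sub_distrib, mul_ite, mul_zero, Finset.sum_ite_eq',
      Finset.mem_univ, if_true]
    have h2 : ∑ i, ∑ j, (if a = i then M i j * (K j b).1 z else 0) =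
        ∑ j, M a j * (K j b).1 z := by
      rw [Finset.sum_comm]
      simp
    rw [h2, sub_eq_zero, sub_eq_add_neg, h1, Finset.sum_sub_distrib]
    simp only [mul_comm]
  have hsingle : ∀ (c : ℂ) (k l : Fin p),
      ∑ i, ∑ j, Matrix.single k l c i j * S i j = c * S k l := by
    intro c k l
    rw [Finset.sum_eq_single k, Finset.sum_eq_single l]
    · simp
    · intro b _ hb
      simp [hb.symm]
    · simp
    · intro b _ hb
      simp [hb.symm]
    · simp
  have h1 := key (Matrix.single i j 1 - Matrix.single j i 1) (by
    simp [Matrix.conjTranspose_sub, Matrix.conjTranspose_single])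
  have h2 := key (Matrix.single i j Complex.I + Matrix.single j i Complex.I) (by
    rw [Matrix.conjTranspose_add, Matrix.conjTranspose_single, Matrix.conjTranspose_single,
      neg_add, add_comm]
    simp only [RCLike.star_def, Complex.conj_I, Matrix.single_neg])
  simp only [Matrix.sub_apply, sub_mul, Finset.sum_sub_distrib, hsingle, one_mul] at h1
  simp only [Matrix.add_apply, add_mul, Finset.sum_add_distrib, hsingle] at h2
  have h3 : S i j = 0 := by
    have h4 : Complex.I * (S i j + S j i) = 0 := by rw [mul_add, h2]
    have h5 := (mul_eq_zero.mp h4).resolve_left Complex.I_ne_zero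
    have h6 : 2 * S i j = 0 := by linear_combination h1 + h5
    simpa using h6
  exact sub_eq_zero.mp h3

/-- In the sum over `i` and `j`, both terms of the commutator add up to `p tr K`, so they cancel. -/
theorem EquivariantFn.sum_euler {K : Matrix (Fin p) (Fin p) (smoothFrame p q)}
    (hK : EquivariantFn K) :
    ∑ i, ∑ j, euler i j (K i j) = ∑ i, ∑ j, eulerBar j i (K i j) := by
  refine smoothFrame_ext fun z => ?_
  simp only [coe_sum_apply]
  rw [← sub_eq_zero, ← Finset.sum_sub_distrib]
  simp only [← Finset.sum_sub_distrib, hK.euler_sub_eulerBar, if_true]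
  simp only [Finset.sum_sub_distrib]
  rw [Finset.sum_comm, sub_self]

end Wick

/-! ### The ideal generated by `x - μ` -/

section Ideal

variable {p q : ℕ}

/-- The classical part `K ↦ ∑ K_ij (x - μ)_ji` of the map whose image is the ideal. -/
def traceMomentum (μ : ℝ) (K : Matrix (Fin p) (Fin p) (smoothFrame p q)) : smoothFrame p q :=
  ∑ i, ∑ j, K i j * momentum μ j i

/-- The quantum correction `K ↦ ∑ E_ij K_ij` of the map whose image is the ideal. -/
def traceEuler (K : Matrix (Fin p) (Fin p) (smoothFrame p q)) : smoothFrame p q :=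
  ∑ i, ∑ j, euler i j (K i j)

theorem wickPower_one_momentum (μ : ℝ) (F : smoothFrame p q) (i j : Fin p) :
    wickPower 1 F (momentum μ j i) = euler i j F := by
  simp [wickPower_one, dzbar_momentum, euler_apply, mul_comm]

theorem wickPower_one_momentum_left (μ : ℝ) (F : smoothFrame p q) (i j : Fin p) :
    wickPower 1 (momentum μ j i) F = eulerBar j i F := by
  simp [wickPower_one, dz_momentum, eulerBar_apply]

theorem wickPower_zfun (r : ℕ) (F : smoothFrame p q) (A : Fin p ⊕ Fin q) (i : Fin p) :
    wickPower (r + 1) F (zfun A i) = 0 := by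
  simp [wickPower_succ, dzbar_zfun]

/-- The terms of order two and higher vanish because `x - μ` is affine in `z̄`. -/
theorem wickPower_add_two_momentum (μ : ℝ) (r : ℕ) (F : smoothFrame p q) (i j : Fin p) :
    wickPower (r + 2) F (momentum μ j i) = 0 := by
  rw [wickPower_succ]
  refine Finset.sum_eq_zero fun A _ => Finset.sum_eq_zero fun k _ => ?_
  rw [dzbar_momentum]
  split_ifs
  · exact wickPower_zfun r _ A i
  · exact map_zero _

theorem wickPower_add_two_momentum_left (μ : ℝ) (r : ℕ) (F : smoothFrame p q) (i j : Fin p) :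
    wickPower (r + 2) (momentum μ j i) F = 0 := by
  rw [← conjFn_conjFn (wickPower (r + 2) (momentum μ j i) F), conjFn_wickPower, conjFn_momentum,
    wickPower_add_two_momentum]
  exact smoothFrame_ext fun _ => map_zero (starRingEnd ℂ)

theorem sum_antidiagonal_eq_of_two {M : Type*} [AddCommMonoid M] (f : ℕ × ℕ → M)
    (h : ∀ r b, f (r + 2, b) = 0) (n : ℕ) :
    ∑ k ∈ Finset.HasAntidiagonal.antidiagonal (n + 1), f k = f (0, n + 1) + f (1, n) := by
  rw [Finset.Nat.sum_antidiagonal_succ]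
  congr 1
  cases n with
  | zero => simp
  | succ n =>
    rw [Finset.Nat.sum_antidiagonal_succ]
    simp [h]

theorem coeff_zero_wick_momentum (μ : ℝ) (F : (smoothFrame p q)⟦X⟧) (i j : Fin p) :
    PowerSeries.coeff 0 (wick p q F (PowerSeries.C (momentum μ j i))) =
      PowerSeries.coeff 0 F * momentum μ j i := by
  refine (coeff_formalBilin_C_right _ F _ 0).trans ?_
  simp [wickPower_zero]

theorem coeff_succ_wick_momentum (μ : ℝ) (F : (smoothFrame p q)⟦X⟧) (i j : Fin p) (n : ℕ) :
    PowerSeries.coeff (n + 1) (wick p q F (PowerSeries.C (momentum μ j i))) =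
      PowerSeries.coeff (n + 1) F * momentum μ j i + euler i j (PowerSeries.coeff n F) := by
  refine (coeff_formalBilin_C_right _ F _ (n + 1)).trans ?_
  rw [sum_antidiagonal_eq_of_two]
  · simp [wickPower_zero, wickPower_one_momentum]
  · intro r b
    simp [wickPower_add_two_momentum]

theorem coeff_zero_momentum_wick (μ : ℝ) (F : (smoothFrame p q)⟦X⟧) (i j : Fin p) :
    PowerSeries.coeff 0 (wick p q (PowerSeries.C (momentum μ j i)) F) =
      PowerSeries.coeff 0 F * momentum μ j i := by
  refine (coeff_formalBilin_C_left _ _ F 0).trans ?_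
  simp [wickPower_zero, mul_comm]

theorem coeff_succ_momentum_wick (μ : ℝ) (F : (smoothFrame p q)⟦X⟧) (i j : Fin p) (n : ℕ) :
    PowerSeries.coeff (n + 1) (wick p q (PowerSeries.C (momentum μ j i)) F) =
      PowerSeries.coeff (n + 1) F * momentum μ j i + eulerBar j i (PowerSeries.coeff n F) := by
  refine (coeff_formalBilin_C_left _ _ F (n + 1)).trans ?_
  rw [sum_antidiagonal_eq_of_two]
  · simp [wickPower_zero, wickPower_one_momentum_left, mul_comm]
  · intro r b
    simp [wickPower_add_two_momentum_left]

/-- Membership in the ideal, coefficient by coefficient. -/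
theorem mem_momentumIdeal_iff {μ : ℝ} {F : (smoothFrame p q)⟦X⟧} :
    F ∈ momentumIdeal p q μ ↔ ∃ K : ℕ → Matrix (Fin p) (Fin p) (smoothFrame p q),
      (∀ n, EquivariantFn (K n)) ∧ PowerSeries.coeff 0 F = traceMomentum μ (K 0) ∧
      ∀ n, PowerSeries.coeff (n + 1) F = traceMomentum μ (K (n + 1)) + traceEuler (K n) := by
  constructor
  · rintro ⟨G, hG, rfl⟩
    refine ⟨fun n => Matrix.of fun i j => PowerSeries.coeff n (G i j), hG, ?_, fun n => ?_⟩
    · simp only [map_sum, coeff_zero_wick_momentum]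
      rfl
    · simp only [map_sum, coeff_succ_wick_momentum, Finset.sum_add_distrib]
      rfl
  · rintro ⟨K, hK, h0, h1⟩
    refine ⟨Matrix.of fun i j => PowerSeries.mk fun n => K n i j, ?_, ?_⟩
    · rw [isEquivariant_iff]
      intro n
      simp only [Matrix.of_apply, PowerSeries.coeff_mk]
      exact hK n
    · ext1 n
      cases n with
      | zero =>
        rw [h0]
        simp only [map_sum, coeff_zero_wick_momentum, Matrix.of_apply, PowerSeries.coeff_mk]
        rfl
      | succ n =>
        rw [h1]
        simp only [map_sum, coeff_succ_wick_momentum, Finset.sum_add_distrib, Matrix.of_apply,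
          PowerSeries.coeff_mk]
        rfl

theorem traceMomentum_mem_invariantFn (μ : ℝ) {K : Matrix (Fin p) (Fin p) (smoothFrame p q)}
    (hK : EquivariantFn K) : traceMomentum μ K ∈ invariantFn p q :=
  sum_wickPower_mem_invariantFn 0 hK (equivariantFn_momentum μ)

theorem traceEuler_mem_invariantFn {K : Matrix (Fin p) (Fin p) (smoothFrame p q)}
    (hK : EquivariantFn K) : traceEuler K ∈ invariantFn p q := by
  have h := sum_wickPower_mem_invariantFn 1 hK (equivariantFn_momentum 0)
  simp only [Matrix.of_apply, wickPower_one_momentum] at h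
  exact h

theorem momentumIdeal_le_formalInv (μ : ℝ) : momentumIdeal p q μ ≤ formalInv p q := by
  intro F hF
  obtain ⟨K, hK, h0, h1⟩ := mem_momentumIdeal_iff.mp hF
  intro n
  cases n with
  | zero =>
    rw [h0]
    exact traceMomentum_mem_invariantFn μ (hK 0)
  | succ n =>
    rw [h1]
    exact Submodule.add_mem _ (traceMomentum_mem_invariantFn μ (hK _))
      (traceEuler_mem_invariantFn (hK n))

theorem traceMomentum_mul_left (μ : ℝ) (a : smoothFrame p q)
    (K : Matrix (Fin p) (Fin p) (smoothFrame p q)) :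
    traceMomentum μ (Matrix.of fun i j => a * K i j) = a * traceMomentum μ K := by
  simp only [traceMomentum, Matrix.of_apply, Finset.mul_sum, mul_assoc]

theorem traceEuler_mul_left {a : smoothFrame p q} (ha : a ∈ homogeneousFn p q)
    (K : Matrix (Fin p) (Fin p) (smoothFrame p q)) :
    traceEuler (Matrix.of fun i j => a * K i j) = a * traceEuler K := by
  simp only [traceEuler, Matrix.of_apply, euler_mul, euler_of_mem_homogeneousFn ha, zero_mul,
    zero_add, Finset.mul_sum]

/-- Pointwise multiplication by a homogeneous function preserves the ideal, because the fields
`E_ij` do not differentiate homogeneous functions. -/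
theorem C_mul_mem_momentumIdeal {μ : ℝ} {a : smoothFrame p q} (ha : a ∈ homogeneousFn p q)
    {F : (smoothFrame p q)⟦X⟧} (hF : F ∈ momentumIdeal p q μ) :
    PowerSeries.C a * F ∈ momentumIdeal p q μ := by
  obtain ⟨K, hK, h0, h1⟩ := mem_momentumIdeal_iff.mp hF
  refine mem_momentumIdeal_iff.mpr ⟨fun n => Matrix.of fun i j => a * K n i j,
    fun n => (hK n).mul_left (homogeneousFn_le_invariantFn ha), ?_, fun n => ?_⟩
  · rw [PowerSeries.coeff_C_mul, h0, traceMomentum_mul_left]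
  · rw [PowerSeries.coeff_C_mul, h1, traceMomentum_mul_left, traceEuler_mul_left ha, mul_add]

/-- An equivariant matrix commutes with the momentum map under the trace. In order zero this is
commutativity of pointwise products, in first order it is infinitesimal equivariance. -/
theorem IsEquivariant.sum_wick_comm (μ : ℝ) {G : Matrix (Fin p) (Fin p) (smoothFrame p q)⟦X⟧}
    (hG : IsEquivariant G) :
    ∑ i, ∑ j, wick p q (G i j) (PowerSeries.C (momentum μ j i)) =
      ∑ i, ∑ j, wick p q (PowerSeries.C (momentum μ j i)) (G i j) := by
  ext1 n
  cases n with
  | zero => simp only [map_sum, coeff_zero_wick_momentum, coeff_zero_momentum_wick]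
  | succ n =>
    simp only [map_sum, coeff_succ_wick_momentum, coeff_succ_momentum_wick,
      Finset.sum_add_distrib]
    congr 1
    exact (isEquivariant_iff.mp hG n).sum_euler

theorem IsEquivariant.wick_left {G : Matrix (Fin p) (Fin p) (smoothFrame p q)⟦X⟧}
    (hG : IsEquivariant G) {F : (smoothFrame p q)⟦X⟧} (hF : F ∈ formalInv p q) :
    IsEquivariant (Matrix.of fun i j => wick p q F (G i j)) := by
  rw [isEquivariant_iff] at hG ⊢
  intro n
  have h : (Matrix.of fun i j => PowerSeries.coeff n (wick p q F (G i j))) =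
      ∑ k ∈ Finset.HasAntidiagonal.antidiagonal n,
      ∑ l ∈ Finset.HasAntidiagonal.antidiagonal k.2, (1 / (k.1.factorial : ℂ)) •
        Matrix.of fun i j =>
          wickPower k.1 (PowerSeries.coeff l.1 F) (PowerSeries.coeff l.2 (G i j)) := by
    ext1 i j
    simp only [Matrix.of_apply, coeff_wick, Matrix.sum_apply, Matrix.smul_apply]
  simp only [Matrix.of_apply]
  rw [h]
  exact EquivariantFn.sum _ fun k _ => EquivariantFn.sum _ fun l _ =>
    ((hG l.2).wickPower_left (hF l.1) k.1).smul _

theorem IsEquivariant.conj {G : Matrix (Fin p) (Fin p) (smoothFrame p q)⟦X⟧}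
    (hG : IsEquivariant G) : IsEquivariant (Matrix.of fun i j => conjSeries (G j i)) := by
  rw [isEquivariant_iff] at hG ⊢
  intro n
  simp only [Matrix.of_apply, coeff_conjSeries]
  exact (hG n).conj

theorem conjSeries_mem_momentumIdeal {μ : ℝ} {F : (smoothFrame p q)⟦X⟧}
    (hF : F ∈ momentumIdeal p q μ) : conjSeries F ∈ momentumIdeal p q μ := by
  obtain ⟨G, hG, rfl⟩ := hF
  refine ⟨_, hG.conj, ?_⟩
  rw [hG.conj.sum_wick_comm, Finset.sum_comm]
  simp only [conjSeries_sum, conjSeries_wick, Matrix.of_apply]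
  refine Finset.sum_congr rfl fun i _ => Finset.sum_congr rfl fun j _ => ?_
  congr 2
  ext1 n
  rw [coeff_conjSeries, PowerSeries.coeff_C, PowerSeries.coeff_C]
  split_ifs
  · exact conjFn_momentum μ i j
  · exact smoothFrame_ext fun _ => map_zero (starRingEnd ℂ)

theorem wick_mem_momentumIdeal {μ : ℝ} {F G : (smoothFrame p q)⟦X⟧} (hF : F ∈ formalInv p q)
    (hG : G ∈ momentumIdeal p q μ) : wick p q F G ∈ momentumIdeal p q μ := by
  obtain ⟨G, hG, rfl⟩ := hG
  refine ⟨_, hG.wick_left hF, ?_⟩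
  simp only [map_sum, Matrix.of_apply, wick_assoc]

theorem conjSeries_conjSeries (F : (smoothFrame p q)⟦X⟧) : conjSeries (conjSeries F) = F := by
  ext1 n
  rw [coeff_conjSeries, coeff_conjSeries, conjFn_conjFn]

theorem conjFn_mem_invariantFn {F : smoothFrame p q} (hF : F ∈ invariantFn p q) :
    conjFn F ∈ invariantFn p q := fun z U => congrArg (starRingEnd ℂ) (hF z U)

theorem conjSeries_mem_formalInv {F : (smoothFrame p q)⟦X⟧} (hF : F ∈ formalInv p q) :
    conjSeries F ∈ formalInv p q := fun n => by
  rw [coeff_conjSeries]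
  exact conjFn_mem_invariantFn (hF n)

/-- The left ideal is also a right ideal, because complex conjugation reverses products. -/
theorem wick_mem_momentumIdeal' {μ : ℝ} {F G : (smoothFrame p q)⟦X⟧}
    (hF : F ∈ momentumIdeal p q μ) (hG : G ∈ formalInv p q) :
    wick p q F G ∈ momentumIdeal p q μ := by
  rw [← conjSeries_conjSeries (wick p q F G), conjSeries_wick]
  exact conjSeries_mem_momentumIdeal
    (wick_mem_momentumIdeal (conjSeries_mem_formalInv hG) (conjSeries_mem_momentumIdeal hF))

end Ideal

/-! ### An exhaustion function of the fibres -/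

section DetExp

open scoped ComplexOrder

variable {p : ℕ} {μ : ℝ} {x : Matrix (Fin p) (Fin p) ℂ}

theorem det_mul_exp_eq_prod (hx : x.IsHermitian) :
    x.det.re * Real.exp (-(x.trace.re) / μ) =
      ∏ i, hx.eigenvalues i * Real.exp (-(hx.eigenvalues i) / μ) := by
  have h1 : x.det = ((∏ i, hx.eigenvalues i : ℝ) : ℂ) := by
    rw [hx.det_eq_prod_eigenvalues]
    simp
  have h2 : x.trace = ((∑ i, hx.eigenvalues i : ℝ) : ℂ) := by
    rw [hx.trace_eq_sum_eigenvalues]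
    simp
  rw [h1, h2, Complex.ofReal_re, Complex.ofReal_re, Finset.prod_mul_distrib, ← Real.exp_sum,
    ← Finset.sum_div, Finset.sum_neg_distrib]

theorem det_mul_exp_le (hμ : 0 < μ) (hx : x.PosDef) :
    x.det.re * Real.exp (-(x.trace.re) / μ) ≤
      (2 * μ) ^ p * Real.exp (-(x.trace.re) / (2 * μ)) := by
  have h2 : x.trace = ((∑ i, hx.1.eigenvalues i : ℝ) : ℂ) := by
    rw [hx.1.trace_eq_sum_eigenvalues]
    simp
  have h3 : (2 * μ) ^ p * Real.exp (-(x.trace.re) / (2 * μ)) =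
      ∏ i, 2 * μ * Real.exp (-(hx.1.eigenvalues i) / (2 * μ)) := by
    rw [Finset.prod_mul_distrib, ← Real.exp_sum, h2, Complex.ofReal_re, ← Finset.sum_div,
      Finset.sum_neg_distrib]
    simp
  rw [det_mul_exp_eq_prod hx.1, h3]
  refine Finset.prod_le_prod (fun i _ => mul_nonneg (hx.eigenvalues_pos i).le
    (Real.exp_pos _).le) fun i _ => ?_
  set l := hx.1.eigenvalues i
  have h4 : l / (2 * μ) ≤ Real.exp (l / (2 * μ)) := by
    linarith [Real.add_one_le_exp (l / (2 * μ))]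
  have h5 : Real.exp (-l / (2 * μ)) = Real.exp (l / (2 * μ)) * Real.exp (-l / μ) := by
    rw [← Real.exp_add]
    congr 1
    field_simp
    ring
  rw [div_le_iff₀ (by positivity)] at h4
  rw [h5, ← mul_assoc]
  refine mul_le_mul_of_nonneg_right ?_ (Real.exp_pos _).le
  linarith

theorem mul_exp_neg_div_le (hμ : 0 < μ) (l : ℝ) : l * Real.exp (-l / μ) ≤ μ * Real.exp (-1) := by
  have h := Real.add_one_le_exp (l / μ - 1)
  have h1 : Real.exp (-1) = Real.exp (l / μ - 1) * Real.exp (-l / μ) := by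
    rw [← Real.exp_add]
    congr 1
    ring
  rw [h1, ← mul_assoc]
  refine mul_le_mul_of_nonneg_right ?_ (Real.exp_pos _).le
  rw [sub_add_cancel, div_le_iff₀ hμ] at h
  linarith

theorem mul_exp_neg_div_lt (hμ : 0 < μ) {l : ℝ} (hl : l ≠ μ) :
    l * Real.exp (-l / μ) < μ * Real.exp (-1) := by
  have hne : l / μ - 1 ≠ 0 := by
    rw [sub_ne_zero, Ne, div_eq_one_iff_eq hμ.ne']
    exact hl
  have h := Real.add_one_lt_exp hne
  have h1 : Real.exp (-1) = Real.exp (l / μ - 1) * Real.exp (-l / μ) := by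
    rw [← Real.exp_add]
    congr 1
    ring
  rw [h1, ← mul_assoc]
  refine mul_lt_mul_of_pos_right ?_ (Real.exp_pos _)
  rw [sub_add_cancel, div_lt_iff₀ hμ] at h
  linarith

/-- On positive definite matrices, `det x e^{-tr x / μ}` has its strict maximum at `x = μ`. -/
theorem eq_smul_one_of_le_det_mul_exp (hμ : 0 < μ) (hx : x.PosDef)
    (h : (μ * Real.exp (-1)) ^ p ≤ x.det.re * Real.exp (-(x.trace.re) / μ)) :
    x = (μ : ℂ) • 1 := by
  rw [det_mul_exp_eq_prod hx.1] at h
  have h1 : ∀ i, hx.1.eigenvalues i = μ := by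
    by_contra! hne
    obtain ⟨i, hi⟩ := hne
    have h2 := Finset.prod_lt_prod (s := Finset.univ)
      (f := fun i => hx.1.eigenvalues i * Real.exp (-(hx.1.eigenvalues i) / μ))
      (g := fun _ => μ * Real.exp (-1))
      (fun i _ => mul_pos (hx.eigenvalues_pos i) (Real.exp_pos _))
      (fun i _ => mul_exp_neg_div_le hμ _) ⟨i, Finset.mem_univ i, mul_exp_neg_div_lt hμ hi⟩
    simp only [Finset.prod_const, Finset.card_univ, Fintype.card_fin] at h2
    exact absurd h2 (not_lt.mpr h)
  have h3 := hx.1.spectral_theorem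
  have h4 : Matrix.diagonal (RCLike.ofReal ∘ hx.1.eigenvalues) =
      (μ : ℂ) • (1 : Matrix (Fin p) (Fin p) ℂ) := by
    ext i j
    simp [Matrix.diagonal_apply, Matrix.one_apply, h1]
  rw [h4, map_smul, map_one] at h3
  exact h3

theorem det_mul_exp_smul_one (hμ : 0 < μ) :
    ((μ : ℂ) • (1 : Matrix (Fin p) (Fin p) ℂ)).det.re *
      Real.exp (-(((μ : ℂ) • (1 : Matrix (Fin p) (Fin p) ℂ)).trace.re) / μ) =
      (μ * Real.exp (-1)) ^ p := by
  have h : -((p : ℝ) * μ) / μ = p * (-1) := by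
    field_simp
  rw [Matrix.det_smul, Matrix.det_one, Matrix.trace_smul, Matrix.trace_one, mul_pow,
    ← Real.exp_nat_mul, ← h]
  simp [← Complex.ofReal_pow, mul_comm]

end DetExp

/-! ### Test functions on the space of frames -/

section TestFunctions

open scoped ComplexOrder

variable {p q : ℕ}

/-- The composite `φ ∘ Re F` of a smooth function on the line with a smooth function. -/
def compRe (φ : ℝ → ℝ) (hφ : ContDiff ℝ ∞ φ) (F : smoothFrame p q) : smoothFrame p q :=
  ⟨fun z => ((φ (F.1 z).re : ℝ) : ℂ), by
    have h : ContDiffOn ℝ ∞ (fun v => ((φ (extend F.1 v).re : ℝ) : ℂ)) (fullRankCoord p q) :=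
      Complex.ofRealCLM.contDiff.comp_contDiffOn
        (hφ.comp_contDiffOn (Complex.reCLM.contDiff.comp_contDiffOn F.2))
    exact h.congr fun v hv => by rw [extend_of_mem _ v hv, extend_of_mem _ v hv]⟩

theorem compRe_apply (φ : ℝ → ℝ) (hφ : ContDiff ℝ ∞ φ) (F : smoothFrame p q) (z : Frame p q) :
    (compRe φ hφ F).1 z = ((φ (F.1 z).re : ℝ) : ℂ) := rfl

theorem dirDeriv_compRe {φ : ℝ → ℝ} (hφ : ContDiff ℝ ∞ φ) (hφ' : ContDiff ℝ ∞ (deriv φ))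
    {F : smoothFrame p q} (hF : ∀ z, (F.1 z).im = 0) (v : Coord p q) :
    dirDeriv v (compRe φ hφ F) = compRe (deriv φ) hφ' F * dirDeriv v F := by
  refine smoothFrame_ext fun z => ?_
  have h1 : HasFDerivAt (fun v => (extend F.1 v).re)
      (Complex.reCLM.comp (fderiv ℝ (extend F.1) z.coord)) z.coord :=
    Complex.reCLM.hasFDerivAt.comp z.coord (differentiableAt_extend F z).hasFDerivAt
  have h2 : HasDerivAt φ (deriv φ (extend F.1 z.coord).re) (extend F.1 z.coord).re :=
    ((hφ.differentiable (by simp)) _).hasDerivAt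
  have h3 := Complex.ofRealCLM.hasFDerivAt.comp z.coord (h2.comp_hasFDerivAt z.coord h1)
  rw [dirDeriv_eq_of_hasFDerivAt (fun w => ?_) h3]
  · -- the derivative of a real valued function is real valued
    have h4 : dirDeriv v F = compRe id contDiff_id (dirDeriv v F) := by
      refine smoothFrame_ext fun w => ?_
      have h5 : HasFDerivAt (fun v => (((extend F.1 v).re : ℝ) : ℂ))
        (Complex.ofRealCLM.comp (Complex.reCLM.comp (fderiv ℝ (extend F.1) w.coord))) w.coord :=
        Complex.ofRealCLM.hasFDerivAt.comp w.coord
          (Complex.reCLM.hasFDerivAt.comp w.coord (differentiableAt_extend F w).hasFDerivAt)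
      rw [dirDeriv_eq_of_hasFDerivAt (fun u => ?_) h5]
      · rfl
      · rw [extend_coord]
        exact Complex.ext rfl (by rw [Complex.ofReal_im]; exact hF u)
    rw [coe_mul_apply, h4]
    simp only [compRe_apply, extend_coord]
    simp [dirDeriv_apply]
  · rw [Function.comp_apply, Function.comp_apply, extend_coord]
    rfl

theorem euler_compRe {φ : ℝ → ℝ} (hφ : ContDiff ℝ ∞ φ) (hφ' : ContDiff ℝ ∞ (deriv φ))
    {F : smoothFrame p q} (hF : ∀ z, (F.1 z).im = 0) (i j : Fin p) :
    euler i j (compRe φ hφ F) = compRe (deriv φ) hφ' F * euler i j F := by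
  simp only [euler_apply, dz_apply, dirDeriv_compRe hφ hφ' hF, Finset.mul_sum]
  refine Finset.sum_congr rfl fun A _ => smoothFrame_ext fun z => ?_
  simp only [coe_mul_apply, coe_smul_apply, coe_sub_apply]
  ring

/-- The inverse of a smooth function without zeros. -/
def smoothInv (F : smoothFrame p q) (hF : ∀ z, F.1 z ≠ 0) : smoothFrame p q :=
  ⟨fun z => (F.1 z)⁻¹, by
    have h : ContDiffOn ℝ ∞ (fun v => (extend F.1 v)⁻¹) (fullRankCoord p q) :=
      ContDiffOn.inv F.2 fun v hv => by
        rw [extend_of_mem _ v hv]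
        exact hF _
    exact h.congr fun v hv => by rw [extend_of_mem _ v hv, extend_of_mem _ v hv]⟩

theorem mul_smoothInv (F : smoothFrame p q) (hF : ∀ z, F.1 z ≠ 0) : F * smoothInv F hF = 1 :=
  smoothFrame_ext fun z => mul_inv_cancel₀ (hF z)

theorem euler_one (i j : Fin p) : euler i j (1 : smoothFrame p q) = 0 := by
  simp [euler_apply, dz_one]

theorem euler_smoothInv {F : smoothFrame p q} (hF : ∀ z, F.1 z ≠ 0) {i j : Fin p} {c : ℂ}
    (h : euler i j F = c • F) : euler i j (smoothInv F hF) = -c • smoothInv F hF := by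
  have h1 := congrArg (euler i j) (mul_smoothInv F hF)
  rw [euler_mul, euler_one, h, smul_mul_assoc, mul_smoothInv] at h1
  have h2 := congrArg (fun G => smoothInv F hF * G) h1
  simp only [mul_add, mul_zero, mul_smul_comm, mul_one] at h2
  rw [← mul_assoc, mul_comm (smoothInv F hF) F, mul_smoothInv, one_mul] at h2
  rw [neg_smul]
  exact eq_neg_of_add_eq_zero_right h2

theorem euler_pow {F : smoothFrame p q} {i j : Fin p} {c : ℂ} (h : euler i j F = c • F) (n : ℕ) :
    euler i j (F ^ n) = (n * c) • F ^ n := by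
  induction n with
  | zero => simp [euler_one]
  | succ n ih =>
    rw [pow_succ, euler_mul, ih, h, Nat.cast_succ, add_mul, add_smul, one_mul, smul_mul_assoc,
      mul_smul_comm]

theorem posDef_gram (z : Frame p q) : Matrix.PosDef (z.1ᴴ * z.1) :=
  Matrix.PosDef.conjTranspose_mul_self z.1 (mulVec_injective_of_mem z.2)

/-- The function `det x`, where `x = z† z`. -/
def gramDet (p q : ℕ) : smoothFrame p q :=
  (Matrix.of fun i j => momentum (q := q) 0 i j : Matrix (Fin p) (Fin p) (smoothFrame p q)).det

/-- The function `tr x`, where `x = z† z`. -/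
def gramTrace (p q : ℕ) : smoothFrame p q := ∑ i, momentum 0 i i

theorem gramDet_apply (z : Frame p q) : (gramDet p q).1 z = (z.1ᴴ * z.1).det := by
  let ev : smoothFrame p q →+* ℂ := (Pi.evalRingHom (fun _ => ℂ) z).comp
    (smoothFrame p q).toSubring.subtype
  change ev (gramDet p q) = _
  rw [gramDet, RingHom.map_det]
  congr 1
  ext i j
  change (z.1ᴴ * z.1 - ((0 : ℝ) : ℂ) • (1 : Matrix (Fin p) (Fin p) ℂ)) i j = _
  simp

theorem gramTrace_apply (z : Frame p q) : (gramTrace p q).1 z = (z.1ᴴ * z.1).trace := by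
  rw [gramTrace, coe_sum_apply, Matrix.trace]
  refine Finset.sum_congr rfl fun i _ => ?_
  change (z.1ᴴ * z.1 - ((0 : ℝ) : ℂ) • (1 : Matrix (Fin p) (Fin p) ℂ)) i i = _
  simp

theorem gramDet_im (z : Frame p q) : ((gramDet p q).1 z).im = 0 := by
  rw [gramDet_apply]
  exact (Complex.lt_def.mp (posDef_gram z).det_pos).2.symm

theorem gramDet_re_pos (z : Frame p q) : 0 < ((gramDet p q).1 z).re := by
  rw [gramDet_apply]
  exact (Complex.lt_def.mp (posDef_gram z).det_pos).1

theorem gramDet_ne_zero (z : Frame p q) : (gramDet p q).1 z ≠ 0 := by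
  intro h
  have := gramDet_re_pos z
  rw [h] at this
  exact lt_irrefl _ this

theorem gramTrace_im (z : Frame p q) : ((gramTrace p q).1 z).im = 0 := by
  rw [gramTrace_apply, (posDef_gram z).1.trace_eq_sum_eigenvalues]
  simp

theorem euler_momentum (μ : ℝ) (i j k l : Fin p) :
    euler i j (momentum (q := q) μ k l) = if j = l then momentum 0 k i else 0 := by
  rw [euler_apply]
  simp only [dz_momentum]
  split_ifs with h
  · rw [momentum_eq]
    simp [mul_comm]
  · simp

theorem euler_gramTrace (i j : Fin p) : euler i j (gramTrace p q) = momentum 0 j i := by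
  simp [gramTrace, euler_momentum]

theorem hasDerivAt_det_one_add_smul (M : Matrix (Fin p) (Fin p) ℂ) :
    HasDerivAt (fun t : ℝ => (1 + (t : ℂ) • M).det) M.trace 0 := by
  rw [funext fun t : ℝ => Matrix.det_one_add_smul (t : ℂ) M]
  have h1 : HasDerivAt (fun t : ℝ => (t : ℂ)) 1 0 := Complex.ofRealCLM.hasDerivAt
  set P := Polynomial.divX (Polynomial.divX (1 + (Polynomial.X : Polynomial ℂ) •
    M.map Polynomial.C).det)
  have h2 : HasDerivAt (fun t : ℝ => P.eval (t : ℂ)) (P.derivative.eval ((0 : ℝ) : ℂ) * 1) 0 :=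
    HasDerivAt.comp (h₂ := fun s => P.eval s) (0 : ℝ) (P.hasDerivAt _) h1
  have h3 := ((h1.const_mul M.trace).const_add 1).add (h2.mul (h1.pow 2))
  refine h3.congr_deriv ?_
  simp

theorem euler_gramDet (i j : Fin p) :
    euler i j (gramDet p q) = (if i = j then 1 else 0 : ℂ) • gramDet p q := by
  refine smoothFrame_ext fun z => ?_
  have key : ∀ M : Matrix (Fin p) (Fin p) ℂ,
      fderiv ℝ (extend (gramDet p q).1) z.coord (mulRightCLM M z.coord) =
        (starRingEnd ℂ M.trace + M.trace) * (gramDet p q).1 z := by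
    intro M
    have h := hasDerivAt_det_one_add_smul M
    have hc : HasDerivAt (fun t : ℝ => starRingEnd ℂ ((1 + (t : ℂ) • M).det))
        (starRingEnd ℂ M.trace) 0 :=
      Complex.conjCLE.toContinuousLinearMap.hasFDerivAt.comp_hasDerivAt (0 : ℝ) h
    refine fderiv_mulRight_eq (gramDet p q) z M
      (φ := fun t : ℝ => starRingEnd ℂ ((1 + (t : ℂ) • M).det) * (1 + (t : ℂ) • M).det *
        (gramDet p q).1 z) ?_ ?_
    · simpa using (hc.mul h).mul_const ((gramDet p q).1 z)
    · intro t g hg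
      rw [gramDet_apply, gramDet_apply]
      change ((z.1 * g.1)ᴴ * (z.1 * g.1)).det = _
      rw [Matrix.conjTranspose_mul, Matrix.mul_assoc, Matrix.det_mul, ← Matrix.mul_assoc,
        Matrix.det_mul, Matrix.det_conjTranspose, hg]
      simp only [RCLike.star_def]
      ring
  rw [euler_eq_fderiv, key, key, coe_smul_apply]
  rcases eq_or_ne i j with rfl | h
  · rw [Matrix.trace_single_eq_same, Matrix.trace_single_eq_same]
    simp
    ring
  · rw [Matrix.trace_single_eq_of_ne _ _ _ h, Matrix.trace_single_eq_of_ne _ _ _ h]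
    simp [h]

end TestFunctions

/-! ### Integration of compactly supported functions -/

section Integration

open MeasureTheory
open scoped ComplexOrder

variable {p q : ℕ}

instance : (volume : Measure (Coord p q)).IsAddHaarMeasure := by
  have : (volume : Measure (Fin p → ℂ)).IsAddHaarMeasure :=
    inferInstanceAs (Measure.pi fun _ => (volume : Measure ℂ)).IsAddHaarMeasure
  exact Measure.pi.isAddHaarMeasure fun _ : Fin p ⊕ Fin q => (volume : Measure (Fin p → ℂ))

/-- A smooth function on the space of frames vanishes outside a compact set of frames. -/
def CompactlySupported (F : smoothFrame p q) : Prop :=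
  ∃ K : Set (Coord p q), IsCompact K ∧ K ⊆ fullRankCoord p q ∧ ∀ z : Frame p q,
    z.coord ∉ K → F.1 z = 0

theorem CompactlySupported.extend_eq_zero {F : smoothFrame p q} {K : Set (Coord p q)}
    (h : ∀ z : Frame p q, z.coord ∉ K → F.1 z = 0) {v : Coord p q}
    (hv : v ∉ K) : extend F.1 v = 0 := by
  by_cases hv' : v ∈ fullRankCoord p q
  · rw [extend_of_mem _ v hv']
    exact h ⟨Matrix.of v, hv'⟩ hv
  · rw [extend, Function.extend_apply']
    · rfl
    · rintro ⟨z, hz⟩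
      apply hv'
      have : z.1 ∈ fullRank p q := z.2
      rw [hz] at this
      exact this

theorem CompactlySupported.mul_left {F : smoothFrame p q} (hF : CompactlySupported F)
    (G : smoothFrame p q) : CompactlySupported (G * F) := by
  obtain ⟨K, hK, hK', h⟩ := hF
  exact ⟨K, hK, hK', fun z hz => by rw [coe_mul_apply, h z hz, mul_zero]⟩

theorem CompactlySupported.contDiff {F : smoothFrame p q} (hF : CompactlySupported F) :
    ContDiff ℝ ∞ (extend F.1) := by
  obtain ⟨K, hK, hK', h⟩ := hF
  refine contDiff_iff_contDiffAt.mpr fun v => ?_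
  by_cases hv : v ∈ K
  · exact contDiffAt_extend F ⟨Matrix.of v, hK' hv⟩
  · refine (contDiffAt_const (c := (0 : ℂ))).congr_of_eventuallyEq ?_
    filter_upwards [hK.isClosed.isOpen_compl.mem_nhds hv] with w hw
    exact extend_eq_zero h hw

theorem CompactlySupported.hasCompactSupport {F : smoothFrame p q} (hF : CompactlySupported F) :
    HasCompactSupport (extend F.1) := by
  obtain ⟨K, hK, hK', h⟩ := hF
  exact HasCompactSupport.intro hK fun v hv => extend_eq_zero h hv

theorem CompactlySupported.integrable {F : smoothFrame p q} (hF : CompactlySupported F) :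
    Integrable (extend F.1) :=
  hF.contDiff.continuous.integrable_of_hasCompactSupport hF.hasCompactSupport

/-- The Lebesgue integral of a smooth function on the space of frames. -/
def frameIntegral (F : smoothFrame p q) : ℂ := ∫ v, extend F.1 v

theorem extend_add (F G : smoothFrame p q) :
    extend (F + G).1 = extend F.1 + extend G.1 := by
  funext v
  by_cases hv : v ∈ fullRankCoord p q
  · rw [Pi.add_apply, extend_of_mem _ v hv, extend_of_mem _ v hv, extend_of_mem _ v hv]
    rfl
  · have h : ¬ ∃ z : Frame p q, z.1 = Matrix.of v := by
      rintro ⟨z, hz⟩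
      have : z.1 ∈ fullRank p q := z.2
      rw [hz] at this
      exact hv this
    rw [Pi.add_apply, extend, extend, extend, Function.extend_apply' _ _ _ h,
      Function.extend_apply' _ _ _ h, Function.extend_apply' _ _ _ h]
    simp

theorem extend_smul (c : ℂ) (F : smoothFrame p q) :
    extend (c • F).1 = c • extend F.1 := by
  funext v
  by_cases hv : v ∈ fullRankCoord p q
  · rw [Pi.smul_apply, extend_of_mem _ v hv, extend_of_mem _ v hv]
    rfl
  · have h : ¬ ∃ z : Frame p q, z.1 = Matrix.of v := by
      rintro ⟨z, hz⟩
      have : z.1 ∈ fullRank p q := z.2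
      rw [hz] at this
      exact hv this
    rw [Pi.smul_apply, extend, extend, Function.extend_apply' _ _ _ h,
      Function.extend_apply' _ _ _ h]
    simp

theorem frameIntegral_add {F G : smoothFrame p q} (hF : CompactlySupported F)
    (hG : CompactlySupported G) :
    frameIntegral (F + G) = frameIntegral F + frameIntegral G := by
  rw [frameIntegral, extend_add]
  exact integral_add hF.integrable hG.integrable

theorem frameIntegral_smul (c : ℂ) (F : smoothFrame p q) :
    frameIntegral (c • F) = c * frameIntegral F := by
  rw [frameIntegral, extend_smul]
  exact integral_const_mul c _

theorem CompactlySupported.add {F G : smoothFrame p q} (hF : CompactlySupported F)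
    (hG : CompactlySupported G) : CompactlySupported (F + G) := by
  obtain ⟨K, hK, hK', h⟩ := hF
  obtain ⟨L, hL, hL', h'⟩ := hG
  refine ⟨K ∪ L, hK.union hL, Set.union_subset hK' hL', fun z hz => ?_⟩
  rw [Set.mem_union, not_or] at hz
  rw [coe_add_apply, h z hz.1, h' z hz.2, add_zero]

theorem CompactlySupported.smul {F : smoothFrame p q} (hF : CompactlySupported F) (c : ℂ) :
    CompactlySupported (c • F) := by
  obtain ⟨K, hK, hK', h⟩ := hF
  exact ⟨K, hK, hK', fun z hz => by rw [coe_smul_apply, h z hz, mul_zero]⟩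

theorem CompactlySupported.sum {ι : Type*} {s : Finset ι} {F : ι → smoothFrame p q}
    (hF : ∀ i ∈ s, CompactlySupported (F i)) :
    CompactlySupported (∑ i ∈ s, F i) ∧
      frameIntegral (∑ i ∈ s, F i) = ∑ i ∈ s, frameIntegral (F i) := by
  classical
  induction s using Finset.induction_on with
  | empty =>
    refine ⟨⟨∅, isCompact_empty, Set.empty_subset _, fun z _ => rfl⟩, ?_⟩
    rw [Finset.sum_empty, Finset.sum_empty, ← zero_smul ℂ (0 : smoothFrame p q),
      frameIntegral_smul, zero_mul]
  | insert a s ha ih =>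
    obtain ⟨h1, h2⟩ := ih fun i hi => hF i (Finset.mem_insert_of_mem hi)
    have h3 := hF a (Finset.mem_insert_self a s)
    rw [Finset.sum_insert ha, Finset.sum_insert ha, frameIntegral_add h3 h1, h2]
    exact ⟨h3.add h1, rfl⟩

/-- Derivatives of compactly supported functions are compactly supported and have integral zero. -/
theorem CompactlySupported.dirDeriv {F : smoothFrame p q} (hF : CompactlySupported F)
    (v : Coord p q) : CompactlySupported (dirDeriv v F) ∧
      frameIntegral (dirDeriv v F) = 0 := by
  have hc := hF.contDiff
  have hs := hF.hasCompactSupport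
  obtain ⟨K, hK, hK', h⟩ := hF
  have hz : ∀ w, w ∉ K → fderiv ℝ (extend F.1) w v = 0 := by
    intro w hw
    have : extend F.1 =ᶠ[nhds w] fun _ => 0 := by
      filter_upwards [hK.isClosed.isOpen_compl.mem_nhds hw] with w hw
      exact extend_eq_zero h hw
    rw [this.fderiv_eq]
    simp
  have hd : ∀ z : Frame p q, z.coord ∉ K → (GrassmannStar.dirDeriv v F).1 z = 0 :=
    fun z => hz z.coord
  refine ⟨⟨K, hK, hK', hd⟩, ?_⟩
  have h1 : extend (GrassmannStar.dirDeriv v F).1 = fun w => fderiv ℝ (extend F.1) w v := by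
    funext w
    by_cases hw : w ∈ K
    · exact extend_of_mem _ w (hK' hw)
    · rw [hz w hw, extend_eq_zero hd hw]
  rw [frameIntegral, h1]
  have hcont : Continuous fun w => fderiv ℝ (extend F.1) w v :=
    (hc.continuous_fderiv (by simp)).clm_apply continuous_const
  have hsupp : HasCompactSupport fun w => fderiv ℝ (extend F.1) w v :=
    HasCompactSupport.intro hK hz
  have h2 := integral_mul_fderiv_eq_neg_fderiv_mul_of_integrable (μ := volume)
    (f := fun _ : Coord p q => (1 : ℂ)) (g := extend F.1) (v := v) (by simp)
    (by simpa using hcont.integrable_of_hasCompactSupport hsupp)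
    (by simpa using hc.continuous.integrable_of_hasCompactSupport hs)
    (fun w _ => differentiableAt_const _) (fun w _ => (hc.differentiable (by simp)) w)
  simpa using h2

theorem CompactlySupported.dz {F : smoothFrame p q} (hF : CompactlySupported F)
    (A : Fin p ⊕ Fin q) (i : Fin p) : CompactlySupported (dz A i F) ∧
      frameIntegral (dz A i F) = 0 := by
  have h1 := hF.dirDeriv (entryDir A i 1)
  have h2 := hF.dirDeriv (entryDir A i Complex.I)
  have h : GrassmannStar.dz A i F = (1 / 2 : ℂ) • GrassmannStar.dirDeriv (entryDir A i 1) F +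
      (-(1 / 2 : ℂ) * Complex.I) • GrassmannStar.dirDeriv (entryDir A i Complex.I) F := by
    rw [dz_apply, smul_sub, sub_eq_add_neg, smul_smul, ← neg_smul, neg_mul]
  rw [h]
  refine ⟨(h1.1.smul _).add (h2.1.smul _), ?_⟩
  rw [frameIntegral_add (h1.1.smul _) (h2.1.smul _), frameIntegral_smul, frameIntegral_smul, h1.2,
    h2.2, mul_zero, mul_zero, add_zero]

/-- The divergence theorem for the vector fields `E_ij`: the field `E_ii` has divergence
`p + q`, the others are divergence free. -/
theorem CompactlySupported.euler {F : smoothFrame p q} (hF : CompactlySupported F) (i j : Fin p) :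
    CompactlySupported (euler i j F) ∧
      frameIntegral (euler i j F) = -(if i = j then (p + q : ℂ) else 0) * frameIntegral F := by
  have h1 : ∀ A, GrassmannStar.dz A j (zfun A i * F) =
      (if i = j then 1 else 0 : ℂ) • F + zfun A i * GrassmannStar.dz A j F := by
    intro A
    rw [dz_mul, dz_zfun]
    rcases eq_or_ne i j with rfl | h
    · simp
    · simp [h, h.symm]
  have h2 : CompactlySupported (GrassmannStar.euler i j F) :=
    (CompactlySupported.sum fun A _ => ((hF.dz A j).1.mul_left (zfun A i))).1
  refine ⟨h2, ?_⟩
  have h3 := CompactlySupported.sum (s := Finset.univ) (F := fun A =>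
    GrassmannStar.dz A j (zfun A i * F)) fun A _ => ((hF.mul_left (zfun A i)).dz A j).1
  have h4 : ∑ A, GrassmannStar.dz A j (zfun A i * F) =
      (if i = j then (p + q : ℂ) else 0) • F + GrassmannStar.euler i j F := by
    simp only [h1, Finset.sum_add_distrib, euler_apply]
    congr 1
    rw [← Finset.sum_smul]
    split_ifs
    · simp
    · simp
  have h5 := h3.2
  rw [h4, frameIntegral_add (hF.smul _) h2, frameIntegral_smul,
    Finset.sum_eq_zero fun A _ => ((hF.mul_left (zfun A i)).dz A j).2] at h5
  linear_combination h5

/-! ### Weights concentrated near the level set `x = μ` -/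

theorem contDiff_exp_neg_div (μ : ℝ) : ContDiff ℝ ∞ fun s : ℝ => Real.exp (-s / μ) :=
  Real.contDiff_exp.comp (contDiff_neg.div_const μ)

theorem deriv_exp_neg_div (μ : ℝ) : (deriv fun s : ℝ => Real.exp (-s / μ)) =
    fun s => Real.exp (-s / μ) * (-1 / μ) := by
  funext s
  exact (((hasDerivAt_id s).neg.div_const μ).exp).deriv

/-- The exhaustion function `ρ = det x e^{-tr x / μ}`. On each fibre it attains its maximum exactly
where `x = μ`, and `E_ij ρ = -(x - μ)_ji ρ / μ`. -/
def peak (p q : ℕ) (μ : ℝ) : smoothFrame p q :=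
  gramDet p q * compRe (fun s => Real.exp (-s / μ)) (contDiff_exp_neg_div μ) (gramTrace p q)

theorem peak_eq_ofReal (μ : ℝ) (z : Frame p q) : (peak p q μ).1 z =
    ((z.1ᴴ * z.1).det.re * Real.exp (-((z.1ᴴ * z.1).trace.re) / μ) : ℝ) := by
  rw [peak, coe_mul_apply, compRe_apply, gramTrace_apply, Complex.ofReal_mul, ← gramDet_apply]
  congr 1
  exact Complex.ext rfl (by rw [Complex.ofReal_im]; exact gramDet_im z)

theorem peak_im (μ : ℝ) (z : Frame p q) : ((peak p q μ).1 z).im = 0 := by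
  rw [peak_eq_ofReal, Complex.ofReal_im]

theorem peak_re (μ : ℝ) (z : Frame p q) : ((peak p q μ).1 z).re =
    (z.1ᴴ * z.1).det.re * Real.exp (-((z.1ᴴ * z.1).trace.re) / μ) := by
  rw [peak_eq_ofReal, Complex.ofReal_re]

theorem euler_peak {μ : ℝ} (hμ : 0 < μ) (i j : Fin p) :
    euler i j (peak p q μ) = (-1 / μ : ℂ) • (momentum μ j i * peak p q μ) := by
  have hd : ContDiff ℝ ∞ (deriv fun s : ℝ => Real.exp (-s / μ)) := by
    rw [deriv_exp_neg_div]
    exact (contDiff_exp_neg_div μ).mul contDiff_const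
  have hμ' : (μ : ℂ) ≠ 0 := by exact_mod_cast hμ.ne'
  rw [peak, euler_mul, euler_gramDet, euler_compRe _ hd gramTrace_im, euler_gramTrace]
  refine smoothFrame_ext fun z => ?_
  simp only [coe_add_apply, coe_mul_apply, coe_smul_apply, compRe_apply, deriv_exp_neg_div]
  have h1 : (momentum (q := q) μ j i).1 z = (momentum 0 j i).1 z -
      (μ : ℂ) * (if i = j then 1 else 0) := by
    change (z.1ᴴ * z.1 - (μ : ℂ) • (1 : Matrix (Fin p) (Fin p) ℂ)) j i =
      (z.1ᴴ * z.1 - ((0 : ℝ) : ℂ) • (1 : Matrix (Fin p) (Fin p) ℂ)) j i - _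
    simp [Matrix.one_apply, eq_comm]
  rw [h1]
  push_cast
  field_simp
  ring

/-- The coordinate expression of `ρ`, as a function on all matrices. -/
def peakCoord (μ : ℝ) (v : Coord p q) : ℝ :=
  ((Matrix.of v)ᴴ * Matrix.of v).det.re * Real.exp (-(((Matrix.of v)ᴴ * Matrix.of v).trace.re) / μ)

theorem continuous_peakCoord (μ : ℝ) : Continuous (peakCoord (p := p) (q := q) μ) := by
  have h : Continuous fun v : Coord p q => (Matrix.of v)ᴴ * Matrix.of v :=
    Continuous.matrix_mul (Continuous.matrix_conjTranspose continuous_id) continuous_id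
  unfold peakCoord
  refine (Complex.continuous_re.comp h.matrix_det).mul (Real.continuous_exp.comp ?_)
  exact (Complex.continuous_re.comp h.matrix_trace).neg.div_const μ

theorem peakCoord_coord (μ : ℝ) (z : Frame p q) :
    peakCoord μ z.coord = ((peak p q μ).1 z).re := by
  rw [peak_re]
  rfl

/-- The superlevel sets of `ρ` contain no matrices of smaller rank, where `det x = 0`. -/
theorem subset_fullRankCoord_of_peakCoord {μ c : ℝ} (hc : 0 < c) :
    {v : Coord p q | c ≤ peakCoord μ v} ⊆ fullRankCoord p q := by
  intro v hv
  refine mem_fullRank_iff_det.mpr fun h => ?_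
  change ((Matrix.of v)ᴴ * Matrix.of v).det = 0 at h
  have h1 : c ≤ peakCoord μ v := hv
  rw [peakCoord, h, Complex.zero_re, zero_mul] at h1
  exact absurd hc (not_lt.mpr h1)

theorem trace_gram_re (z : Mat p q) : (zᴴ * z).trace.re = ∑ i, ∑ A, ‖z A i‖ ^ 2 := by
  simp only [Matrix.trace, Matrix.diag_apply, Matrix.mul_apply, Matrix.conjTranspose_apply,
    Complex.re_sum]
  refine Finset.sum_congr rfl fun i _ => Finset.sum_congr rfl fun A _ => ?_
  rw [RCLike.star_def, ← Complex.normSq_eq_conj_mul_self, Complex.ofReal_re,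
    Complex.normSq_eq_norm_sq]

/-- The superlevel sets of `ρ` are compact: `ρ` is bounded by a multiple of `e^{-tr x / (2 μ)}`, and
`tr x` is the square of the Hilbert–Schmidt norm of `z`. -/
theorem isCompact_peakCoord {μ c : ℝ} (hμ : 0 < μ) (hc : 0 < c) :
    IsCompact {v : Coord p q | c ≤ peakCoord μ v} := by
  refine Metric.isCompact_of_isClosed_isBounded
    (isClosed_le continuous_const (continuous_peakCoord μ)) ?_
  set T : ℝ := -(2 * μ) * Real.log (c / (2 * μ) ^ p) with hT
  have key : ∀ v : Coord p q, c ≤ peakCoord μ v → ∀ A i, ‖v A i‖ ^ 2 ≤ T := by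
    intro v hv A i
    have hz := subset_fullRankCoord_of_peakCoord hc hv
    have h1 := hv.trans (det_mul_exp_le hμ (posDef_gram (⟨Matrix.of v, hz⟩ : Frame p q)))
    have h2 : ‖v A i‖ ^ 2 ≤ ((Matrix.of v)ᴴ * Matrix.of v).trace.re := by
      rw [trace_gram_re]
      refine le_trans ?_ (Finset.single_le_sum (f := fun i => ∑ A, ‖Matrix.of v A i‖ ^ 2)
        (fun i _ => Finset.sum_nonneg fun A _ => sq_nonneg _) (Finset.mem_univ i))
      exact Finset.single_le_sum (f := fun A => ‖Matrix.of v A i‖ ^ 2)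
        (fun A _ => sq_nonneg _) (Finset.mem_univ A)
    refine h2.trans ?_
    have hpos : 0 < (2 * μ) ^ p := by positivity
    rw [← div_le_iff₀' hpos, ← Real.log_le_iff_le_exp (by positivity),
      le_div_iff₀ (by positivity)] at h1
    rw [hT]
    change ((Matrix.of v)ᴴ * Matrix.of v).trace.re ≤ _
    have h3 : Real.log (c / (2 * μ) ^ p) * (2 * μ) ≤
      -((Matrix.of v)ᴴ * Matrix.of v).trace.re := h1
    linarith
  refine (Metric.isBounded_closedBall (x := (0 : Coord p q)) (r := |T| + 1)).subset fun v hv => ?_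
  rw [mem_closedBall_zero_iff]
  refine (pi_norm_le_iff_of_nonneg (by positivity)).mpr fun A =>
    (pi_norm_le_iff_of_nonneg (by positivity)).mpr fun i => ?_
  have h1 := key v hv A i
  have h2 := le_abs_self T
  nlinarith [norm_nonneg (v A i), abs_nonneg T]

theorem gram_eq_of_max_le_peak {μ : ℝ} (hμ : 0 < μ) (z : Frame p q)
    (h : (μ * Real.exp (-1)) ^ p ≤ ((peak p q μ).1 z).re) :
    z.1ᴴ * z.1 = (μ : ℂ) • (1 : Matrix (Fin p) (Fin p) ℂ) := by
  rw [peak_re] at h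
  exact eq_smul_one_of_le_det_mul_exp hμ (posDef_gram z) h

theorem peak_eq_max {μ : ℝ} (hμ : 0 < μ) {z : Frame p q}
    (h : z.1ᴴ * z.1 = (μ : ℂ) • (1 : Matrix (Fin p) (Fin p) ℂ)) :
    ((peak p q μ).1 z).re = (μ * Real.exp (-1)) ^ p := by
  rw [peak_re, h, det_mul_exp_smul_one hμ]

/-- A function that vanishes where `x = μ` is small where `ρ` is close to its maximum. -/
theorem exists_norm_le_of_peak {μ : ℝ} (hμ : 0 < μ) {F : smoothFrame p q}
    (hF : ∀ z : Frame p q, z.1ᴴ * z.1 = (μ : ℂ) • (1 : Matrix (Fin p) (Fin p) ℂ) → F.1 z = 0)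
    {ε : ℝ} (hε : 0 < ε) : ∃ c, 0 < c ∧ c < (μ * Real.exp (-1)) ^ p ∧
      ∀ z : Frame p q, c ≤ ((peak p q μ).1 z).re → ‖F.1 z‖ ≤ ε := by
  set M := (μ * Real.exp (-1)) ^ p with hM
  have hMpos : 0 < M := by positivity
  have hK := isCompact_peakCoord (p := p) (q := q) hμ (half_pos hMpos)
  have hKs := subset_fullRankCoord_of_peakCoord (p := p) (q := q) (μ := μ) (half_pos hMpos)
  have hcont : ContinuousOn (fun v => ‖extend F.1 v‖) {v : Coord p q | M / 2 ≤ peakCoord μ v} :=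
    (F.2.continuousOn.mono hKs).norm
  have hK1 : IsCompact ({v : Coord p q | M / 2 ≤ peakCoord μ v} ∩
      (fun v => ‖extend F.1 v‖) ⁻¹' Set.Ici ε) :=
    hK.of_isClosed_subset (hcont.preimage_isClosed_of_isClosed hK.isClosed isClosed_Ici)
      Set.inter_subset_left
  rcases Set.eq_empty_or_nonempty ({v : Coord p q | M / 2 ≤ peakCoord μ v} ∩
      (fun v => ‖extend F.1 v‖) ⁻¹' Set.Ici ε) with hemp | hne
  · refine ⟨M / 2, half_pos hMpos, half_lt_self hMpos, fun z hz => ?_⟩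
    by_contra! hlt
    have : z.coord ∈ (∅ : Set (Coord p q)) := by
      rw [← hemp]
      refine ⟨by rw [Set.mem_ofPred_eq, peakCoord_coord]; exact hz, ?_⟩
      rw [Set.mem_preimage, extend_coord]
      exact hlt.le
    exact this
  · obtain ⟨w, hw, hmax⟩ := hK1.exists_isMaxOn hne (continuous_peakCoord μ).continuousOn
    obtain ⟨hw1, hw2⟩ := hw
    set zw : Frame p q := ⟨Matrix.of w, hKs hw1⟩
    have hlt : peakCoord μ w < M := by
      by_contra! hge
      have h1 := hF zw (gram_eq_of_max_le_peak hμ zw (by rw [← peakCoord_coord]; exact hge))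
      rw [Set.mem_preimage, extend_of_mem F.1 w (hKs hw1), h1, norm_zero] at hw2
      exact absurd hε (not_lt.mpr hw2)
    have hw3 : M / 2 ≤ peakCoord μ w := hw1
    refine ⟨(peakCoord μ w + M) / 2, by linarith, by linarith, fun z hz => ?_⟩
    by_contra! hlt'
    rw [← peakCoord_coord] at hz
    have h2 : peakCoord μ z.coord ≤ peakCoord μ w :=
      hmax (show z.coord ∈ _ from ⟨by rw [Set.mem_ofPred_eq]; linarith, by
        rw [Set.mem_preimage, extend_coord]
        exact hlt'.le⟩)
    linarith

end Integration

/-! ### Homogeneous series in the ideal -/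

section Separation

open MeasureTheory
open scoped ComplexOrder

variable {p q : ℕ}

/-- The weight `φ(ρ) (det x)^{-(p+q)}`. The power of the determinant compensates the divergence of
the fields `E_ii` with respect to Lebesgue measure. -/
def weight (p q : ℕ) (μ : ℝ) (φ : ℝ → ℝ) (hφ : ContDiff ℝ ∞ φ) : smoothFrame p q :=
  compRe φ hφ (peak p q μ) * smoothInv (gramDet p q) gramDet_ne_zero ^ (p + q)

theorem weight_apply (μ : ℝ) (φ : ℝ → ℝ) (hφ : ContDiff ℝ ∞ φ) (z : Frame p q) :
    (weight p q μ φ hφ).1 z =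
      ((φ ((peak p q μ).1 z).re * (((gramDet p q).1 z).re⁻¹) ^ (p + q) : ℝ) : ℂ) := by
  have h : (gramDet p q).1 z = (((gramDet p q).1 z).re : ℂ) :=
    Complex.ext rfl (by rw [Complex.ofReal_im]; exact gramDet_im z)
  have h1 : (smoothInv (gramDet p q) gramDet_ne_zero ^ (p + q)).1 z =
      (((gramDet p q).1 z)⁻¹) ^ (p + q) := rfl
  rw [weight, coe_mul_apply, compRe_apply, h1, h]
  push_cast
  rfl

theorem weight_compactlySupported {μ : ℝ} (hμ : 0 < μ) {φ : ℝ → ℝ} (hφ : ContDiff ℝ ∞ φ) {c : ℝ}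
    (hc : 0 < c) (h0 : ∀ s ≤ c, φ s = 0) : CompactlySupported (weight p q μ φ hφ) := by
  refine ⟨_, isCompact_peakCoord hμ hc, subset_fullRankCoord_of_peakCoord hc, fun z hz => ?_⟩
  rw [Set.mem_ofPred_eq, peakCoord_coord, not_le] at hz
  rw [weight_apply, h0 _ hz.le, zero_mul, Complex.ofReal_zero]

theorem contDiff_mul_deriv {φ : ℝ → ℝ} (hφ : ContDiff ℝ ∞ φ) :
    ContDiff ℝ ∞ fun s => s * deriv φ s :=
  contDiff_id.mul (contDiff_infty_iff_deriv.mp hφ).2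

theorem euler_weight {μ : ℝ} (hμ : 0 < μ) {φ : ℝ → ℝ} (hφ : ContDiff ℝ ∞ φ) (i j : Fin p) :
    euler i j (weight p q μ φ hφ) = -(if i = j then (p + q : ℂ) else 0) • weight p q μ φ hφ +
      (-1 / μ : ℂ) • (momentum μ j i *
        weight p q μ (fun s => s * deriv φ s) (contDiff_mul_deriv hφ)) := by
  have hd := (contDiff_infty_iff_deriv.mp hφ).2
  have h1 := euler_pow (euler_smoothInv gramDet_ne_zero (euler_gramDet (q := q) i j)) (p + q)
  rw [weight, euler_mul, euler_compRe hφ hd (peak_im μ), euler_peak hμ, h1, weight]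
  refine smoothFrame_ext fun z => ?_
  simp only [coe_add_apply, coe_mul_apply, coe_smul_apply, compRe_apply]
  have h2 : (peak p q μ).1 z = (((peak p q μ).1 z).re : ℂ) :=
    Complex.ext rfl (by rw [Complex.ofReal_im]; exact peak_im μ z)
  rw [h2]
  push_cast
  split_ifs
  · simp only [Complex.ofReal_re]
    ring
  · simp only [Complex.ofReal_re]
    ring

/-- Integration by parts along the fibres: against homogeneous functions and weights, the
operator `∑ E_ij K_ij` is a multiple of `∑ K_ij (x - μ)_ji`. -/
theorem frameIntegral_traceEuler {μ : ℝ} (hμ : 0 < μ) {φ : ℝ → ℝ} (hφ : ContDiff ℝ ∞ φ) {c : ℝ}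
    (hc : 0 < c) (h0 : ∀ s ≤ c, φ s = 0) {b : smoothFrame p q} (hb : b ∈ homogeneousFn p q)
    (K : Matrix (Fin p) (Fin p) (smoothFrame p q)) :
    frameIntegral (b * traceEuler K * weight p q μ φ hφ) = (1 / μ : ℂ) *
      frameIntegral (b * traceMomentum μ K *
        weight p q μ (fun s => s * deriv φ s) (contDiff_mul_deriv hφ)) := by
  have hw := weight_compactlySupported (p := p) (q := q) hμ hφ hc h0
  have h0' : ∀ s ≤ c / 2, s * deriv φ s = 0 := by
    intro s hs
    have : φ =ᶠ[nhds s] fun _ => 0 := by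
      filter_upwards [Iio_mem_nhds (show s < c by linarith)] with t ht
      exact h0 t (le_of_lt ht)
    rw [this.deriv_eq, deriv_const, mul_zero]
  have hw' := weight_compactlySupported (p := p) (q := q) hμ (contDiff_mul_deriv hφ)
    (half_pos hc) h0'
  set w := weight p q μ φ hφ
  set w' := weight p q μ (fun s => s * deriv φ s) (contDiff_mul_deriv hφ)
  have key : ∀ i j, frameIntegral (b * euler i j (K i j) * w) =
      (1 / μ : ℂ) * frameIntegral (b * (K i j * momentum μ j i) * w') := by
    intro i j
    have h1 := (hw.mul_left (b * K i j)).euler i j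
    have h2 : euler i j (b * K i j * w) = b * euler i j (K i j) * w +
        ((-(if i = j then (p + q : ℂ) else 0)) • (b * K i j * w) +
          (-1 / μ : ℂ) • (b * (K i j * momentum μ j i) * w')) := by
      rw [euler_mul, euler_mul, euler_of_mem_homogeneousFn hb, euler_weight hμ, zero_mul, zero_add,
        mul_add, mul_smul_comm, mul_smul_comm]
      congr 3
      ring
    have h3 := h1.2
    rw [h2, frameIntegral_add (hw.mul_left _) (((hw.mul_left _).smul _).add
      ((hw'.mul_left _).smul _)), frameIntegral_add ((hw.mul_left _).smul _)
      ((hw'.mul_left _).smul _), frameIntegral_smul, frameIntegral_smul] at h3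
    linear_combination h3
  have h1 : b * traceEuler K * w = ∑ i, ∑ j, b * euler i j (K i j) * w := by
    simp only [traceEuler, Finset.mul_sum, Finset.sum_mul]
  have h2 : b * traceMomentum μ K * w' = ∑ i, ∑ j, b * (K i j * momentum μ j i) * w' := by
    simp only [traceMomentum, Finset.mul_sum, Finset.sum_mul]
  have s1 := fun i => CompactlySupported.sum (s := Finset.univ) (F := fun j =>
    b * euler i j (K i j) * w) fun j _ => hw.mul_left _
  have s2 := fun i => CompactlySupported.sum (s := Finset.univ) (F := fun j =>
    b * (K i j * momentum μ j i) * w') fun j _ => hw'.mul_left _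
  rw [h1, h2, (CompactlySupported.sum fun i _ => (s1 i).1).2,
    (CompactlySupported.sum fun i _ => (s2 i).1).2, Finset.mul_sum]
  refine Finset.sum_congr rfl fun i _ => ?_
  rw [(s1 i).2, (s2 i).2, Finset.mul_sum]
  exact Finset.sum_congr rfl fun j _ => key i j

theorem traceMomentum_apply_eq_zero {μ : ℝ} (K : Matrix (Fin p) (Fin p) (smoothFrame p q))
    {z : Frame p q} (hz : z.1ᴴ * z.1 = (μ : ℂ) • (1 : Matrix (Fin p) (Fin p) ℂ)) :
    (traceMomentum μ K).1 z = 0 := by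
  rw [traceMomentum, coe_sum_apply]
  refine Finset.sum_eq_zero fun i _ => ?_
  rw [coe_sum_apply]
  refine Finset.sum_eq_zero fun j _ => ?_
  have h : (momentum (q := q) μ j i).1 z = 0 := by
    change (z.1ᴴ * z.1 - (μ : ℂ) • (1 : Matrix (Fin p) (Fin p) ℂ)) j i = 0
    rw [hz, sub_self, Matrix.zero_apply]
  rw [coe_mul_apply, h, mul_zero]

open scoped MatrixOrder in
/-- A positive definite matrix has a factorization `B† B` with `B` invertible. -/
theorem exists_factor_of_posDef {x : Matrix (Fin p) (Fin p) ℂ} (hx : x.PosDef) :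
    ∃ B : GL (Fin p) ℂ, x = B.1ᴴ * B.1 := by
  obtain ⟨B, hB⟩ := CStarAlgebra.nonneg_iff_eq_star_mul_self.mp hx.posSemidef.nonneg
  rw [Matrix.star_eq_conjTranspose] at hB
  have hu : IsUnit B := by
    rw [Matrix.isUnit_iff_isUnit_det, isUnit_iff_ne_zero]
    intro h
    have := hx.det_pos
    rw [hB, Matrix.det_mul, h, mul_zero] at this
    exact lt_irrefl _ this
  obtain ⟨B', rfl⟩ := hu
  exact ⟨B', hB⟩

/-- Every fibre meets the level set `x = μ`. -/
theorem exists_mul_gram_eq {μ : ℝ} (hμ : 0 < μ) (z : Frame p q) : ∃ g : GL (Fin p) ℂ,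
    (z.mul g).1ᴴ * (z.mul g).1 = (μ : ℂ) • (1 : Matrix (Fin p) (Fin p) ℂ) := by
  have hp : (z.1ᴴ * z.1).PosDef := posDef_gram z
  obtain ⟨B, hB⟩ := exists_factor_of_posDef (hp.smul (inv_pos.mpr (Complex.zero_lt_real.mpr hμ)))
  refine ⟨B⁻¹, ?_⟩
  have hμ' : (μ : ℂ) ≠ 0 := by exact_mod_cast hμ.ne'
  have h1 : z.1ᴴ * z.1 = (μ : ℂ) • (B.1ᴴ * B.1) := by
    rw [← hB, smul_smul, mul_inv_cancel₀ hμ', one_smul]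
  have h2 : B.1 * (B⁻¹).1 = 1 := by rw [← Units.val_mul, mul_inv_cancel, Units.val_one]
  have h3 : (z.mul B⁻¹).1ᴴ * (z.mul B⁻¹).1 = ((B⁻¹).1)ᴴ * (z.1ᴴ * z.1) * (B⁻¹).1 := by
    change (z.1 * (B⁻¹).1)ᴴ * (z.1 * (B⁻¹).1) = _
    rw [Matrix.conjTranspose_mul]
    simp only [Matrix.mul_assoc]
  have h4 : ((B⁻¹).1)ᴴ * B.1ᴴ = 1 := by
    rw [← Matrix.conjTranspose_mul, h2, Matrix.conjTranspose_one]
  rw [h3, h1, Matrix.mul_smul, Matrix.smul_mul]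
  congr 1
  rw [Matrix.mul_assoc, Matrix.mul_assoc, h2, Matrix.mul_one, h4]

/-- If a homogeneous function agrees with a function vanishing where `x = μ` on all test functions,
then it is zero: the weights concentrate where the second function is small, while a homogeneous
function has the same size along each fibre. -/
theorem homogeneous_eq_zero_of_integral_eq {μ : ℝ} (hμ : 0 < μ) {H F : smoothFrame p q}
    (hH : H ∈ homogeneousFn p q)
    (hF : ∀ z : Frame p q, z.1ᴴ * z.1 = (μ : ℂ) • (1 : Matrix (Fin p) (Fin p) ℂ) → F.1 z = 0)
    (h : ∀ b ∈ homogeneousFn p q, ∀ (φ : ℝ → ℝ) (hφ : ContDiff ℝ ∞ φ) (c : ℝ), 0 < c →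
      (∀ s ≤ c, φ s = 0) → frameIntegral (b * H * weight p q μ φ hφ) =
        frameIntegral (b * F * weight p q μ φ hφ)) : H = 0 := by
  refine smoothFrame_ext fun z₀ => ?_
  by_contra hne
  obtain ⟨g, hg⟩ := exists_mul_gram_eq hμ z₀
  have hne' : H.1 (z₀.mul g) ≠ 0 := by
    rw [hH]
    exact hne
  set ζ := z₀.mul g with hζ
  set η : ℝ := ‖H.1 ζ‖ / 2 with hη
  have hηpos : 0 < η := half_pos (norm_pos_iff.mpr hne')
  obtain ⟨c, hc0, hcM, hc⟩ := exists_norm_le_of_peak hμ hF (half_pos hηpos)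
  -- `b = conj H · χ(|H|²)` with `χ` vanishing where `|H| ≤ η`, and `φ` supported in `ρ ≥ c`
  have hχ : ContDiff ℝ ∞ fun s : ℝ => Real.smoothTransition (s - η ^ 2) :=
    Real.smoothTransition.contDiff.comp (contDiff_id.sub contDiff_const)
  have hφ : ContDiff ℝ ∞ fun s : ℝ => Real.smoothTransition (s - c) :=
    Real.smoothTransition.contDiff.comp (contDiff_id.sub contDiff_const)
  have hφ0 : ∀ s ≤ c, Real.smoothTransition (s - c) = 0 := fun s hs =>
    Real.smoothTransition.zero_of_nonpos (by linarith)
  set b : smoothFrame p q := conjFn H * compRe _ hχ (conjFn H * H) with hb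
  have hbhom : b ∈ homogeneousFn p q := by
    intro z g
    simp only [hb, coe_mul_apply, compRe_apply, conjFn_apply, hH z g]
  have hw := weight_compactlySupported (p := p) (q := q) hμ hφ hc0 hφ0
  have hint := h b hbhom _ hφ c hc0 hφ0
  set w := weight p q μ _ hφ with hw_def
  have hnorm : ∀ z, ((conjFn H * H).1 z).re = ‖H.1 z‖ ^ 2 := by
    intro z
    rw [coe_mul_apply, conjFn_apply, ← Complex.normSq_eq_conj_mul_self, Complex.ofReal_re,
      Complex.normSq_eq_norm_sq]
  have hwz : ∀ z, ∃ r : ℝ, 0 ≤ r ∧ w.1 z = (r : ℂ) ∧ (((peak p q μ).1 z).re < c → r = 0) ∧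
      (c < ((peak p q μ).1 z).re → 0 < r) := by
    intro z
    have hd : 0 < (((gramDet p q).1 z).re⁻¹) ^ (p + q) := pow_pos (inv_pos.mpr (gramDet_re_pos z)) _
    refine ⟨_, ?_, weight_apply μ _ hφ z, fun hlt => ?_, fun hlt => ?_⟩
    · exact mul_nonneg (Real.smoothTransition.nonneg _) hd.le
    · rw [hφ0 _ hlt.le, zero_mul]
    · exact mul_pos (Real.smoothTransition.pos_of_pos (by linarith)) hd
  -- the integrand on the left is real and nonnegative
  have hL : ∀ z, ∃ s : ℝ, 0 ≤ s ∧ (b * H * w).1 z = (s : ℂ) ∧ ‖(b * F * w).1 z‖ ≤ s / 2 ∧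
      (η < ‖H.1 z‖ → c < ((peak p q μ).1 z).re → 0 < s) := by
    intro z
    obtain ⟨r, hr0, hr, hr1, hr2⟩ := hwz z
    set χ := Real.smoothTransition (‖H.1 z‖ ^ 2 - η ^ 2) with hχz
    have hχ0 : 0 ≤ χ := Real.smoothTransition.nonneg _
    have hbz : b.1 z = starRingEnd ℂ (H.1 z) * (χ : ℂ) := by
      rw [hb, coe_mul_apply, compRe_apply, hnorm, conjFn_apply]
    refine ⟨‖H.1 z‖ ^ 2 * χ * r, by positivity, ?_, ?_, fun h1 h2 => ?_⟩
    · rw [coe_mul_apply, coe_mul_apply, hbz, hr]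
      push_cast
      rw [← Complex.conj_mul']
      ring
    · rw [coe_mul_apply, coe_mul_apply, hbz, hr, norm_mul, norm_mul, norm_mul, RCLike.norm_conj,
        Complex.norm_real, Complex.norm_real, Real.norm_of_nonneg hχ0, Real.norm_of_nonneg hr0]
      by_cases hlt : ((peak p q μ).1 z).re < c
      · rw [hr1 hlt]
        simp
      · have hFz := hc z (not_lt.mp hlt)
        by_cases hχ' : χ = 0
        · rw [hχ']
          simp
        · have hHz : η ≤ ‖H.1 z‖ := by
            by_contra! hlt'
            refine hχ' (Real.smoothTransition.zero_of_nonpos ?_)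
            nlinarith [norm_nonneg (H.1 z)]
          have h1 : ‖H.1 z‖ * ‖F.1 z‖ ≤ ‖H.1 z‖ * (‖H.1 z‖ / 2) :=
            mul_le_mul_of_nonneg_left (by linarith) (norm_nonneg _)
          have h2 := mul_le_mul_of_nonneg_right h1 (mul_nonneg hχ0 hr0)
          nlinarith [h2]
    · have h3 : 0 < χ := by
        refine Real.smoothTransition.pos_of_pos ?_
        nlinarith
      have h4 : 0 < ‖H.1 z‖ := hηpos.trans h1
      exact mul_pos (mul_pos (pow_pos h4 2) h3) (hr2 h2)
  have hcsL := hw.mul_left (b * H)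
  have hcsR := hw.mul_left (b * F)
  set L : Coord p q → ℝ := fun v => (extend (b * H * w).1 v).re with hLdef
  have hLcont : Continuous L := Complex.continuous_re.comp hcsL.contDiff.continuous
  have hLsupp : HasCompactSupport L := hcsL.hasCompactSupport.comp_left (g := Complex.re) rfl
  have hzero : ∀ (G : smoothFrame p q) (v : Coord p q), v ∉ fullRankCoord p q →
      extend G.1 v = 0 := by
    intro G v hv
    rw [extend, Function.extend_apply']
    · rfl
    · rintro ⟨z, hz⟩
      apply hv
      have : z.1 ∈ fullRank p q := z.2
      rw [hz] at this
      exact this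
  have hLnonneg : 0 ≤ L := by
    intro v
    by_cases hv : v ∈ fullRankCoord p q
    · obtain ⟨s, hs0, hs, -, -⟩ := hL ⟨Matrix.of v, hv⟩
      simp only [hLdef]
      rw [extend_of_mem _ v hv, hs]
      exact hs0
    · simp only [hLdef]
      rw [hzero _ v hv]
      exact le_refl _
  have hLζ : L ζ.coord ≠ 0 := by
    obtain ⟨s, -, hs, -, hs'⟩ := hL ζ
    simp only [hLdef]
    rw [extend_coord, hs, Complex.ofReal_re]
    refine (hs' ?_ ?_).ne'
    · rw [hη]
      exact half_lt_self (norm_pos_iff.mpr hne')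
    · rw [peak_eq_max hμ hg]
      exact hcM
  have hpos : 0 < ∫ v, L v :=
    hLcont.integral_pos_of_hasCompactSupport_nonneg_nonzero hLsupp hLnonneg hLζ
  have hle : ∀ v, ‖extend (b * F * w).1 v‖ ≤ L v / 2 := by
    intro v
    by_cases hv : v ∈ fullRankCoord p q
    · obtain ⟨s, -, hs, hs', -⟩ := hL ⟨Matrix.of v, hv⟩
      simp only [hLdef]
      rw [extend_of_mem _ v hv, extend_of_mem _ v hv, hs, Complex.ofReal_re]
      exact hs'
    · simp only [hLdef]
      rw [hzero _ v hv, hzero _ v hv]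
      simp
  have h1 : ∫ v, L v = (frameIntegral (b * H * w)).re :=
    integral_re (𝕜 := ℂ) hcsL.integrable
  have h2 : (frameIntegral (b * H * w)).re ≤ (∫ v, L v) / 2 := by
    rw [hint]
    refine (Complex.re_le_norm _).trans ((norm_integral_le_integral_norm _).trans ?_)
    rw [← integral_div]
    exact integral_mono hcsR.integrable.norm
      ((hLcont.integrable_of_hasCompactSupport hLsupp).div_const 2) hle
  linarith

/-- The only homogeneous series in the ideal is zero. -/
theorem disjoint_formalHom_momentumIdeal {μ : ℝ} (hμ : 0 < μ) :
    Disjoint (formalHom p q) (momentumIdeal p q μ) := by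
  rw [Submodule.disjoint_def]
  intro H hH hJ
  obtain ⟨K, -, h0, h1⟩ := mem_momentumIdeal_iff.mp hJ
  have key : ∀ n, PowerSeries.coeff n H = 0 ∧ ∀ b ∈ homogeneousFn p q, ∀ (φ : ℝ → ℝ)
      (hφ : ContDiff ℝ ∞ φ) (c : ℝ), 0 < c → (∀ s ≤ c, φ s = 0) →
      frameIntegral (b * traceMomentum μ (K n) * weight p q μ φ hφ) = 0 := by
    have step : ∀ n, (∀ b ∈ homogeneousFn p q, ∀ (φ : ℝ → ℝ)
        (hφ : ContDiff ℝ ∞ φ) (c : ℝ), 0 < c → (∀ s ≤ c, φ s = 0) →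
        frameIntegral (b * PowerSeries.coeff n H * weight p q μ φ hφ) =
          frameIntegral (b * traceMomentum μ (K n) * weight p q μ φ hφ)) →
        PowerSeries.coeff n H = 0 ∧ ∀ b ∈ homogeneousFn p q, ∀ (φ : ℝ → ℝ)
          (hφ : ContDiff ℝ ∞ φ) (c : ℝ), 0 < c → (∀ s ≤ c, φ s = 0) →
          frameIntegral (b * traceMomentum μ (K n) * weight p q μ φ hφ) = 0 := by
      intro n h
      have hz := homogeneous_eq_zero_of_integral_eq hμ (hH n)
        (fun z hz => traceMomentum_apply_eq_zero (K n) hz) h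
      refine ⟨hz, fun b hb φ hφ c hc h0 => ?_⟩
      rw [← h b hb φ hφ c hc h0, hz, mul_zero, zero_mul, ← zero_smul ℂ (0 : smoothFrame p q),
        frameIntegral_smul, zero_mul]
    intro n
    induction n with
    | zero =>
      refine step 0 fun b _ φ hφ c _ _ => ?_
      rw [h0]
    | succ n ih =>
      refine step (n + 1) fun b hb φ hφ c hc hc0 => ?_
      have hw := weight_compactlySupported (p := p) (q := q) hμ hφ hc hc0
      rw [h1, mul_add, add_mul, frameIntegral_add (hw.mul_left _) (hw.mul_left _),
        frameIntegral_traceEuler hμ hφ hc hc0 hb, ih.2 b hb _ _ (c / 2) (half_pos hc), mul_zero,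
        add_zero]
      intro s hs
      have : φ =ᶠ[nhds s] fun _ => 0 := by
        filter_upwards [Iio_mem_nhds (show s < c by linarith)] with t ht
        exact hc0 t (le_of_lt ht)
      rw [this.deriv_eq, deriv_const, mul_zero]
  ext1 n
  exact (key n).1

end Separation

/-! ### Integrals depending smoothly on a parameter -/

section ParametricIntegral

open MeasureTheory Set

theorem continuousOn_slice {V W : Type} [TopologicalSpace V] [TopologicalSpace W]
    {f : V × ℝ → W} {v : V}
    (h : ∀ t ∈ Icc (0 : ℝ) 1, ContinuousAt f (v, t)) :
    ContinuousOn (fun t => f (v, t)) (uIcc (0 : ℝ) 1) := by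
  rw [uIcc_of_le zero_le_one]
  intro t ht
  exact ((h t ht).comp (f := fun t => (v, t)) (by fun_prop)).continuousWithinAt

variable {V W : Type} [NormedAddCommGroup V] [NormedSpace ℝ V] [ProperSpace V]
  [NormedAddCommGroup W] [NormedSpace ℝ W]

/-- Differentiation under the integral sign; the bound comes from compactness of a closed ball of
parameters times `[0, 1]`. -/
theorem hasFDerivAt_integral_param {U : Set V} (hU : IsOpen U) {f : V × ℝ → W}
    (hf : ∀ v ∈ U, ∀ t ∈ Icc (0 : ℝ) 1, ContDiffAt ℝ 1 f (v, t)) {v : V} (hv : v ∈ U) :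
    HasFDerivAt (fun v => ∫ t in (0 : ℝ)..1, f (v, t))
      (∫ t in (0 : ℝ)..1, (fderiv ℝ f (v, t)).comp (ContinuousLinearMap.inl ℝ V ℝ)) v := by
  have hd : ∀ v ∈ U, ∀ t ∈ Icc (0 : ℝ) 1, ContinuousAt
      (fun x : V × ℝ => (fderiv ℝ f x).comp (ContinuousLinearMap.inl ℝ V ℝ)) (v, t) := by
    intro v hv t ht
    have h := ((hf v hv t ht).fderiv_right (m := 0) (by simp)).continuousAt
    exact (ContinuousLinearMap.compL ℝ V (V × ℝ) W).flip
      (ContinuousLinearMap.inl ℝ V ℝ) |>.continuous.continuousAt.comp h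
  obtain ⟨ε, hε, hball⟩ := Metric.nhds_basis_closedBall.mem_iff.mp (hU.mem_nhds hv)
  obtain ⟨C, hC⟩ := ((isCompact_closedBall v ε).prod isCompact_Icc).exists_bound_of_continuousOn
    (f := fun x : V × ℝ => (fderiv ℝ f x).comp (ContinuousLinearMap.inl ℝ V ℝ))
    (s := Metric.closedBall v ε ×ˢ Icc (0 : ℝ) 1)
    (fun x hx => (hd x.1 (hball hx.1) x.2 hx.2).continuousWithinAt)
  have hsub : uIoc (0 : ℝ) 1 ⊆ Icc 0 1 := by
    rw [uIoc_of_le zero_le_one]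
    exact Ioc_subset_Icc_self
  have hint : ∀ w ∈ U, IntervalIntegrable (fun t => f (w, t)) volume 0 1 := fun w hw =>
    (continuousOn_slice fun t ht => (hf w hw t ht).continuousAt).intervalIntegrable
  refine intervalIntegral.hasFDerivAt_integral_of_dominated_of_fderiv_le
    (F := fun v t => f (v, t)) (bound := fun _ => C)
    (F' := fun v t => (fderiv ℝ f (v, t)).comp (ContinuousLinearMap.inl ℝ V ℝ))
    (Metric.closedBall_mem_nhds v hε) ?_ (hint v hv) ?_ ?_ intervalIntegrable_const ?_
  · filter_upwards [hU.mem_nhds hv] with w hw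
    rw [uIoc_of_le zero_le_one]
    exact (hint w hw).1.aestronglyMeasurable
  · rw [uIoc_of_le zero_le_one]
    exact (continuousOn_slice (hd v hv)).intervalIntegrable.1.aestronglyMeasurable
  · exact Filter.Eventually.of_forall fun t ht w hw => hC (w, t) ⟨hw, hsub ht⟩
  · refine Filter.Eventually.of_forall fun t ht w hw => ?_
    have h := ((hf w (hball hw) t (hsub ht)).differentiableAt (by simp)).hasFDerivAt
    exact h.comp (f := fun w => (w, t)) w (hasFDerivAt_prodMk_left w t)

theorem contDiffOn_integral_param_nat (n : ℕ) {U : Set V} (hU : IsOpen U) :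
    ∀ {W : Type} [NormedAddCommGroup W] [NormedSpace ℝ W] {f : V × ℝ → W},
    (∀ v ∈ U, ∀ t ∈ Icc (0 : ℝ) 1, ContDiffAt ℝ ∞ f (v, t)) →
    ContDiffOn ℝ n (fun v => ∫ t in (0 : ℝ)..1, f (v, t)) U := by
  induction n with
  | zero =>
    intro W _ _ f hf
    refine contDiffOn_zero.mpr fun v hv => ?_
    exact (hasFDerivAt_integral_param hU (fun v hv t ht => (hf v hv t ht).of_le (by simp))
      hv).continuousAt.continuousWithinAt
  | succ n ih =>
    intro W _ _ f hf
    have hd : ∀ v ∈ U, HasFDerivAt (fun v => ∫ t in (0 : ℝ)..1, f (v, t))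
        (∫ t in (0 : ℝ)..1, (fderiv ℝ f (v, t)).comp (ContinuousLinearMap.inl ℝ V ℝ)) v :=
      fun v hv => hasFDerivAt_integral_param hU
        (fun v hv t ht => (hf v hv t ht).of_le (by simp)) hv
    push_cast
    refine (contDiffOn_succ_iff_fderiv_of_isOpen hU).mpr
      ⟨fun v hv => (hd v hv).differentiableAt.differentiableWithinAt, by simp, ?_⟩
    refine (ih (f := fun x : V × ℝ => (fderiv ℝ f x).comp (ContinuousLinearMap.inl ℝ V ℝ))
      fun v hv t ht => ?_).congr fun v hv => (hd v hv).fderiv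
    have h := (hf v hv t ht).fderiv_right (m := ∞) (by simp)
    exact ((ContinuousLinearMap.compL ℝ V (V × ℝ) W).flip
      (ContinuousLinearMap.inl ℝ V ℝ)).contDiff.contDiffAt.comp (v, t) h

/-- An integral over `[0, 1]` of a smooth function depends smoothly on parameters. -/
theorem contDiffOn_integral_param {U : Set V} (hU : IsOpen U) {f : V × ℝ → W}
    (hf : ∀ v ∈ U, ∀ t ∈ Icc (0 : ℝ) 1, ContDiffAt ℝ ∞ f (v, t)) :
    ContDiffOn ℝ ∞ (fun v => ∫ t in (0 : ℝ)..1, f (v, t)) U :=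
  contDiffOn_infty.mpr fun n => contDiffOn_integral_param_nat n hU hf

end ParametricIntegral

/-! ### Invariant functions along the fibres -/

section Fibre

open scoped Topology

variable {p q : ℕ}

/-- Square matrices as a real normed space. -/
abbrev Square (p : ℕ) : Type := Fin p → Fin p → ℂ

theorem smoothEntries_square (y : Square p) : SmoothEntries (fun y : Square p => Matrix.of y) y :=
  fun i j => contDiffAt_pi.mp (contDiffAt_pi.mp contDiffAt_id i) j

theorem SmoothEntries.conjTranspose {V : Type*} [NormedAddCommGroup V] [NormedSpace ℝ V]
    {m n : Type*} {f : V → Matrix m n ℂ} {x : V} (hf : SmoothEntries f x) :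
    SmoothEntries (fun v => (f v)ᴴ) x :=
  fun i j => Complex.conjCLE.contDiff.contDiffAt.comp x (hf j i)

theorem SmoothEntries.comp {V W : Type*} [NormedAddCommGroup V] [NormedSpace ℝ V]
    [NormedAddCommGroup W] [NormedSpace ℝ W] {m n : Type*} {f : W → Matrix m n ℂ} {g : V → W}
    {x : V} (hf : SmoothEntries f (g x)) (hg : ContDiffAt ℝ ∞ g x) :
    SmoothEntries (fun v => f (g v)) x :=
  fun i j => (hf i j).comp x hg

theorem SmoothEntries.contDiffAt {V : Type*} [NormedAddCommGroup V] [NormedSpace ℝ V]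
    {m n : Type*} [Fintype m] [Fintype n] {f : V → Matrix m n ℂ} {x : V}
    (hf : SmoothEntries f x) : ContDiffAt ℝ ∞ (fun v => (Matrix.of.symm (f v) : m → n → ℂ)) x :=
  contDiffAt_pi.mpr fun i => contDiffAt_pi.mpr fun j => hf i j

/-- The map `s ↦ s s† + s - s†`. It is a local diffeomorphism at `1`, and where its value is
Hermitian, so is `s`, and the value is `s s†`. -/
def gramMap (s : Square p) : Square p :=
  Matrix.of.symm (Matrix.of s * (Matrix.of s)ᴴ + (Matrix.of s - (Matrix.of s)ᴴ))

theorem contDiffAt_gramMap (s : Square p) : ContDiffAt ℝ ∞ (gramMap (p := p)) s := by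
  have h := smoothEntries_square s
  refine contDiffAt_pi.mpr fun i => contDiffAt_pi.mpr fun j => ?_
  exact (h.mul h.conjTranspose i j).add ((h i j).sub (h.conjTranspose i j))

/-- The identity matrix as an element of the real normed space of square matrices. -/
def squareOne (p : ℕ) : Square p := Matrix.of.symm 1

theorem gramMap_one : gramMap (squareOne p) = squareOne p := by
  simp [gramMap, squareOne]

theorem hasFDerivAt_gramMap : HasFDerivAt (gramMap (p := p))
    ((ContinuousLinearEquiv.smulLeft (Units.mk0 (2 : ℝ) two_ne_zero) :
      Square p ≃L[ℝ] Square p) : Square p →L[ℝ] Square p) (squareOne p) := by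
  have h := ((contDiffAt_gramMap (squareOne p)).differentiableAt (by simp)).hasFDerivAt
  suffices hs : ∀ w : Square p, (2 : ℝ) • w = fderiv ℝ gramMap (squareOne p) w by
    have he : ((ContinuousLinearEquiv.smulLeft (Units.mk0 (2 : ℝ) two_ne_zero) :
      Square p ≃L[ℝ] Square p) : Square p →L[ℝ] Square p) =
        fderiv ℝ gramMap (squareOne p) := ContinuousLinearMap.ext hs
    rw [he]
    exact h
  intro w
  have h1 : HasDerivAt (fun t : ℝ => squareOne p + t • w) w 0 := by
    simpa using ((hasDerivAt_id (0 : ℝ)).smul_const w).const_add (squareOne p)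
  have h2 : HasDerivAt (fun t : ℝ => gramMap (squareOne p + t • w))
      (fderiv ℝ gramMap (squareOne p) w) 0 := by
    have h' : HasFDerivAt gramMap (fderiv ℝ gramMap (squareOne p))
        (squareOne p + (0 : ℝ) • w) := by
      rwa [zero_smul, add_zero]
    exact h'.comp_hasDerivAt 0 h1
  have h3 : (fun t : ℝ => gramMap (squareOne p + t • w)) = fun t : ℝ =>
      squareOne p + t • ((2 : ℝ) • w) +
        t ^ 2 • (Matrix.of.symm (Matrix.of w * (Matrix.of w)ᴴ) : Square p) := by
    funext t
    refine congrArg Matrix.of.symm ?_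
    change (1 + t • Matrix.of w) * (1 + t • Matrix.of w)ᴴ +
      ((1 + t • Matrix.of w) - (1 + t • Matrix.of w)ᴴ) =
      1 + t • ((2 : ℝ) • Matrix.of w) + t ^ 2 • (Matrix.of w * (Matrix.of w)ᴴ)
    rw [Matrix.conjTranspose_add, Matrix.conjTranspose_smul, Matrix.conjTranspose_one,
      star_trivial, Matrix.add_mul, Matrix.mul_add, Matrix.mul_add, Matrix.one_mul, Matrix.one_mul,
      Matrix.mul_one, Matrix.smul_mul, Matrix.mul_smul, smul_smul, pow_two, two_smul, smul_add]
    abel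
  have h4 : HasDerivAt (fun t : ℝ => squareOne p + t • ((2 : ℝ) • w) +
        t ^ 2 • (Matrix.of.symm (Matrix.of w * (Matrix.of w)ᴴ) : Square p)) ((2 : ℝ) • w) 0 := by
    have := (((hasDerivAt_id (0 : ℝ)).smul_const ((2 : ℝ) • w)).const_add (squareOne p)).add
      ((hasDerivAt_pow 2 (0 : ℝ)).smul_const
        (Matrix.of.symm (Matrix.of w * (Matrix.of w)ᴴ) : Square p))
    simp only [one_smul, Nat.cast_ofNat, Nat.reduceSub, pow_one, mul_zero, zero_smul,
      add_zero] at this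
    exact this
  rw [h3] at h2
  exact h4.unique h2

/-- A smooth local section of `s ↦ s s†` over the Hermitian matrices near `1`. -/
theorem exists_local_section (p : ℕ) : ∃ σ : Square p → Square p,
    ContDiffAt ℝ ∞ σ (squareOne p) ∧ σ (squareOne p) = squareOne p ∧
    ∀ᶠ m in 𝓝 (squareOne p), (Matrix.of m).IsHermitian →
      Matrix.of (σ m) * (Matrix.of (σ m))ᴴ = Matrix.of m := by
  have h := contDiffAt_gramMap (squareOne p)
  have hn : (∞ : WithTop ℕ∞) ≠ 0 := by simp
  refine ⟨h.localInverse hasFDerivAt_gramMap hn, ?_, ?_, ?_⟩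
  · simpa only [gramMap_one] using h.to_localInverse hasFDerivAt_gramMap hn
  · simpa only [gramMap_one] using h.localInverse_apply_image hasFDerivAt_gramMap hn
  · have hr := (h.hasStrictFDerivAt' hasFDerivAt_gramMap hn).eventually_right_inverse
    rw [gramMap_one] at hr
    filter_upwards [hr] with m hm hH
    set s : Matrix (Fin p) (Fin p) ℂ := Matrix.of (h.localInverse hasFDerivAt_gramMap hn m)
    have h1 : s * sᴴ + (s - sᴴ) = Matrix.of m := congrArg Matrix.of hm
    have h2 : s * sᴴ + (sᴴ - s) = Matrix.of m := by
      have h2 := congrArg Matrix.conjTranspose h1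
      rw [hH.eq, Matrix.conjTranspose_add, Matrix.conjTranspose_sub, Matrix.conjTranspose_mul,
        Matrix.conjTranspose_conjTranspose] at h2
      exact h2
    have h3 : s - sᴴ = 0 := by
      have h4 : s - sᴴ = sᴴ - s := add_left_cancel (h1.trans h2.symm)
      have h5 : (2 : ℂ) • (s - sᴴ) = 0 := by
        rw [two_smul]
        nth_rewrite 2 [h4]
        abel
      exact (smul_eq_zero.mp h5).resolve_left two_ne_zero
    rw [h3, add_zero] at h1
    exact h1

/-- The Hermitian part of a square matrix. -/
def hermPart (y : Square p) : Matrix (Fin p) (Fin p) ℂ :=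
  (1 / 2 : ℂ) • (Matrix.of y + (Matrix.of y)ᴴ)

theorem isHermitian_hermPart (y : Square p) : (hermPart y).IsHermitian := by
  rw [Matrix.IsHermitian, hermPart, Matrix.conjTranspose_smul, Matrix.conjTranspose_add,
    Matrix.conjTranspose_conjTranspose, add_comm]
  simp

theorem hermPart_of_isHermitian {y : Matrix (Fin p) (Fin p) ℂ} (h : y.IsHermitian) :
    hermPart (Matrix.of.symm y) = y := by
  rw [hermPart, Equiv.apply_symm_apply, h.eq, ← two_smul ℂ, smul_smul]
  norm_num

theorem smoothEntries_hermPart (y : Square p) : SmoothEntries (hermPart (p := p)) y := fun i j =>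
  contDiffAt_const.mul ((smoothEntries_square y i j).add
    ((smoothEntries_square y).conjTranspose i j))

open Classical in
/-- The function `(z, y) ↦ F (z c)`, where `c c†` is the Hermitian part of `y`. For a
`U(p)`-invariant function `F` the choice of `c` does not matter. The second argument is an
arbitrary square matrix, rather than a Hermitian one, in order to have a vector space of
matrices with coordinates. -/
def fibreExt (F : Frame p q → ℂ) (x : Coord p q × Square p) : ℂ :=
  if h : ∃ c : GL (Fin p) ℂ, c.1 * c.1ᴴ = hermPart x.2 then
    extend F (mulRightCLM h.choose.1 x.1) else 0

/-- Two factors of the same positive definite matrix differ by a unitary matrix on the right. -/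
theorem exists_unitary_of_mul_conjTranspose_eq {c d : GL (Fin p) ℂ}
    (h : c.1 * c.1ᴴ = d.1 * d.1ᴴ) :
    ∃ U : Matrix.unitaryGroup (Fin p) ℂ, d = c * Unitary.toUnits U := by
  have h1 : (c⁻¹).1 * c.1 = 1 := c.inv_mul
  have h2 : c.1ᴴ * ((c⁻¹).1)ᴴ = 1 := by
    rw [← Matrix.conjTranspose_mul, h1, Matrix.conjTranspose_one]
  have h3 : ((c⁻¹).1 * d.1) * star ((c⁻¹).1 * d.1) = 1 := by
    rw [Matrix.star_eq_conjTranspose, Matrix.conjTranspose_mul]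
    calc (c⁻¹).1 * d.1 * (d.1ᴴ * ((c⁻¹).1)ᴴ) = (c⁻¹).1 * (d.1 * d.1ᴴ) * ((c⁻¹).1)ᴴ := by
          simp only [Matrix.mul_assoc]
      _ = ((c⁻¹).1 * c.1) * (c.1ᴴ * ((c⁻¹).1)ᴴ) := by
          rw [← h]
          simp only [Matrix.mul_assoc]
      _ = 1 := by rw [h1, h2, Matrix.one_mul]
  refine ⟨⟨(c⁻¹).1 * d.1, Matrix.mem_unitaryGroup_iff.mpr h3⟩, Units.ext ?_⟩
  change d.1 = c.1 * ((c⁻¹).1 * d.1)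
  rw [← Matrix.mul_assoc, c.mul_inv, Matrix.one_mul]

theorem Frame.mul_mul (z : Frame p q) (g h : GL (Fin p) ℂ) : z.mul (g * h) = (z.mul g).mul h :=
  Subtype.ext (Matrix.mul_assoc z.1 g.1 h.1).symm

theorem fibreExt_apply {F : smoothFrame p q} (hF : F ∈ invariantFn p q) (z : Frame p q)
    {c : GL (Fin p) ℂ} {y : Square p} (h : c.1 * c.1ᴴ = hermPart y) :
    fibreExt F.1 (z.coord, y) = F.1 (z.mul c) := by
  have hex : ∃ c : GL (Fin p) ℂ, c.1 * c.1ᴴ = hermPart y := ⟨c, h⟩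
  rw [fibreExt, dif_pos hex]
  obtain ⟨U, hU⟩ := exists_unitary_of_mul_conjTranspose_eq (h.trans hex.choose_spec.symm)
  change extend F.1 (z.mul hex.choose).coord = _
  rw [extend_coord, hU, Frame.mul_mul]
  exact hF _ U

/-- Near `y = c c†` a factor of `y'` is `c σ(c⁻¹ y' c†⁻¹)`, where `σ` is the smooth local section of
`s ↦ s s†` near `1`. -/
theorem contDiffAt_fibreExt {F : smoothFrame p q} (hF : F ∈ invariantFn p q) (z : Frame p q)
    {c : GL (Fin p) ℂ} {y : Square p} (h : c.1 * c.1ᴴ = hermPart y) :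
    ContDiffAt ℝ ∞ (fibreExt F.1) (z.coord, y) := by
  obtain ⟨σ, hσ, hσ1, hsec⟩ := exists_local_section p
  obtain ⟨d, hdc, hcd⟩ : ∃ d : Matrix (Fin p) (Fin p) ℂ, d * c.1 = 1 ∧ c.1 * d = 1 :=
    ⟨(c⁻¹).1, c.inv_mul, c.mul_inv⟩
  have hcd' : c.1ᴴ * dᴴ = 1 := by
    rw [← Matrix.conjTranspose_mul, hdc, Matrix.conjTranspose_one]
  have hdc' : dᴴ * c.1ᴴ = 1 := by
    rw [← Matrix.conjTranspose_mul, hcd, Matrix.conjTranspose_one]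
  obtain ⟨m, hmd⟩ : ∃ m : Square p → Square p, m = fun y =>
      Matrix.of.symm (d * hermPart y * dᴴ) := ⟨_, rfl⟩
  have hmd' : ∀ y, Matrix.of (m y) = d * hermPart y * dᴴ := fun y => by
    rw [hmd, Equiv.apply_symm_apply]
  have hm : ContDiffAt ℝ ∞ m y := by
    rw [hmd]
    exact (((SmoothEntries.const d y).mul (smoothEntries_hermPart y)).mul
      (SmoothEntries.const dᴴ y)).contDiffAt
  have hmy : m y = squareOne p := by
    change m y = Matrix.of.symm 1
    rw [← Matrix.of.symm_apply_apply (m y), hmd', ← h, ← Matrix.mul_assoc d, hdc,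
      Matrix.one_mul, hcd']
  rw [← hmy] at hσ hsec
  replace hσ1 : σ (m y) = squareOne p := by rw [hmy, hσ1]
  have hσm : SmoothEntries (fun y => Matrix.of (σ (m y))) y :=
    (smoothEntries_square (σ (m y))).comp (g := fun y => σ (m y)) (hσ.comp y hm)
  have hdet : ∀ᶠ y' in 𝓝 y, (Matrix.of (σ (m y'))).det ≠ 0 := by
    refine hσm.det.continuousAt.eventually_ne ?_
    rw [hσ1, squareOne, Equiv.apply_symm_apply, Matrix.det_one]
    exact one_ne_zero
  have hfst : ContDiffAt ℝ ∞ (fun x : Coord p q × Square p => x.1) (z.coord, y) := contDiffAt_fst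
  have hsnd : ContDiffAt ℝ ∞ (fun x : Coord p q × Square p => x.2) (z.coord, y) := contDiffAt_snd
  have hτ : ContDiffAt ℝ ∞ (fun x : Coord p q × Square p => (Matrix.of.symm (Matrix.of x.1 *
      (c.1 * Matrix.of (σ (m x.2)))) : Coord p q)) (z.coord, y) := by
    have t1 : SmoothEntries (fun x : Coord p q × Square p => Matrix.of x.1) (z.coord, y) :=
      SmoothEntries.comp (f := fun v : Coord p q => Matrix.of v) (g := Prod.fst)
        (smoothEntries_of z.coord) hfst
    have t2 : SmoothEntries (fun x : Coord p q × Square p => Matrix.of (σ (m x.2)))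
        (z.coord, y) :=
      SmoothEntries.comp (f := fun y : Square p => Matrix.of (σ (m y))) (g := Prod.snd) hσm hsnd
    have t3 : SmoothEntries (fun _ : Coord p q × Square p => c.1) (z.coord, y) :=
      SmoothEntries.const c.1 _
    exact (t1.mul (t3.mul t2)).contDiffAt
  have hτy : (Matrix.of.symm (Matrix.of z.coord * (c.1 * Matrix.of (σ (m y)))) : Coord p q) =
      (z.mul c).coord := by
    rw [hσ1, squareOne, Equiv.apply_symm_apply, Matrix.mul_one]
    rfl
  have hcomp := ContDiffAt.comp (z.coord, y) (g := extend F.1) (by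
    rw [hτy]
    exact contDiffAt_extend F _) hτ
  refine hcomp.congr_of_eventuallyEq ?_
  have h1 : ∀ᶠ x : Coord p q × Square p in 𝓝 (z.coord, y), x.1 ∈ fullRankCoord p q :=
    hfst.continuousAt.eventually ((isOpen_fullRankCoord p q).mem_nhds z.2)
  have h2 := hsnd.continuousAt.eventually hdet
  have h3 := hsnd.continuousAt.eventually (hm.continuousAt.eventually hsec)
  filter_upwards [h1, h2, h3] with x hx1 hx2 hx3
  have hH : (Matrix.of (m x.2)).IsHermitian := by
    rw [hmd']
    exact Matrix.isHermitian_mul_mul_conjTranspose _ (isHermitian_hermPart x.2)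
  obtain ⟨s, hs⟩ : IsUnit (Matrix.of (σ (m x.2))) :=
    (Matrix.isUnit_iff_isUnit_det _).mpr (isUnit_iff_ne_zero.mpr hx2)
  have hx4 : (c * s).1 * ((c * s).1)ᴴ = hermPart x.2 := by
    change c.1 * s.1 * (c.1 * s.1)ᴴ = _
    have h5 : s.1 * s.1ᴴ = d * hermPart x.2 * dᴴ := by
      rw [hs, hx3 hH, hmd']
    calc c.1 * s.1 * (c.1 * s.1)ᴴ = c.1 * (s.1 * s.1ᴴ) * c.1ᴴ := by
          rw [Matrix.conjTranspose_mul]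
          simp only [Matrix.mul_assoc]
      _ = (c.1 * d) * hermPart x.2 * (dᴴ * c.1ᴴ) := by
          rw [h5]
          simp only [Matrix.mul_assoc]
      _ = hermPart x.2 := by rw [hcd, hdc', Matrix.one_mul, Matrix.mul_one]
  obtain ⟨w, hw⟩ : ∃ w : Frame p q, w.coord = x.1 := ⟨⟨Matrix.of x.1, hx1⟩, rfl⟩
  have h6 := fibreExt_apply hF w hx4
  rw [hw, Prod.mk.eta] at h6
  rw [h6, ← extend_coord F.1 (w.mul (c * s))]
  change extend F.1 (Matrix.of.symm (Matrix.of w.coord * (c.1 * s.1))) = _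
  rw [hs, hw]
  rfl

theorem hermPart_conj (g : GL (Fin p) ℂ) (y : Square p) :
    hermPart (Matrix.of.symm (g.1 * Matrix.of y * g.1ᴴ)) = g.1 * hermPart y * g.1ᴴ := by
  rw [hermPart, hermPart, Equiv.apply_symm_apply, Matrix.mul_smul, Matrix.smul_mul, Matrix.mul_add,
    Matrix.add_mul, Matrix.conjTranspose_mul, Matrix.conjTranspose_mul,
    Matrix.conjTranspose_conjTranspose, Matrix.mul_assoc g.1 (Matrix.of y)ᴴ]

theorem exists_conj_iff (g : GL (Fin p) ℂ) {y : Square p} :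
    (∃ c : GL (Fin p) ℂ, c.1 * c.1ᴴ = hermPart (Matrix.of.symm (g.1 * Matrix.of y * g.1ᴴ))) ↔
      ∃ c : GL (Fin p) ℂ, c.1 * c.1ᴴ = hermPart y := by
  rw [hermPart_conj]
  constructor
  · rintro ⟨c, hc⟩
    refine ⟨g⁻¹ * c, ?_⟩
    have h1 : (g⁻¹).1 * g.1 = 1 := g.inv_mul
    have h2 : g.1ᴴ * ((g⁻¹).1)ᴴ = 1 := by
      rw [← Matrix.conjTranspose_mul, h1, Matrix.conjTranspose_one]
    calc (g⁻¹).1 * c.1 * ((g⁻¹).1 * c.1)ᴴ = (g⁻¹).1 * (c.1 * c.1ᴴ) * ((g⁻¹).1)ᴴ := by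
          rw [Matrix.conjTranspose_mul]
          simp only [Matrix.mul_assoc]
      _ = ((g⁻¹).1 * g.1) * hermPart y * (g.1ᴴ * ((g⁻¹).1)ᴴ) := by
          rw [hc]
          simp only [Matrix.mul_assoc]
      _ = hermPart y := by rw [h1, h2, Matrix.one_mul, Matrix.mul_one]
  · rintro ⟨c, hc⟩
    refine ⟨g * c, ?_⟩
    rw [← hc]
    change g.1 * c.1 * (g.1 * c.1)ᴴ = _
    rw [Matrix.conjTranspose_mul]
    simp only [Matrix.mul_assoc]

theorem fibreExt_mul {F : smoothFrame p q} (hF : F ∈ invariantFn p q) (z : Frame p q)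
    (g : GL (Fin p) ℂ) (y : Square p) : fibreExt F.1 ((z.mul g).coord, y) =
      fibreExt F.1 (z.coord, Matrix.of.symm (g.1 * Matrix.of y * g.1ᴴ)) := by
  by_cases h : ∃ c : GL (Fin p) ℂ, c.1 * c.1ᴴ = hermPart y
  · obtain ⟨c, hc⟩ := h
    have hc' : (g * c).1 * ((g * c).1)ᴴ =
        hermPart (Matrix.of.symm (g.1 * Matrix.of y * g.1ᴴ)) := by
      rw [hermPart_conj, ← hc]
      change g.1 * c.1 * (g.1 * c.1)ᴴ = _
      rw [Matrix.conjTranspose_mul]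
      simp only [Matrix.mul_assoc]
    rw [fibreExt_apply hF _ hc, fibreExt_apply hF _ hc', Frame.mul_mul]
  · rw [fibreExt, dif_neg h, fibreExt, dif_neg (mt (exists_conj_iff g).mp h)]

end Fibre

/-! ### The classical decomposition of invariant functions -/

section Decomposition

open scoped Topology ComplexOrder

variable {p q : ℕ}

/-- The path `t + (1 - t) μ x⁻¹` from `μ x⁻¹` to `1` in the positive definite matrices, where
`x = z† z`. -/
def fibrePath (μ : ℝ) (v : Coord p q) (t : ℝ) : Square p :=
  Matrix.of.symm ((t : ℂ) • (1 : Matrix (Fin p) (Fin p) ℂ) +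
    ((1 - t) * μ : ℂ) • ((Matrix.of v)ᴴ * Matrix.of v)⁻¹)

theorem smoothEntries_gram_inv {v : Coord p q} (hv : v ∈ fullRankCoord p q) :
    SmoothEntries (fun v : Coord p q => ((Matrix.of v)ᴴ * Matrix.of v)⁻¹) v :=
  ((smoothEntries_of v).conjTranspose.mul (smoothEntries_of v)).inv (mem_fullRank_iff_det.mp hv)

theorem contDiffAt_fibrePath (μ : ℝ) {v : Coord p q} (hv : v ∈ fullRankCoord p q) (t : ℝ) :
    ContDiffAt ℝ ∞ (fun x : Coord p q × ℝ => fibrePath μ x.1 x.2) (v, t) := by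
  have h1 : SmoothEntries (fun x : Coord p q × ℝ => ((Matrix.of x.1)ᴴ * Matrix.of x.1)⁻¹) (v, t) :=
    SmoothEntries.comp (f := fun v : Coord p q => ((Matrix.of v)ᴴ * Matrix.of v)⁻¹) (g := Prod.fst)
      (smoothEntries_gram_inv hv) contDiffAt_fst
  have h2 : ContDiffAt ℝ ∞ (fun x : Coord p q × ℝ => (x.2 : ℂ)) (v, t) :=
    Complex.ofRealCLM.contDiff.contDiffAt.comp (v, t) contDiffAt_snd
  refine contDiffAt_pi.mpr fun i => contDiffAt_pi.mpr fun j => ?_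
  exact (h2.mul contDiffAt_const).add
    (((contDiffAt_const.sub h2).mul contDiffAt_const).mul (h1 i j))

theorem posDef_fibrePath {μ : ℝ} (hμ : 0 < μ) (z : Frame p q) {t : ℝ}
    (ht : t ∈ Set.Icc (0 : ℝ) 1) : (Matrix.of (fibrePath μ z.coord t)).PosDef := by
  have hx : (z.1ᴴ * z.1)⁻¹.PosDef := (posDef_gram z).inv
  change ((t : ℂ) • (1 : Matrix (Fin p) (Fin p) ℂ) +
    ((1 - t) * μ : ℂ) • (z.1ᴴ * z.1)⁻¹).PosDef
  rcases eq_or_lt_of_le ht.1 with rfl | h0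
  · simpa using hx.smul (Complex.zero_lt_real.mpr hμ)
  · refine (Matrix.PosDef.one.smul (Complex.zero_lt_real.mpr h0)).add_posSemidef ?_
    refine hx.posSemidef.smul ?_
    have : ((1 - t) * μ : ℂ) = (((1 - t) * μ : ℝ) : ℂ) := by push_cast; rfl
    rw [this]
    exact Complex.zero_le_real.mpr (mul_nonneg (by linarith [ht.2]) hμ.le)

theorem exists_mul_eq_fibrePath {μ : ℝ} (hμ : 0 < μ) (z : Frame p q) {t : ℝ}
    (ht : t ∈ Set.Icc (0 : ℝ) 1) :
    ∃ c : GL (Fin p) ℂ, c.1 * c.1ᴴ = hermPart (fibrePath μ z.coord t) := by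
  have h := posDef_fibrePath hμ z ht
  obtain ⟨B, hB⟩ := exists_factor_of_posDef h
  have hu : IsUnit B.1ᴴ := by
    rw [Matrix.isUnit_iff_isUnit_det, Matrix.det_conjTranspose]
    exact ((Matrix.isUnit_iff_isUnit_det _).mp B.isUnit).star
  obtain ⟨c, hc⟩ := hu
  refine ⟨c, ?_⟩
  rw [hc, Matrix.conjTranspose_conjTranspose, ← hB]
  exact (hermPart_of_isHermitian h.1).symm

theorem contDiffAt_fibreExt_path {μ : ℝ} (hμ : 0 < μ) {F : smoothFrame p q}
    (hF : F ∈ invariantFn p q) (z : Frame p q) {t : ℝ} (ht : t ∈ Set.Icc (0 : ℝ) 1) :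
    ContDiffAt ℝ ∞ (fibreExt F.1) (z.coord, fibrePath μ z.coord t) := by
  obtain ⟨c, hc⟩ := exists_mul_eq_fibrePath hμ z ht
  exact contDiffAt_fibreExt hF z hc

/-- The inverse of the Gram matrix transforms like the argument of `fibreExt`. -/
theorem mul_gram_inv_mul (z : Frame p q) (g : GL (Fin p) ℂ) :
    g.1 * ((z.mul g).1ᴴ * (z.mul g).1)⁻¹ * g.1ᴴ = (z.1ᴴ * z.1)⁻¹ := by
  have hg : IsUnit g.1.det := (Matrix.isUnit_iff_isUnit_det _).mp g.isUnit
  have hg' : IsUnit (g.1ᴴ).det := by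
    rw [Matrix.det_conjTranspose]
    exact hg.star
  have h : (z.mul g).1ᴴ * (z.mul g).1 = g.1ᴴ * (z.1ᴴ * z.1) * g.1 := by
    change (z.1 * g.1)ᴴ * (z.1 * g.1) = _
    rw [Matrix.conjTranspose_mul]
    simp only [Matrix.mul_assoc]
  rw [h, Matrix.mul_inv_rev, Matrix.mul_inv_rev, ← Matrix.mul_assoc, Matrix.mul_nonsing_inv _ hg,
    Matrix.one_mul, Matrix.mul_assoc, Matrix.nonsing_inv_mul _ hg', Matrix.mul_one]

theorem unitary_mul_fibrePath_mul (μ : ℝ) (z : Frame p q) (U : Matrix.unitaryGroup (Fin p) ℂ)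
    (t : ℝ) : Matrix.of.symm (U.1 * Matrix.of (fibrePath μ (z.mulU U).coord t) * U.1ᴴ) =
      fibrePath μ z.coord t := by
  refine congrArg Matrix.of.symm ?_
  change U.1 * ((t : ℂ) • (1 : Matrix (Fin p) (Fin p) ℂ) +
    ((1 - t) * μ : ℂ) • ((z.mulU U).1ᴴ * (z.mulU U).1)⁻¹) * U.1ᴴ =
    (t : ℂ) • (1 : Matrix (Fin p) (Fin p) ℂ) + ((1 - t) * μ : ℂ) • (z.1ᴴ * z.1)⁻¹
  rw [Matrix.mul_add, Matrix.add_mul, Matrix.mul_smul, Matrix.smul_mul, Matrix.mul_one,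
    Matrix.mul_smul, Matrix.smul_mul, ← mul_gram_inv_mul z (Unitary.toUnits U),
    ← Matrix.star_eq_conjTranspose, self_mul_star_unitary]
  rfl

/-- The complex linear functional `η ↦ ℓ(η) - i ℓ(i η)`. It agrees with `ℓ` on Hermitian
matrices if `ℓ` vanishes on antihermitian ones. -/
def complexify (l : Square p →L[ℝ] ℂ) : Matrix (Fin p) (Fin p) ℂ →ₗ[ℂ] ℂ where
  toFun η := l (Matrix.of.symm η) - Complex.I * l (Matrix.of.symm (Complex.I • η))
  map_add' η η' := by
    have h : (Matrix.of.symm (Complex.I • (η + η')) : Square p) =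
      Matrix.of.symm (Complex.I • η) + Matrix.of.symm (Complex.I • η') := by
        rw [smul_add]
        rfl
    have h' : (Matrix.of.symm (η + η') : Square p) = Matrix.of.symm η + Matrix.of.symm η' := rfl
    rw [h, h', map_add, map_add]
    ring
  map_smul' c η := by
    have h : (Matrix.of.symm (c • η) : Square p) =
        c.re • Matrix.of.symm η + c.im • Matrix.of.symm (Complex.I • η) := by
      funext i j
      change c * η i j = (c.re : ℂ) * η i j + (c.im : ℂ) * (Complex.I * η i j)
      conv_lhs => rw [← Complex.re_add_im c]
      ring
    have h' : (Matrix.of.symm (Complex.I • c • η) : Square p) =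
        c.re • Matrix.of.symm (Complex.I • η) - c.im • Matrix.of.symm η := by
      funext i j
      change Complex.I * (c * η i j) = (c.re : ℂ) * (Complex.I * η i j) - (c.im : ℂ) * η i j
      conv_lhs => rw [← Complex.re_add_im c]
      linear_combination (c.im : ℂ) * η i j * Complex.I_mul_I
    have hl : ∀ (r : ℝ) (w : Square p), l (r • w) = r * l w := fun r w => l.map_smul r w
    rw [h, h', map_add, map_sub, hl, hl, hl, hl]
    simp only [smul_eq_mul, RingHom.id_apply]
    conv_rhs => rw [← Complex.re_add_im c]
    linear_combination
      (c.im : ℂ) * l (Matrix.of.symm (Complex.I • η)) * Complex.I_mul_I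

theorem complexify_apply (l : Square p →L[ℝ] ℂ) (η : Matrix (Fin p) (Fin p) ℂ) :
    complexify l η = l (Matrix.of.symm η) - Complex.I * l (Matrix.of.symm (Complex.I • η)) := rfl

/-- The derivative of `fibreExt F` in its second argument. -/
def fibreDeriv (F : Frame p q → ℂ) (x : Coord p q × Square p) : Square p →L[ℝ] ℂ :=
  (fderiv ℝ (fibreExt F) x).comp (ContinuousLinearMap.inr ℝ (Coord p q) (Square p))

theorem hasDerivAt_fibreExt {F : Frame p q → ℂ} {v : Coord p q} {y : Square p}
    (h : DifferentiableAt ℝ (fibreExt F) (v, y)) (η : Square p) :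
    HasDerivAt (fun s : ℝ => fibreExt F (v, y + s • η)) (fibreDeriv F (v, y) η) 0 := by
  have h1 : HasDerivAt (fun s : ℝ => y + s • η) η 0 := by
    simpa using ((hasDerivAt_id (0 : ℝ)).smul_const η).const_add y
  have h2 : HasDerivAt (fun s : ℝ => (v, y + s • η)) ((0 : Coord p q), η) 0 :=
    (hasDerivAt_const (0 : ℝ) v).prodMk h1
  have h3 : HasFDerivAt (fibreExt F) (fderiv ℝ (fibreExt F) (v, y)) (v, y + (0 : ℝ) • η) := by
    rw [zero_smul, add_zero]
    exact h.hasFDerivAt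
  exact h3.comp_hasDerivAt 0 h2

theorem fibreExt_congr (F : Frame p q → ℂ) (v : Coord p q) {y y' : Square p}
    (h : hermPart y = hermPart y') : fibreExt F (v, y) = fibreExt F (v, y') := by
  classical
  have key : ∀ m m' : Matrix (Fin p) (Fin p) ℂ, m = m' →
      (if h : ∃ c : GL (Fin p) ℂ, c.1 * c.1ᴴ = m then
        extend F (mulRightCLM h.choose.1 v) else 0) =
      if h : ∃ c : GL (Fin p) ℂ, c.1 * c.1ᴴ = m' then
        extend F (mulRightCLM h.choose.1 v) else 0 := by
    rintro m _ rfl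
    rfl
  unfold fibreExt
  convert key _ _ h

/-- The derivative of `fibreExt F` vanishes on skew-Hermitian matrices, because `fibreExt F` depends
only on the Hermitian part of its argument. -/
theorem complexify_fibreDeriv {F : Frame p q → ℂ} {v : Coord p q} {y : Square p}
    (h : DifferentiableAt ℝ (fibreExt F) (v, y)) {η : Matrix (Fin p) (Fin p) ℂ}
    (hη : η.IsHermitian) :
    complexify (fibreDeriv F (v, y)) η = fibreDeriv F (v, y) (Matrix.of.symm η) := by
  have h1 := hasDerivAt_fibreExt h (Matrix.of.symm (Complex.I • η))
  have h2 : (fun s : ℝ => fibreExt F (v, y + s • Matrix.of.symm (Complex.I • η))) =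
      fun _ => fibreExt F (v, y) := by
    funext s
    have h3 : hermPart (y + s • Matrix.of.symm (Complex.I • η)) = hermPart y := by
      refine congrArg (fun m => (1 / 2 : ℂ) • m) ?_
      change (Matrix.of y + s • (Complex.I • η)) + (Matrix.of y + s • (Complex.I • η))ᴴ = _
      rw [Matrix.conjTranspose_add, Matrix.conjTranspose_smul, Matrix.conjTranspose_smul, hη.eq,
        Complex.star_def, Complex.conj_I, star_trivial, neg_smul, smul_neg]
      abel
    exact fibreExt_congr F v h3
  rw [h2] at h1
  rw [complexify_apply, h1.unique (hasDerivAt_const _ _), mul_zero, sub_zero]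

theorem fibreDeriv_mulU {F : smoothFrame p q} (hF : F ∈ invariantFn p q) (z : Frame p q)
    (U : Matrix.unitaryGroup (Fin p) ℂ) {y : Square p}
    (h : DifferentiableAt ℝ (fibreExt F.1) ((z.mulU U).coord, y))
    (h' : DifferentiableAt ℝ (fibreExt F.1)
      (z.coord, Matrix.of.symm (U.1 * Matrix.of y * U.1ᴴ))) (η : Matrix (Fin p) (Fin p) ℂ) :
    fibreDeriv F.1 ((z.mulU U).coord, y) (Matrix.of.symm η) =
      fibreDeriv F.1 (z.coord, Matrix.of.symm (U.1 * Matrix.of y * U.1ᴴ))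
        (Matrix.of.symm (U.1 * η * U.1ᴴ)) := by
  have h1 := hasDerivAt_fibreExt h (Matrix.of.symm η)
  have h2 := hasDerivAt_fibreExt h' (Matrix.of.symm (U.1 * η * U.1ᴴ))
  suffices he : (fun s : ℝ => fibreExt F.1 ((z.mulU U).coord, y + s • Matrix.of.symm η)) =
      fun s : ℝ => fibreExt F.1 (z.coord, Matrix.of.symm (U.1 * Matrix.of y * U.1ᴴ) +
        s • Matrix.of.symm (U.1 * η * U.1ᴴ)) by
    rw [he] at h1
    exact h1.unique h2
  funext s
  refine (fibreExt_mul hF z (Unitary.toUnits U) _).trans (congrArg (fun y => fibreExt F.1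
    (z.coord, y)) (congrArg Matrix.of.symm ?_))
  change U.1 * (Matrix.of y + s • η) * U.1ᴴ = U.1 * Matrix.of y * U.1ᴴ + s • (U.1 * η * U.1ᴴ)
  rw [Matrix.mul_add, Matrix.add_mul, Matrix.mul_smul, Matrix.smul_mul]

theorem contDiffAt_complexify_fibreDeriv {μ : ℝ} (hμ : 0 < μ) {F : smoothFrame p q}
    (hF : F ∈ invariantFn p q) (η : Matrix (Fin p) (Fin p) ℂ) {v : Coord p q}
    (hv : v ∈ fullRankCoord p q) {t : ℝ} (ht : t ∈ Set.Icc (0 : ℝ) 1) :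
    ContDiffAt ℝ ∞ (fun x : Coord p q × ℝ =>
      complexify (fibreDeriv F.1 (x.1, fibrePath μ x.1 x.2)) η) (v, t) := by
  have h1 : ContDiffAt ℝ ∞ (fun x : Coord p q × ℝ => (x.1, fibrePath μ x.1 x.2)) (v, t) :=
    contDiffAt_fst.prodMk (contDiffAt_fibrePath μ hv t)
  have h2 := (contDiffAt_fibreExt_path hμ hF ⟨Matrix.of v, hv⟩ ht).fderiv_right (m := ∞) (by simp)
  have h3 : ContDiffAt ℝ ∞ (fun x : Coord p q × ℝ =>
      fderiv ℝ (fibreExt F.1) (x.1, fibrePath μ x.1 x.2)) (v, t) :=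
    ContDiffAt.comp (v, t) (g := fderiv ℝ (fibreExt F.1)) h2 h1
  exact (h3.clm_apply contDiffAt_const).sub (contDiffAt_const.mul (h3.clm_apply contDiffAt_const))

theorem continuousOn_complexify_fibreDeriv {μ : ℝ} (hμ : 0 < μ) {F : smoothFrame p q}
    (hF : F ∈ invariantFn p q) (η : Matrix (Fin p) (Fin p) ℂ) (z : Frame p q) :
    ContinuousOn (fun t : ℝ => complexify (fibreDeriv F.1 (z.coord, fibrePath μ z.coord t)) η)
      (Set.uIcc 0 1) :=
  continuousOn_slice (f := fun x : Coord p q × ℝ =>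
      complexify (fibreDeriv F.1 (x.1, fibrePath μ x.1 x.2)) η) fun _ ht =>
    (contDiffAt_complexify_fibreDeriv hμ hF η z.2 ht).continuousAt

/-- The mean over the path `fibrePath` of the derivative of `fibreExt F` in its second argument,
as a complex linear functional on matrices. -/
def fibreMean {μ : ℝ} (hμ : 0 < μ) {F : smoothFrame p q} (hF : F ∈ invariantFn p q)
    (z : Frame p q) : Matrix (Fin p) (Fin p) ℂ →ₗ[ℂ] ℂ where
  toFun η := ∫ t in (0 : ℝ)..1, complexify (fibreDeriv F.1 (z.coord, fibrePath μ z.coord t)) η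
  map_add' η η' := by
    simp only [map_add]
    exact intervalIntegral.integral_add
      (continuousOn_complexify_fibreDeriv hμ hF η z).intervalIntegrable
      (continuousOn_complexify_fibreDeriv hμ hF η' z).intervalIntegrable
  map_smul' c η := by
    simp only [map_smul]
    exact intervalIntegral.integral_smul c _

theorem fibreMean_mulU {μ : ℝ} (hμ : 0 < μ) {F : smoothFrame p q} (hF : F ∈ invariantFn p q)
    (z : Frame p q) (U : Matrix.unitaryGroup (Fin p) ℂ) (η : Matrix (Fin p) (Fin p) ℂ) :
    fibreMean hμ hF (z.mulU U) η = fibreMean hμ hF z (U.1 * η * U.1ᴴ) := by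
  refine intervalIntegral.integral_congr fun t ht => ?_
  rw [Set.uIcc_of_le zero_le_one] at ht
  have h1 := (contDiffAt_fibreExt_path hμ hF (z.mulU U) ht).differentiableAt (by simp)
  have h2 := (contDiffAt_fibreExt_path hμ hF z ht).differentiableAt (by simp)
  have h3 := unitary_mul_fibrePath_mul μ z U t
  rw [← h3] at h2
  change complexify _ _ = complexify _ _
  rw [complexify_apply, complexify_apply, fibreDeriv_mulU hF z U h1 h2,
    fibreDeriv_mulU hF z U h1 h2, h3, Matrix.mul_smul, Matrix.smul_mul]

/-- The value of an invariant function minus its value where the fibre meets `x = μ` is a mean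
of derivatives along the fibre. -/
theorem fibreMean_sub {μ : ℝ} (hμ : 0 < μ) {F : smoothFrame p q} (hF : F ∈ invariantFn p q)
    (z : Frame p q) : fibreMean hμ hF z (1 - (μ : ℂ) • (z.1ᴴ * z.1)⁻¹) =
      F.1 z - fibreExt F.1 (z.coord, fibrePath μ z.coord 0) := by
  have hx : (z.1ᴴ * z.1)⁻¹.IsHermitian := (posDef_gram z).inv.1
  have hη : (1 - (μ : ℂ) • (z.1ᴴ * z.1)⁻¹).IsHermitian := by
    refine Matrix.isHermitian_one.sub ?_
    rw [Matrix.IsHermitian, Matrix.conjTranspose_smul, hx.eq, Complex.star_def, Complex.conj_ofReal]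
  have h1 : fibreExt F.1 (z.coord, fibrePath μ z.coord 1) = F.1 z := by
    have h : (1 : GL (Fin p) ℂ).1 * (1 : GL (Fin p) ℂ).1ᴴ =
        hermPart (fibrePath μ z.coord 1) := by
      have h0 : fibrePath μ z.coord 1 = Matrix.of.symm 1 := by
        simp [fibrePath]
      rw [h0, hermPart_of_isHermitian Matrix.isHermitian_one, Units.val_one,
        Matrix.conjTranspose_one, Matrix.one_mul]
    rw [fibreExt_apply hF z h]
    exact congrArg F.1 (Subtype.ext (Matrix.mul_one z.1))
  rw [← h1]
  have hd : ∀ t ∈ Set.uIcc (0 : ℝ) 1, HasDerivAt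
      (fun t => fibreExt F.1 (z.coord, fibrePath μ z.coord t))
      (complexify (fibreDeriv F.1 (z.coord, fibrePath μ z.coord t))
        (1 - (μ : ℂ) • (z.1ᴴ * z.1)⁻¹)) t := by
    intro t ht
    rw [Set.uIcc_of_le zero_le_one] at ht
    have h2 := (contDiffAt_fibreExt_path hμ hF z ht).differentiableAt (by simp)
    rw [complexify_fibreDeriv h2 hη]
    have h3 := hasDerivAt_fibreExt h2 (Matrix.of.symm (1 - (μ : ℂ) • (z.1ᴴ * z.1)⁻¹))
    have h4 : HasDerivAt (fun s : ℝ => s - t) 1 t := (hasDerivAt_id t).sub_const t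
    rw [← sub_self t] at h3
    have h5 := HasDerivAt.scomp (h := fun s => s - t) t h3 h4
    rw [one_smul] at h5
    refine h5.congr_of_eventuallyEq (Filter.Eventually.of_forall fun s => ?_)
    refine congrArg (fun y => fibreExt F.1 (z.coord, y)) (congrArg Matrix.of.symm ?_)
    change (s : ℂ) • (1 : Matrix (Fin p) (Fin p) ℂ) + ((1 - s) * μ : ℂ) • (z.1ᴴ * z.1)⁻¹ =
      ((t : ℂ) • (1 : Matrix (Fin p) (Fin p) ℂ) + ((1 - t) * μ : ℂ) • (z.1ᴴ * z.1)⁻¹) +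
        ((s - t : ℝ) : ℂ) • (1 - (μ : ℂ) • (z.1ᴴ * z.1)⁻¹)
    rw [smul_sub, smul_smul]
    push_cast
    module
  exact intervalIntegral.integral_eq_sub_of_hasDerivAt hd
    (continuousOn_complexify_fibreDeriv hμ hF _ z).intervalIntegrable

/-- The value of an invariant function where the fibre meets `x = μ`. -/
def fibreValue {μ : ℝ} (hμ : 0 < μ) {F : smoothFrame p q} (hF : F ∈ invariantFn p q) :
    smoothFrame p q :=
  smoothOf (fun v => fibreExt F.1 (v, fibrePath μ v 0)) fun v hv => by
    have h0 : (0 : ℝ) ∈ Set.Icc (0 : ℝ) 1 := by simp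
    have h1 := contDiffAt_fibreExt_path hμ hF ⟨Matrix.of v, hv⟩ h0
    have h2 : ContDiffAt ℝ ∞ (fun v : Coord p q => fibrePath μ v 0) v :=
      ContDiffAt.comp (g := fun x : Coord p q × ℝ => fibrePath μ x.1 x.2)
        (f := fun v : Coord p q => (v, (0 : ℝ))) v (contDiffAt_fibrePath μ hv 0)
        (contDiffAt_id.prodMk contDiffAt_const)
    exact (ContDiffAt.comp (g := fibreExt F.1) (f := fun v : Coord p q => (v, fibrePath μ v 0)) v
      h1 (contDiffAt_id.prodMk h2)).contDiffWithinAt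

theorem fibreValue_mem_homogeneousFn {μ : ℝ} (hμ : 0 < μ) {F : smoothFrame p q}
    (hF : F ∈ invariantFn p q) : fibreValue hμ hF ∈ homogeneousFn p q := by
  intro z g
  refine (fibreExt_mul hF z g _).trans ?_
  refine congrArg (fun y => fibreExt F.1 (z.coord, y)) (congrArg Matrix.of.symm ?_)
  change g.1 * (((0 : ℝ) : ℂ) • (1 : Matrix (Fin p) (Fin p) ℂ) +
    ((1 - ((0 : ℝ) : ℂ)) * μ : ℂ) • ((z.mul g).1ᴴ * (z.mul g).1)⁻¹) * g.1ᴴ =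
    ((0 : ℝ) : ℂ) • (1 : Matrix (Fin p) (Fin p) ℂ) +
      ((1 - ((0 : ℝ) : ℂ)) * μ : ℂ) • (z.1ᴴ * z.1)⁻¹
  rw [Complex.ofReal_zero, zero_smul, zero_add, zero_add, Matrix.mul_smul,
    Matrix.smul_mul, mul_gram_inv_mul]

/-- The matrix valued function `K` with `tr (K (x - μ)) = F - fibreValue F`. -/
def fibreMatrix {μ : ℝ} (hμ : 0 < μ) {F : smoothFrame p q} (hF : F ∈ invariantFn p q) :
    Matrix (Fin p) (Fin p) (smoothFrame p q) := Matrix.of fun i j =>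
  ∑ k, smoothOf (fun v => ((Matrix.of v)ᴴ * Matrix.of v)⁻¹ i k)
      (fun _ hv => (smoothEntries_gram_inv hv i k).contDiffWithinAt) *
    smoothOf (fun v => ∫ t in (0 : ℝ)..1,
        complexify (fibreDeriv F.1 (v, fibrePath μ v t)) (Matrix.single j k 1))
      (contDiffOn_integral_param (isOpen_fullRankCoord p q)
        (f := fun x : Coord p q × ℝ =>
          complexify (fibreDeriv F.1 (x.1, fibrePath μ x.1 x.2)) (Matrix.single j k 1))
        fun _ hv _ ht => contDiffAt_complexify_fibreDeriv hμ hF _ hv ht)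

theorem fibreMatrix_apply {μ : ℝ} (hμ : 0 < μ) {F : smoothFrame p q} (hF : F ∈ invariantFn p q)
    (z : Frame p q) (i j : Fin p) : (fibreMatrix hμ hF i j).1 z =
      ∑ k, (z.1ᴴ * z.1)⁻¹ i k * fibreMean hμ hF z (Matrix.single j k 1) := by
  rw [fibreMatrix, Matrix.of_apply, coe_sum_apply]
  rfl

theorem linearMap_eq_sum_single (l : Matrix (Fin p) (Fin p) ℂ →ₗ[ℂ] ℂ)
    (η : Matrix (Fin p) (Fin p) ℂ) : l η = ∑ i, ∑ j, η i j * l (Matrix.single i j 1) := by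
  conv_lhs => rw [Matrix.matrix_eq_sum_single η]
  simp only [map_sum]
  refine Finset.sum_congr rfl fun i _ => Finset.sum_congr rfl fun j _ => ?_
  rw [← smul_eq_mul, ← map_smul, Matrix.smul_single, smul_eq_mul, mul_one]

theorem eq_fibreValue_add_traceMomentum {μ : ℝ} (hμ : 0 < μ) {F : smoothFrame p q}
    (hF : F ∈ invariantFn p q) : F = fibreValue hμ hF + traceMomentum μ (fibreMatrix hμ hF) := by
  refine smoothFrame_ext fun z => ?_
  have hx : (z.1ᴴ * z.1) * (z.1ᴴ * z.1)⁻¹ = 1 :=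
    Matrix.mul_nonsing_inv _ (isUnit_iff_ne_zero.mpr (mem_fullRank_iff_det.mp z.2))
  have h1 : (1 - (μ : ℂ) • (z.1ᴴ * z.1)⁻¹) =
      (z.1ᴴ * z.1 - (μ : ℂ) • (1 : Matrix (Fin p) (Fin p) ℂ)) * (z.1ᴴ * z.1)⁻¹ := by
    rw [Matrix.sub_mul, hx, Matrix.smul_mul, Matrix.one_mul]
  have h2 : (traceMomentum μ (fibreMatrix hμ hF)).1 z =
      fibreMean hμ hF z (1 - (μ : ℂ) • (z.1ᴴ * z.1)⁻¹) := by
    rw [h1, linearMap_eq_sum_single, traceMomentum, coe_sum_apply]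
    simp only [coe_sum_apply, coe_mul_apply, fibreMatrix_apply]
    rw [Finset.sum_comm]
    refine Finset.sum_congr rfl fun a _ => ?_
    simp only [Matrix.mul_apply (N := (z.1ᴴ * z.1)⁻¹), Finset.sum_mul]
    rw [Finset.sum_comm]
    refine Finset.sum_congr rfl fun j _ => Finset.sum_congr rfl fun b _ => ?_
    change _ * (z.1ᴴ * z.1 - (μ : ℂ) • (1 : Matrix (Fin p) (Fin p) ℂ)) a b = _
    ring
  rw [coe_add_apply, h2, fibreMean_sub]
  exact (add_sub_cancel _ _).symm

theorem equivariantFn_fibreMatrix {μ : ℝ} (hμ : 0 < μ) {F : smoothFrame p q}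
    (hF : F ∈ invariantFn p q) : EquivariantFn (fibreMatrix hμ hF) := by
  intro z U
  have key : ∀ w : Frame p q, (Matrix.of fun i j => (fibreMatrix hμ hF i j).1 w) =
      (w.1ᴴ * w.1)⁻¹ * (Matrix.of fun k j => fibreMean hμ hF w (Matrix.single j k 1)) := by
    intro w
    ext i j
    rw [Matrix.of_apply, fibreMatrix_apply, Matrix.mul_apply]
    rfl
  have hU : star U.1 * U.1 = 1 := star_mul_self_unitary U
  have h1 : ((z.mulU U).1ᴴ * (z.mulU U).1)⁻¹ = star U.1 * (z.1ᴴ * z.1)⁻¹ * U.1 := by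
    rw [← mul_gram_inv_mul z (Unitary.toUnits U)]
    change _ = star U.1 * (U.1 * _ * star U.1) * U.1
    rw [← Matrix.mul_assoc, ← Matrix.mul_assoc, hU, Matrix.one_mul, Matrix.mul_assoc, hU,
      Matrix.mul_one]
    rfl
  have h2 : (Matrix.of fun k j => fibreMean hμ hF (z.mulU U) (Matrix.single j k 1)) =
      star U.1 * (Matrix.of fun k j => fibreMean hμ hF z (Matrix.single j k 1)) * U.1 := by
    ext k j
    rw [Matrix.of_apply, fibreMean_mulU, linearMap_eq_sum_single, Matrix.mul_apply]
    refine Finset.sum_congr rfl fun a _ => ?_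
    rw [Matrix.mul_apply, Finset.sum_mul]
    refine Finset.sum_congr rfl fun b _ => ?_
    have h3 : (U.1 * (Matrix.single j k 1 : Matrix (Fin p) (Fin p) ℂ) * U.1ᴴ) a b =
        U.1 a j * star U.1 k b := by
      rw [Matrix.mul_apply, Finset.sum_eq_single k]
      · rw [Matrix.mul_single_apply_same, mul_one]
        rfl
      · intro l _ hl
        rw [Matrix.mul_single_apply_of_ne _ _ _ _ _ hl, zero_mul]
      · simp
    rw [h3, Matrix.of_apply]
    ring
  rw [key, key, h1, h2]
  simp only [Matrix.mul_assoc]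
  rw [← Matrix.mul_assoc U.1 (star U.1), self_mul_star_unitary, Matrix.one_mul]

/-- Every invariant function is the sum of a homogeneous function and a combination of the entries
of `x - μ` with equivariant coefficients. -/
theorem exists_homogeneousFn_add_traceMomentum {μ : ℝ} (hμ : 0 < μ) {F : smoothFrame p q}
    (hF : F ∈ invariantFn p q) : ∃ H ∈ homogeneousFn p q,
      ∃ K, EquivariantFn K ∧ F = H + traceMomentum μ K :=
  ⟨_, fibreValue_mem_homogeneousFn hμ hF, _, equivariantFn_fibreMatrix hμ hF,
    eq_fibreValue_add_traceMomentum hμ hF⟩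

end Decomposition

/-! ### The decomposition of formal series and the projection -/

section Projection

variable {p q : ℕ} {μ : ℝ}

/-- Solving for the coefficients of the decomposition order by order. -/
theorem exists_formalHom_sub_mem (hμ : 0 < μ) {F : (smoothFrame p q)⟦X⟧}
    (hF : F ∈ formalInv p q) : ∃ H ∈ formalHom p q, F - H ∈ momentumIdeal p q μ := by
  have key : ∀ f : invariantFn p q, ∃ d : smoothFrame p q ×
      {K : Matrix (Fin p) (Fin p) (smoothFrame p q) // EquivariantFn K},
      d.1 ∈ homogeneousFn p q ∧ f.1 = d.1 + traceMomentum μ d.2.1 := by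
    intro f
    obtain ⟨H, hH, K, hK, h⟩ := exists_homogeneousFn_add_traceMomentum hμ f.2
    exact ⟨(H, ⟨K, hK⟩), hH, h⟩
  choose D hD1 hD2 using key
  let s : ℕ → smoothFrame p q ×
      {K : Matrix (Fin p) (Fin p) (smoothFrame p q) // EquivariantFn K} :=
    Nat.rec (D ⟨PowerSeries.coeff 0 F, hF 0⟩) fun n d => D ⟨PowerSeries.coeff (n + 1) F -
      traceEuler d.2.1, Submodule.sub_mem _ (hF (n + 1)) (traceEuler_mem_invariantFn d.2.2)⟩
  have h0 : PowerSeries.coeff 0 F = (s 0).1 + traceMomentum μ (s 0).2.1 :=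
    hD2 ⟨PowerSeries.coeff 0 F, hF 0⟩
  have h1 : ∀ n, PowerSeries.coeff (n + 1) F - traceEuler (s n).2.1 =
      (s (n + 1)).1 + traceMomentum μ (s (n + 1)).2.1 := fun n => hD2 ⟨PowerSeries.coeff (n + 1) F -
      traceEuler (s n).2.1, Submodule.sub_mem _ (hF (n + 1)) (traceEuler_mem_invariantFn (s n).2.2)⟩
  refine ⟨PowerSeries.mk fun n => (s n).1, ?_, mem_momentumIdeal_iff.mpr
    ⟨fun n => (s n).2.1, fun n => (s n).2.2, ?_, fun n => ?_⟩⟩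
  · intro n
    rw [PowerSeries.coeff_mk]
    cases n with
    | zero => exact hD1 _
    | succ n => exact hD1 _
  · rw [map_sub, PowerSeries.coeff_mk, h0, add_sub_cancel_left]
  · rw [map_sub, PowerSeries.coeff_mk, eq_add_of_sub_eq (h1 n)]
    abel

theorem formalHom_sup_momentumIdeal (hμ : 0 < μ) :
    formalHom p q ⊔ momentumIdeal p q μ = formalInv p q := by
  refine le_antisymm (sup_le formalHom_le_formalInv (momentumIdeal_le_formalInv μ)) fun F hF => ?_
  obtain ⟨H, hH, hJ⟩ := exists_formalHom_sub_mem hμ hF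
  exact Submodule.mem_sup.mpr ⟨H, hH, _, hJ, add_sub_cancel _ _⟩

theorem eq_of_sub_mem_momentumIdeal (hμ : 0 < μ) {H H' : (smoothFrame p q)⟦X⟧}
    (hH : H ∈ formalHom p q) (hH' : H' ∈ formalHom p q) (h : H - H' ∈ momentumIdeal p q μ) :
    H = H' :=
  sub_eq_zero.mp (Submodule.disjoint_def.mp (disjoint_formalHom_momentumIdeal hμ) _
    (Submodule.sub_mem _ hH hH') h)

/-- The projection of the invariant series onto the homogeneous ones along the ideal. -/
def formalProjection (p q : ℕ) (hμ : 0 < μ) : formalInv p q →ₗ[ℂ⟦X⟧] (smoothFrame p q)⟦X⟧ where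
  toFun F := (exists_formalHom_sub_mem hμ F.2).choose
  map_add' F G := by
    have hF := (exists_formalHom_sub_mem hμ F.2).choose_spec
    have hG := (exists_formalHom_sub_mem hμ G.2).choose_spec
    have hS := (exists_formalHom_sub_mem hμ (F + G).2).choose_spec
    refine eq_of_sub_mem_momentumIdeal hμ hS.1 (Submodule.add_mem _ hF.1 hG.1) ?_
    have h := Submodule.sub_mem _ (Submodule.add_mem _ hF.2 hG.2) hS.2
    have e : ∀ a b c f g s : (smoothFrame p q)⟦X⟧, s = f + g →
        f - a + (g - b) - (s - c) = c - (a + b) := by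
      rintro a b c f g _ rfl
      abel
    rwa [e _ _ _ F.1 G.1 (F + G).1 rfl] at h
  map_smul' c F := by
    have hF := (exists_formalHom_sub_mem hμ F.2).choose_spec
    have hS := (exists_formalHom_sub_mem hμ (c • F).2).choose_spec
    refine eq_of_sub_mem_momentumIdeal hμ hS.1 (Submodule.smul_mem _ c hF.1) ?_
    have h := Submodule.sub_mem _ (Submodule.smul_mem _ c hF.2) hS.2
    have e : ∀ a b f s : (smoothFrame p q)⟦X⟧, s = c • f → c • (f - a) - (s - b) = b - c • a := by
      rintro a b f _ rfl
      rw [smul_sub]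
      abel
    rwa [e _ _ F.1 (c • F).1 rfl] at h

theorem isProjection_formalProjection (hμ : 0 < μ) :
    IsProjection μ (formalProjection p q hμ) where
  mem_hom F := (exists_formalHom_sub_mem hμ F.2).choose_spec.1
  sub_mem F := (exists_formalHom_sub_mem hμ F.2).choose_spec.2

theorem formalProjection_eq (hμ : 0 < μ) {F : formalInv p q} {H : (smoothFrame p q)⟦X⟧}
    (hH : H ∈ formalHom p q) (h : (F : (smoothFrame p q)⟦X⟧) - H ∈ momentumIdeal p q μ) :
    formalProjection p q hμ F = H := by
  have hF := isProjection_formalProjection (p := p) (q := q) hμ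
  refine eq_of_sub_mem_momentumIdeal hμ (hF.mem_hom F) hH ?_
  convert Submodule.sub_mem _ h (hF.sub_mem F) using 1
  abel

/-- The Wick product of invariant series. -/
def wickInvariant (p q : ℕ) :
    formalInv p q →ₗ[ℂ⟦X⟧] formalInv p q →ₗ[ℂ⟦X⟧] formalInv p q :=
  LinearMap.mk₂ ℂ⟦X⟧ (fun F G => ⟨wick p q F.1 G.1, wick_mem_formalInv F.2 G.2⟩)
    (fun F F' G => Subtype.ext (by simp)) (fun c F G => Subtype.ext (by simp))
    (fun F G G' => Subtype.ext (by simp)) (fun c F G => Subtype.ext (by simp))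

theorem coe_wickInvariant (F G : formalInv p q) :
    (wickInvariant p q F G : (smoothFrame p q)⟦X⟧) = wick p q F G := rfl

theorem isUnitalAlgebra_wickInvariant (p q : ℕ) :
    IsUnitalAlgebra (wickInvariant p q) (oneInv p q) where
  assoc F G H := Subtype.ext (wick_assoc F.1 G.1 H.1)
  one_mul F := Subtype.ext (one_wick F.1)
  mul_one F := Subtype.ext (wick_one F.1)

end Projection

/-! ### Homogeneous functions and functions on the Grassmann manifold -/

section Descent

variable {p q : ℕ}

/-- The function on the Grassmann manifold induced by a homogeneous function. -/
def descend (H : smoothFrame p q) (hH : H ∈ homogeneousFn p q) :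
    smoothFn (Model p q) (Grassmann p q) :=
  ⟨Quotient.lift H.1 (by
    rintro z _ ⟨g, rfl⟩
    exact (hH z g).symm), by
    intro x
    obtain ⟨a, ha⟩ : ∃ a, chartAt (Model p q) x = grassmannChart a := ⟨_, rfl⟩
    have h1 : ContDiff ℝ ∞ (fun w : Model p q => H.1 (chartInv a w)) := by
      refine contDiff_iff_contDiffAt.mpr fun w => ?_
      have h := ContDiffAt.comp (g := extend H.1)
        (f := fun w : Model p q => (chartInv a w).coord) w (contDiffAt_extend H (chartInv a w))
        (contDiff_chartInv a).contDiffAt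
      refine h.congr_of_eventuallyEq (Filter.Eventually.of_forall fun w => ?_)
      exact (extend_coord H.1 (chartInv a w)).symm
    have h2 : ContMDiffAt 𝓘(ℝ, Model p q) 𝓘(ℝ, Model p q) ∞ (chartAt (Model p q) x) x :=
      contMDiffOn_chart.contMDiffAt (chart_source_mem_nhds (Model p q) x)
    have h3 := h1.contMDiff.contMDiffAt.comp x h2
    refine h3.congr_of_eventuallyEq ?_
    filter_upwards [chart_source_mem_nhds (Model p q) x] with y hy
    rw [ha] at hy
    obtain ⟨z, rfl, hz⟩ := hy
    rw [Function.comp_apply, ha, grassmannChart_proj]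
    have h4 := proj_chartInv a z hz
    obtain ⟨g, hg⟩ := Quotient.exact (s := frameSetoid p q) h4
    exact (congrArg H.1 hg).trans (hH _ g)⟩

theorem pullback_descend (H : smoothFrame p q) (hH : H ∈ homogeneousFn p q) :
    pullback p q (descend H hH) = H := rfl

theorem pullback_apply (f : smoothFn (Model p q) (Grassmann p q)) (z : Frame p q) :
    (pullback p q f).1 z = f.1 (proj z) := rfl

theorem pullback_injective : Function.Injective (pullback p q) := by
  intro f g h
  refine Subtype.ext (funext fun x => ?_)
  obtain ⟨z, rfl⟩ := (isQuotientMap_proj p q).surjective x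
  exact congrArg (fun F : smoothFrame p q => F.1 z) h

theorem pullback_mem_homogeneousFn (f : smoothFn (Model p q) (Grassmann p q)) :
    pullback p q f ∈ homogeneousFn p q := fun z g => congrArg f.1 (proj_mul z g)

theorem coeff_formalPullback (f : (smoothFn (Model p q) (Grassmann p q))⟦X⟧) (n : ℕ) :
    PowerSeries.coeff n (formalPullback p q f) = pullback p q (PowerSeries.coeff n f) :=
  PowerSeries.coeff_map _ _ _

theorem formalPullback_mem_formalHom (f : (smoothFn (Model p q) (Grassmann p q))⟦X⟧) :
    formalPullback p q f ∈ formalHom p q := fun n => by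
  rw [coeff_formalPullback]
  exact pullback_mem_homogeneousFn _

theorem formalPullback_injective : Function.Injective (formalPullback p q) := by
  intro f g h
  ext1 n
  refine pullback_injective ?_
  rw [← coeff_formalPullback, h, coeff_formalPullback]

theorem formalPullback_smul (c : ℂ⟦X⟧) (f : (smoothFn (Model p q) (Grassmann p q))⟦X⟧) :
    formalPullback p q (c • f) = c • formalPullback p q f := by
  ext1 n
  simp only [coeff_formalPullback, coeff_smul_formal, map_sum, map_smul]

theorem formalPullback_C (f : smoothFn (Model p q) (Grassmann p q)) :
    formalPullback p q (PowerSeries.C f) = PowerSeries.C (pullback p q f) :=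
  PowerSeries.map_C _ _

theorem formalPullback_formalConj (f : (smoothFn (Model p q) (Grassmann p q))⟦X⟧) :
    formalPullback p q (formalConj f) = conjSeries (formalPullback p q f) := by
  ext1 n
  rw [coeff_formalPullback, coeff_conjSeries, coeff_formalPullback, formalConj,
    PowerSeries.coeff_mk]
  rfl

/-- The pullback of formal series, with values in the invariant series. -/
def invPullback (p q : ℕ) :
    (smoothFn (Model p q) (Grassmann p q))⟦X⟧ →ₗ[ℂ⟦X⟧] formalInv p q where
  toFun f := ⟨formalPullback p q f, formalHom_le_formalInv (formalPullback_mem_formalHom f)⟩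
  map_add' f g := Subtype.ext (map_add _ f g)
  map_smul' c f := Subtype.ext (formalPullback_smul c f)

theorem coe_invPullback (f : (smoothFn (Model p q) (Grassmann p q))⟦X⟧) :
    (invPullback p q f : (smoothFrame p q)⟦X⟧) = formalPullback p q f := rfl

/-- The series on the Grassmann manifold whose pullback is the projection along the ideal. -/
def reduceFun {μ : ℝ} (hμ : 0 < μ) (F : formalInv p q) :
    (smoothFn (Model p q) (Grassmann p q))⟦X⟧ :=
  PowerSeries.mk fun n => descend (PowerSeries.coeff n (formalProjection p q hμ F))
    ((isProjection_formalProjection hμ).mem_hom F n)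

theorem formalPullback_reduceFun {μ : ℝ} (hμ : 0 < μ) (F : formalInv p q) :
    formalPullback p q (reduceFun hμ F) = formalProjection p q hμ F := by
  ext1 n
  rw [coeff_formalPullback, reduceFun, PowerSeries.coeff_mk, pullback_descend]

/-- Reduction of invariant series to the Grassmann manifold, as a linear map. -/
def reduce (p q : ℕ) {μ : ℝ} (hμ : 0 < μ) :
    formalInv p q →ₗ[ℂ⟦X⟧] (smoothFn (Model p q) (Grassmann p q))⟦X⟧ where
  toFun := reduceFun hμ
  map_add' F G := formalPullback_injective (by
    simp only [map_add, formalPullback_reduceFun])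
  map_smul' c F := formalPullback_injective (by
    simp only [map_smul, formalPullback_smul, formalPullback_reduceFun, RingHom.id_apply])

theorem formalPullback_reduce {μ : ℝ} (hμ : 0 < μ) (F : formalInv p q) :
    formalPullback p q (reduce p q hμ F) = formalProjection p q hμ F :=
  formalPullback_reduceFun hμ F

theorem sub_formalPullback_reduce_mem {μ : ℝ} (hμ : 0 < μ) (F : formalInv p q) :
    (F : (smoothFrame p q)⟦X⟧) - formalPullback p q (reduce p q hμ F) ∈ momentumIdeal p q μ := by
  rw [formalPullback_reduce]
  exact (isProjection_formalProjection hμ).sub_mem F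

theorem reduce_eq {μ : ℝ} (hμ : 0 < μ) {F : formalInv p q}
    {f : (smoothFn (Model p q) (Grassmann p q))⟦X⟧}
    (h : (F : (smoothFrame p q)⟦X⟧) - formalPullback p q f ∈ momentumIdeal p q μ) :
    reduce p q hμ F = f :=
  formalPullback_injective ((formalPullback_reduce hμ F).trans
    (formalProjection_eq hμ (formalPullback_mem_formalHom f) h))

theorem reduce_invPullback {μ : ℝ} (hμ : 0 < μ)
    (f : (smoothFn (Model p q) (Grassmann p q))⟦X⟧) : reduce p q hμ (invPullback p q f) = f :=
  reduce_eq hμ (by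
    rw [coe_invPullback, sub_self]
    exact Submodule.zero_mem _)

/-- Reduction is linear over the functions on the Grassmann manifold. -/
theorem reduce_eq_C_mul {μ : ℝ} (hμ : 0 < μ) (a : smoothFn (Model p q) (Grassmann p q))
    {F G : formalInv p q}
    (h : (G : (smoothFrame p q)⟦X⟧) = PowerSeries.C (pullback p q a) * F) :
    reduce p q hμ G = PowerSeries.C a * reduce p q hμ F := by
  refine reduce_eq hμ ?_
  rw [h, map_mul, formalPullback_C, ← mul_sub]
  exact C_mul_mem_momentumIdeal (pullback_mem_homogeneousFn a) (sub_formalPullback_reduce_mem hμ F)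

theorem coeff_zero_reduce {μ : ℝ} (hμ : 0 < μ) {F : formalInv p q}
    {f : smoothFn (Model p q) (Grassmann p q)}
    (h : PowerSeries.coeff 0 (F : (smoothFrame p q)⟦X⟧) = pullback p q f) :
    PowerSeries.coeff 0 (reduce p q hμ F) = f := by
  have hF' : (PowerSeries.mk fun n => PowerSeries.coeff (n + 1) (F : (smoothFrame p q)⟦X⟧)) ∈
      formalInv p q := fun n => by
    rw [PowerSeries.coeff_mk]
    exact F.2 (n + 1)
  have h1 : F = invPullback p q (PowerSeries.C f) + (PowerSeries.X : ℂ⟦X⟧) •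
      (⟨_, hF'⟩ : formalInv p q) := Subtype.ext (by
    rw [Submodule.coe_add, Submodule.coe_smul, coe_invPullback, formalPullback_C, ← h]
    exact eq_C_add_X_smul _)
  rw [h1, map_add, map_smul, reduce_invPullback, map_add, coeff_X_smul_zero, add_zero,
    PowerSeries.coeff_zero_C]

/-- Reduction is compatible with division by the formal parameter. -/
theorem coeff_succ_reduce {μ : ℝ} (hμ : 0 < μ) {F G : formalInv p q}
    (h0 : PowerSeries.coeff 0 (F : (smoothFrame p q)⟦X⟧) = 0)
    (h : ∀ n, PowerSeries.coeff n (G : (smoothFrame p q)⟦X⟧) =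
      PowerSeries.coeff (n + 1) (F : (smoothFrame p q)⟦X⟧)) (n : ℕ) :
    PowerSeries.coeff (n + 1) (reduce p q hμ F) = PowerSeries.coeff n (reduce p q hμ G) := by
  have h1 : F = (PowerSeries.X : ℂ⟦X⟧) • G := Subtype.ext (by
    ext1 n
    rw [Submodule.coe_smul]
    cases n with
    | zero => rw [h0, coeff_X_smul_zero]
    | succ n => rw [coeff_X_smul_succ, h])
  rw [h1, map_smul, coeff_X_smul_succ]

/-- Reduction does not lower the order in the formal parameter. -/
theorem coeff_reduce_eq_zero {μ : ℝ} (hμ : 0 < μ) {n : ℕ} {F : formalInv p q}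
    (h : ∀ s ≤ n, PowerSeries.coeff s (F : (smoothFrame p q)⟦X⟧) = 0) :
    PowerSeries.coeff n (reduce p q hμ F) = 0 := by
  induction n generalizing F with
  | zero => exact coeff_zero_reduce hμ (by rw [h 0 le_rfl, map_zero])
  | succ n ih =>
    have hG : (PowerSeries.mk fun n => PowerSeries.coeff (n + 1) (F : (smoothFrame p q)⟦X⟧)) ∈
        formalInv p q := fun n => by
      rw [PowerSeries.coeff_mk]
      exact F.2 (n + 1)
    rw [coeff_succ_reduce hμ (G := ⟨_, hG⟩) (h 0 (Nat.zero_le _)) fun n => by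
      rw [PowerSeries.coeff_mk]]
    refine ih fun s hs => ?_
    rw [PowerSeries.coeff_mk]
    exact h (s + 1) (by omega)

/-- Where `x = μ`, the lowest order of an invariant series agrees with its reduction. -/
theorem coeff_zero_reduce_apply {μ : ℝ} (hμ : 0 < μ) (F : formalInv p q) {ζ : Frame p q}
    (hζ : ζ.1ᴴ * ζ.1 = (μ : ℂ) • (1 : Matrix (Fin p) (Fin p) ℂ)) :
    (PowerSeries.coeff 0 (reduce p q hμ F)).1 (proj ζ) =
      (PowerSeries.coeff 0 (F : (smoothFrame p q)⟦X⟧)).1 ζ := by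
  obtain ⟨K, -, h0, -⟩ := mem_momentumIdeal_iff.mp (sub_formalPullback_reduce_mem hμ F)
  rw [map_sub, coeff_formalPullback, sub_eq_iff_eq_add] at h0
  rw [h0, coe_add_apply, traceMomentum_apply_eq_zero (K 0) hζ, zero_add, pullback_apply]

theorem formalConj_reduce {μ : ℝ} (hμ : 0 < μ) {F G : formalInv p q}
    (h : (G : (smoothFrame p q)⟦X⟧) = conjSeries F) :
    formalConj (reduce p q hμ F) = reduce p q hμ G := by
  refine (reduce_eq hμ ?_).symm
  rw [formalPullback_formalConj, h, ← conjSeries_sub]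
  exact conjSeries_mem_momentumIdeal (sub_formalPullback_reduce_mem hμ F)

end Descent

/-! ### Differential operators -/

section DiffOp

variable {A : Type*} [CommRing A] [Algebra ℂ A]

/-- `D` is a differential operator of order less than `k`: its `k`-fold commutators with
multiplications vanish. In contrast to `IsDiffOp`, this includes the zero operator as the only one
of order less than `0`. -/
def DiffOpLT : ℕ → (A →ₗ[ℂ] A) → Prop
  | 0, D => D = 0
  | k + 1, D => ∀ a : A, DiffOpLT k ⁅D, LinearMap.mulLeft ℂ a⁆

theorem commutator_apply (D : A →ₗ[ℂ] A) (a f : A) :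
    ⁅D, LinearMap.mulLeft ℂ a⁆ f = D (a * f) - a * D f := rfl

theorem commutator_zero (a : A) : ⁅(0 : A →ₗ[ℂ] A), LinearMap.mulLeft ℂ a⁆ = 0 :=
  LinearMap.ext fun f => by
    rw [commutator_apply, LinearMap.zero_apply, LinearMap.zero_apply, mul_zero, sub_zero]

theorem commutator_add (D E : A →ₗ[ℂ] A) (a : A) : ⁅D + E, LinearMap.mulLeft ℂ a⁆ =
    ⁅D, LinearMap.mulLeft ℂ a⁆ + ⁅E, LinearMap.mulLeft ℂ a⁆ :=
  LinearMap.ext fun f => by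
    rw [commutator_apply, LinearMap.add_apply, LinearMap.add_apply, LinearMap.add_apply,
      commutator_apply, commutator_apply]
    ring

theorem isDiffOp_iff {k : ℕ} {D : A →ₗ[ℂ] A} : IsDiffOp k D ↔ DiffOpLT (k + 1) D := by
  induction k generalizing D with
  | zero => exact Iff.rfl
  | succ k ih => exact forall_congr' fun a => ih

theorem diffOpLT_zero (k : ℕ) : DiffOpLT k (0 : A →ₗ[ℂ] A) := by
  induction k with
  | zero => rfl
  | succ k ih =>
    intro a
    rwa [commutator_zero]

theorem DiffOpLT.add {k : ℕ} {D E : A →ₗ[ℂ] A} (hD : DiffOpLT k D) (hE : DiffOpLT k E) :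
    DiffOpLT k (D + E) := by
  induction k generalizing D E with
  | zero =>
    change D = 0 at hD
    change E = 0 at hE
    rw [hD, hE, add_zero]
    rfl
  | succ k ih =>
    intro a
    rw [commutator_add]
    exact ih (hD a) (hE a)

theorem DiffOpLT.sum {ι : Type*} {s : Finset ι} {k : ℕ} {D : ι → A →ₗ[ℂ] A}
    (h : ∀ i ∈ s, DiffOpLT k (D i)) : DiffOpLT k (∑ i ∈ s, D i) :=
  Finset.sum_induction D (DiffOpLT k) (fun _ _ => DiffOpLT.add) (diffOpLT_zero k) h

theorem DiffOpLT.comp_mulLeft {k : ℕ} {D : A →ₗ[ℂ] A} (hD : DiffOpLT k D) (b : A) :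
    DiffOpLT k (D ∘ₗ LinearMap.mulLeft ℂ b) := by
  induction k generalizing D with
  | zero =>
    change D = 0 at hD
    rw [hD, LinearMap.zero_comp]
    rfl
  | succ k ih =>
    intro a
    have h : ⁅D ∘ₗ LinearMap.mulLeft ℂ b, LinearMap.mulLeft ℂ a⁆ =
        ⁅D, LinearMap.mulLeft ℂ a⁆ ∘ₗ LinearMap.mulLeft ℂ b := LinearMap.ext fun f => by
      rw [commutator_apply, LinearMap.comp_apply, LinearMap.comp_apply, LinearMap.comp_apply,
        commutator_apply, LinearMap.mulLeft_apply, LinearMap.mulLeft_apply, mul_left_comm]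
    rw [h]
    exact ih (hD a)

theorem DiffOpLT.comp_derivation {k : ℕ} {D δ : A →ₗ[ℂ] A} (hD : DiffOpLT k D)
    (hδ : ∀ f g, δ (f * g) = δ f * g + f * δ g) : DiffOpLT (k + 1) (D ∘ₗ δ) := by
  induction k generalizing D with
  | zero =>
    change D = 0 at hD
    rw [hD, LinearMap.zero_comp]
    exact diffOpLT_zero _
  | succ k ih =>
    intro a
    have h : ⁅D ∘ₗ δ, LinearMap.mulLeft ℂ a⁆ =
        ⁅D, LinearMap.mulLeft ℂ a⁆ ∘ₗ δ + D ∘ₗ LinearMap.mulLeft ℂ (δ a) :=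
      LinearMap.ext fun f => by
        rw [commutator_apply, LinearMap.add_apply, LinearMap.comp_apply, LinearMap.comp_apply,
          LinearMap.comp_apply, LinearMap.comp_apply, commutator_apply, LinearMap.mulLeft_apply,
          hδ, map_add]
        ring
    rw [h]
    exact (ih (hD a)).add (hD.comp_mulLeft _)

theorem DiffOpLT.smul {k : ℕ} {D : A →ₗ[ℂ] A} (hD : DiffOpLT k D) (c : ℂ) :
    DiffOpLT k (c • D) := by
  have h : c • D = D ∘ₗ LinearMap.mulLeft ℂ (algebraMap ℂ A c) := LinearMap.ext fun f => by
    rw [LinearMap.smul_apply, LinearMap.comp_apply, LinearMap.mulLeft_apply, ← Algebra.smul_def,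
      map_smul]
  rw [h]
  exact hD.comp_mulLeft _

theorem diffOpLT_mulLeft (g : A) : DiffOpLT 1 (LinearMap.mulLeft ℂ g) := fun a =>
  LinearMap.ext fun f => by
    rw [commutator_apply, LinearMap.mulLeft_apply, LinearMap.mulLeft_apply, mul_left_comm, sub_self]
    rfl

end DiffOp

section WickOperators

variable {p q : ℕ}

theorem diffOpLT_wickPower_right (s : ℕ) (F : smoothFrame p q) :
    DiffOpLT (s + 1) (wickPower s F) := by
  induction s generalizing F with
  | zero => exact diffOpLT_mulLeft F
  | succ s ih =>
    have h : wickPower (s + 1) F = ∑ A : Fin p ⊕ Fin q, ∑ i : Fin p,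
        wickPower s (dz A i F) ∘ₗ dzbar A i :=
      LinearMap.ext fun G => by
        rw [wickPower_succ]
        simp only [LinearMap.sum_apply, LinearMap.comp_apply]
    rw [h]
    exact DiffOpLT.sum fun A _ => DiffOpLT.sum fun i _ =>
      (ih _).comp_derivation fun f g => dzbar_mul A i f g

theorem diffOpLT_wickPower_left (s : ℕ) (G : smoothFrame p q) :
    DiffOpLT (s + 1) ((wickPower (p := p) (q := q) s).flip G) := by
  induction s generalizing G with
  | zero =>
    have h : (wickPower (p := p) (q := q) 0).flip G = LinearMap.mulLeft ℂ G :=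
      LinearMap.ext fun F => mul_comm F G
    rw [h]
    exact diffOpLT_mulLeft G
  | succ s ih =>
    have h : (wickPower (p := p) (q := q) (s + 1)).flip G = ∑ A : Fin p ⊕ Fin q, ∑ i : Fin p,
        (wickPower (p := p) (q := q) s).flip (dzbar A i G) ∘ₗ dz A i :=
      LinearMap.ext fun F => by
        rw [LinearMap.flip_apply, wickPower_succ]
        simp only [LinearMap.sum_apply, LinearMap.comp_apply, LinearMap.flip_apply]
    rw [h]
    exact DiffOpLT.sum fun A _ => DiffOpLT.sum fun i _ =>
      (ih _).comp_derivation fun f g => dz_mul A i f g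

/-- Reduction is linear over the functions on the Grassmann manifold and over the formal
parameter, so commutators with multiplications can be taken before the reduction, and each of them
lowers the order of the coefficients. -/
theorem diffOpLT_of_eq_coeff_reduce {μ : ℝ} (hμ : 0 < μ) (r k : ℕ)
    {E : ℕ → smoothFrame p q →ₗ[ℂ] smoothFrame p q}
    (hE : ∀ s ≤ r, DiffOpLT (s + k - r) (E s))
    {D : smoothFn (Model p q) (Grassmann p q) →ₗ[ℂ] smoothFn (Model p q) (Grassmann p q)}
    (hD : ∀ f, ∃ F : formalInv p q,
      (∀ s, PowerSeries.coeff s (F : (smoothFrame p q)⟦X⟧) = E s (pullback p q f)) ∧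
      D f = PowerSeries.coeff r (reduce p q hμ F)) : DiffOpLT k D := by
  induction k generalizing E D with
  | zero =>
    refine LinearMap.ext fun f => ?_
    obtain ⟨F, hF, h⟩ := hD f
    rw [h, LinearMap.zero_apply]
    refine coeff_reduce_eq_zero hμ fun s hs => ?_
    have h0 := hE s hs
    rw [show s + 0 - r = 0 by omega] at h0
    change E s = 0 at h0
    rw [hF, h0, LinearMap.zero_apply]
  | succ k ih =>
    intro a
    refine ih (E := fun s => ⁅E s, LinearMap.mulLeft ℂ (pullback p q a)⁆) (fun s hs => ?_)
      fun f => ?_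
    · by_cases hk : s + k < r
      · have h0 := hE s hs
        rw [show s + (k + 1) - r = 0 by omega] at h0
        change E s = 0 at h0
        rw [h0, commutator_zero]
        exact diffOpLT_zero _
      · have h1 := hE s hs
        rw [show s + (k + 1) - r = (s + k - r) + 1 by omega] at h1
        exact h1 _
    · obtain ⟨F, hF, hDF⟩ := hD f
      obtain ⟨G, hG, hDG⟩ := hD (a * f)
      have hm : PowerSeries.C (pullback p q a) * (F : (smoothFrame p q)⟦X⟧) ∈ formalInv p q := by
        intro n z U
        rw [PowerSeries.coeff_C_mul, coe_mul_apply, coe_mul_apply, F.2 n z U,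
          homogeneousFn_le_invariantFn (pullback_mem_homogeneousFn a) z U]
      refine ⟨G - ⟨_, hm⟩, fun s => ?_, ?_⟩
      · rw [Submodule.coe_sub, map_sub, hG, PowerSeries.coeff_C_mul, hF, map_mul]
        rfl
      · rw [commutator_apply, hDG, hDF, map_sub (reduce p q hμ), map_sub,
          reduce_eq_C_mul hμ a (F := F) (G := ⟨_, hm⟩) rfl, PowerSeries.coeff_C_mul]

end WickOperators

/-! ### The reduced star product -/

section StarProduct

variable {p q : ℕ} {μ : ℝ}

/-- The star product on the Grassmann manifold obtained by reduction of the Wick product. -/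
def reducedStar (p q : ℕ) (hμ : 0 < μ) : (smoothFn (Model p q) (Grassmann p q))⟦X⟧ →ₗ[ℂ⟦X⟧]
    (smoothFn (Model p q) (Grassmann p q))⟦X⟧ →ₗ[ℂ⟦X⟧]
    (smoothFn (Model p q) (Grassmann p q))⟦X⟧ :=
  ((wickInvariant p q).compl₁₂ (invPullback p q) (invPullback p q)).compr₂ (reduce p q hμ)

theorem reducedStar_apply (hμ : 0 < μ) (f g : (smoothFn (Model p q) (Grassmann p q))⟦X⟧) :
    reducedStar p q hμ f g =
      reduce p q hμ (wickInvariant p q (invPullback p q f) (invPullback p q g)) := rfl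

/-- Reduction is multiplicative because the ideal is two-sided. -/
theorem reduce_wickInvariant (hμ : 0 < μ) (F G : formalInv p q) :
    reduce p q hμ (wickInvariant p q F G) =
      reducedStar p q hμ (reduce p q hμ F) (reduce p q hμ G) := by
  rw [reducedStar_apply]
  set F' := invPullback p q (reduce p q hμ F)
  set G' := invPullback p q (reduce p q hμ G)
  have h1 : (F : (smoothFrame p q)⟦X⟧) - F' ∈ momentumIdeal p q μ :=
    sub_formalPullback_reduce_mem hμ F
  have h2 : (G : (smoothFrame p q)⟦X⟧) - G' ∈ momentumIdeal p q μ :=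
    sub_formalPullback_reduce_mem hμ G
  refine reduce_eq hμ ?_
  have h3 := sub_formalPullback_reduce_mem hμ (wickInvariant p q F' G')
  have h4 := Submodule.add_mem _ (wick_mem_momentumIdeal' h1 G.2) (wick_mem_momentumIdeal F'.2 h2)
  have h5 := Submodule.add_mem _ h4 h3
  rw [map_sub, LinearMap.sub_apply, map_sub, coe_wickInvariant] at h5
  rw [coe_wickInvariant]
  convert h5 using 1
  abel

theorem reduce_oneInv (hμ : 0 < μ) : reduce p q hμ (oneInv p q) = 1 :=
  reduce_eq hμ (by
    rw [map_one]
    change (1 : (smoothFrame p q)⟦X⟧) - 1 ∈ _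
    rw [sub_self]
    exact Submodule.zero_mem _)

theorem reduce_surjective (hμ : 0 < μ) : Function.Surjective (reduce p q hμ) :=
  fun f => ⟨_, reduce_invPullback hμ f⟩

theorem isAlgebraEpimorphism_reduce (hμ : 0 < μ) :
    IsAlgebraEpimorphism (wickInvariant p q) (oneInv p q) (reducedStar p q hμ) 1
      (reduce p q hμ) where
  map_one := reduce_oneInv hμ
  map_mul := reduce_wickInvariant hμ
  surjective := reduce_surjective hμ

/-- The associativity and the unit are inherited along the epimorphism `reduce`. -/
theorem isUnitalAlgebra_reducedStar (hμ : 0 < μ) :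
    IsUnitalAlgebra (reducedStar p q hμ) 1 where
  assoc f g h := by
    obtain ⟨F, rfl⟩ := reduce_surjective hμ f
    obtain ⟨G, rfl⟩ := reduce_surjective hμ g
    obtain ⟨H, rfl⟩ := reduce_surjective hμ h
    simp only [← reduce_wickInvariant, (isUnitalAlgebra_wickInvariant p q).assoc]
  one_mul f := by
    obtain ⟨F, rfl⟩ := reduce_surjective hμ f
    rw [← reduce_oneInv hμ, ← reduce_wickInvariant, (isUnitalAlgebra_wickInvariant p q).one_mul]
  mul_one f := by
    obtain ⟨F, rfl⟩ := reduce_surjective hμ f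
    rw [← reduce_oneInv hμ, ← reduce_wickInvariant, (isUnitalAlgebra_wickInvariant p q).mul_one]

theorem coeff_wickInvariant_C (f g : smoothFn (Model p q) (Grassmann p q)) (n : ℕ) :
    PowerSeries.coeff n (wickInvariant p q (invPullback p q (PowerSeries.C f))
      (invPullback p q (PowerSeries.C g)) : (smoothFrame p q)⟦X⟧) =
      (1 / (n.factorial : ℂ)) • wickPower n (pullback p q f) (pullback p q g) := by
  rw [coe_wickInvariant, coe_invPullback, coe_invPullback, formalPullback_C, formalPullback_C]
  exact coeff_formalBilin_C_C _ _ _ n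

theorem cochain_reducedStar (hμ : 0 < μ) (r : ℕ) (f g : smoothFn (Model p q) (Grassmann p q)) :
    cochain (reducedStar p q hμ) r f g = PowerSeries.coeff r (reduce p q hμ (wickInvariant p q
      (invPullback p q (PowerSeries.C f)) (invPullback p q (PowerSeries.C g)))) := rfl

/-- The `r`-th cochain of a bilinear product over power series, as a bilinear map. -/
def cochainLinear {A : Type*} [CommRing A] [Algebra ℂ A]
    (m : A⟦X⟧ →ₗ[ℂ⟦X⟧] A⟦X⟧ →ₗ[ℂ⟦X⟧] A⟦X⟧) (r : ℕ) : A →ₗ[ℂ] A →ₗ[ℂ] A :=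
  have hC : ∀ (c : ℂ) (f : A), (PowerSeries.C (c • f) : A⟦X⟧) =
      (PowerSeries.C c : ℂ⟦X⟧) • PowerSeries.C f := fun c f => by
    rw [Algebra.smul_def, map_mul, Algebra.smul_def, PowerSeries.algebraMap_apply'',
      PowerSeries.map_C]
  have hS : ∀ (c : ℂ) (F : A⟦X⟧), PowerSeries.coeff r ((PowerSeries.C c : ℂ⟦X⟧) • F) =
      c • PowerSeries.coeff r F := fun c F => by
    rw [Algebra.smul_def, PowerSeries.algebraMap_apply'', PowerSeries.map_C,
      PowerSeries.coeff_C_mul, Algebra.smul_def]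
  LinearMap.mk₂ ℂ (cochain m r)
    (fun f f' g => by simp only [cochain, map_add, LinearMap.add_apply])
    (fun c f g => by
      unfold cochain
      rw [hC, map_smul, LinearMap.smul_apply, hS])
    (fun f g g' => by simp only [cochain, map_add])
    (fun c f g => by
      unfold cochain
      rw [hC, map_smul, hS])

theorem isBidifferential_reducedStar (hμ : 0 < μ) :
    IsBidifferential (reducedStar p q hμ) := by
  intro r
  refine ⟨r, fun g => ⟨⟨(cochainLinear (reducedStar p q hμ) r).flip g, isDiffOp_iff.mpr ?_,
    fun _ => rfl⟩, ⟨cochainLinear (reducedStar p q hμ) r g, isDiffOp_iff.mpr ?_, fun _ => rfl⟩⟩⟩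
  · refine diffOpLT_of_eq_coeff_reduce hμ r (r + 1)
      (E := fun s => (1 / (s.factorial : ℂ)) • (wickPower s).flip (pullback p q g))
      (fun s _ => ?_) fun f => ⟨_, fun s => coeff_wickInvariant_C f g s, rfl⟩
    rw [show s + (r + 1) - r = s + 1 by omega]
    exact (diffOpLT_wickPower_left s _).smul _
  · refine diffOpLT_of_eq_coeff_reduce hμ r (r + 1)
      (E := fun s => (1 / (s.factorial : ℂ)) • wickPower s (pullback p q g))
      (fun s _ => ?_) fun f => ⟨_, fun s => coeff_wickInvariant_C g f s, rfl⟩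
    rw [show s + (r + 1) - r = s + 1 by omega]
    exact (diffOpLT_wickPower_right s _).smul _

/-- The bracket given by the first order of the commutator. -/
def reducedBracket (p q : ℕ) (hμ : 0 < μ) (f g : smoothFn (Model p q) (Grassmann p q)) :
    smoothFn (Model p q) (Grassmann p q) :=
  (2 / Complex.I) • (cochain (reducedStar p q hμ) 1 f g - cochain (reducedStar p q hμ) 1 g f)

theorem poisson_eq (F G : smoothFrame p q) :
    poisson F G = (2 / Complex.I) • (wickPower 1 F G - wickPower 1 G F) := by
  simp only [poisson, wickPower_one, Finset.sum_sub_distrib]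

/-- The commutator of two homogeneous functions starts in first order, with the Poisson bracket,
which on `x = μ` is not changed by the reduction. -/
theorem isReducedBracket_reducedBracket (hμ : 0 < μ) :
    IsReducedBracket μ (reducedBracket p q hμ) := by
  intro f g ζ hζ
  set V : formalInv p q :=
    wickInvariant p q (invPullback p q (PowerSeries.C f)) (invPullback p q (PowerSeries.C g)) -
    wickInvariant p q (invPullback p q (PowerSeries.C g)) (invPullback p q (PowerSeries.C f))
    with hV
  have hc : ∀ n, PowerSeries.coeff n (V : (smoothFrame p q)⟦X⟧) = (1 / (n.factorial : ℂ)) •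
      (wickPower n (pullback p q f) (pullback p q g) -
        wickPower n (pullback p q g) (pullback p q f)) := by
    intro n
    rw [hV, Submodule.coe_sub, map_sub, coeff_wickInvariant_C, coeff_wickInvariant_C, smul_sub]
  have h0 : PowerSeries.coeff 0 (V : (smoothFrame p q)⟦X⟧) = 0 := by
    rw [hc, wickPower_zero, wickPower_zero, mul_comm, sub_self, smul_zero]
  have hW : (PowerSeries.mk fun n => PowerSeries.coeff (n + 1) (V : (smoothFrame p q)⟦X⟧)) ∈
      formalInv p q := fun n => by
    rw [PowerSeries.coeff_mk]
    exact V.2 (n + 1)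
  have h1 : reducedBracket p q hμ f g =
      (2 / Complex.I) • PowerSeries.coeff 0 (reduce p q hμ (⟨_, hW⟩ : formalInv p q)) := by
    rw [reducedBracket, cochain_reducedStar, cochain_reducedStar, ← map_sub, ← map_sub, ← hV,
      coeff_succ_reduce hμ (G := ⟨_, hW⟩) h0 fun n => by rw [PowerSeries.coeff_mk]]
  have h2 := coeff_zero_reduce_apply hμ ⟨_, hW⟩ hζ
  have h3 : (reducedBracket p q hμ f g).1 (proj ζ) = (2 / Complex.I) *
      (PowerSeries.coeff 0 (reduce p q hμ (⟨_, hW⟩ : formalInv p q))).1 (proj ζ) := by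
    rw [h1]
    rfl
  rw [h3, h2, PowerSeries.coeff_mk, hc, poisson_eq, coe_smul_apply, coe_smul_apply]
  simp

theorem isStarProduct_reducedStar (hμ : 0 < μ) :
    IsStarProduct (reducedBracket p q hμ) (reducedStar p q hμ) where
  algebra := isUnitalAlgebra_reducedStar hμ
  bidifferential := isBidifferential_reducedStar hμ
  order_zero f g := by
    rw [cochain_reducedStar]
    refine coeff_zero_reduce hμ ?_
    rw [coeff_wickInvariant_C, wickPower_zero, map_mul, Nat.factorial_zero, Nat.cast_one, div_one,
      one_smul]
  order_one f g := by
    rw [reducedBracket, smul_smul]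
    have h : Complex.I / 2 * (2 / Complex.I) = 1 := by
      field_simp
    rw [h, one_smul]
  conj f g := by
    rw [reducedStar_apply, reducedStar_apply]
    refine formalConj_reduce hμ ?_
    rw [coe_wickInvariant, coe_wickInvariant, conjSeries_wick]
    simp only [coe_invPullback, formalPullback_formalConj]

end StarProduct

end

end GrassmannStar

theorem mainTheorem3 (p q : ℕ) (μ : ℝ) (hμ : 0 < μ) :
    Disjoint (formalHom p q) (momentumIdeal p q μ) ∧
    formalHom p q ⊔ momentumIdeal p q μ = formalInv p q ∧
    ∃ wickInv : formalInv p q →ₗ[ℂ⟦X⟧] formalInv p q →ₗ[ℂ⟦X⟧] formalInv p q,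
      (∀ F G : formalInv p q, (wickInv F G : (smoothFrame p q)⟦X⟧) = wick p q F G) ∧
      IsUnitalAlgebra wickInv (oneInv p q) ∧
    ∃ P : formalInv p q →ₗ[ℂ⟦X⟧] (smoothFrame p q)⟦X⟧, IsProjection μ P ∧
    ∃ B : smoothFn (Model p q) (Grassmann p q) → smoothFn (Model p q) (Grassmann p q) →
        smoothFn (Model p q) (Grassmann p q), IsReducedBracket μ B ∧
    ∃ starProd : (smoothFn (Model p q) (Grassmann p q))⟦X⟧ →ₗ[ℂ⟦X⟧]
        (smoothFn (Model p q) (Grassmann p q))⟦X⟧ →ₗ[ℂ⟦X⟧]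
        (smoothFn (Model p q) (Grassmann p q))⟦X⟧,
      IsStarProduct B starProd ∧
    ∃ Φ : formalInv p q →ₗ[ℂ⟦X⟧] (smoothFn (Model p q) (Grassmann p q))⟦X⟧,
      (∀ F, formalPullback p q (Φ F) = P F) ∧
      IsAlgebraEpimorphism wickInv (oneInv p q) starProd 1 Φ :=
  ⟨disjoint_formalHom_momentumIdeal hμ, formalHom_sup_momentumIdeal hμ, wickInvariant p q,
    coe_wickInvariant, isUnitalAlgebra_wickInvariant p q, formalProjection p q hμ,
    isProjection_formalProjection hμ, reducedBracket p q hμ, isReducedBracket_reducedBracket hμ,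
    reducedStar p q hμ, isStarProduct_reducedStar hμ, reduce p q hμ, formalPullback_reduce hμ,
    isAlgebraEpimorphism_reduce hμ⟩
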